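/- Let $\mathbb K=\mathbb R$ or $\mathbb C$, and let $Q(u,x,y,z)$ be a function on $\mathbb K^4$ in the class $\mathcal F'$: it is affine linear in each argument, depends explicitly on each argument ($\partial_iQ\not\equiv0$), and satisfies $Q(u,x,y,z)=\tau\,Q(x,u,z,y)=\tau'\,Q(y,z,u,x)$ with $\tau,\tau'\in\{1,-1\}$. Consider the lattice equation $Q(u_{00},u_{10},u_{01},u_{11})=0$ for $u:\mathbb Z^2\to\mathbb K$, where $u_{ij}=u(n+i,m+j)$. Write $Q_{,i}$ for derivatives with respect to the $i$-th argument and put $h_{ij}=Q\,Q_{,ij}-Q_{,i}Q_{,j}$ (independent of the $i$-th and $j$-th arguments), $h_1(u,x)=h_{34}$, $h_2(u,y)=h_{24}$, $G(x,y)=h_{14}$. Suppose that for $i=1,2$ the matrix $$\mathcal G_i=\left.\begin{pmatrix} h_i(x,y)&G(x,z)&G(x,w)\\ h_{i,x}(x,y)&G_{,x}(x,z)&G_{,x}(x,w)\\ h_{i,xx}(x,y)&G_{,xx}(x,z)&G_{,xx}(x,w)\end{pmatrix}\right|_{x=0}$$ is invertible as a matrix of polynomials in the indeterminates $y,z,w$,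 i.e. its determinant is not the zero polynomial. Call a solution regular on a quadrilateral if all four $Q_{,i}\neq0$ there. Let $R(n,m,\cdot)$ be smooth (holomorphic if $\mathbb K=\mathbb C$) on an open set $\Omega_{n,m}\subset\mathbb K^5$ of values $(u_{00},u_{10},u_{01},u_{-10},u_{0\,-1})$, for every $(n,m)\in\mathbb Z^2$. Let $R\,\partial_{u_{00}}$ be a five-point generalized symmetry: for all $(n,m)$, $$Q_{,1}R+Q_{,2}\,\mathcal S_nR+Q_{,3}\,\mathcal S_mR+Q_{,4}\,\mathcal S_n\mathcal S_mR=0$$ (with $\mathcal S_n,\mathcal S_m$ the shifts in $n,m$, and $Q_{,i}$ evaluated on the quadrilateral at $(n,m)$) at all admissible values of $u$, i.e. values that satisfy the equation regularly on the quadrilateral at $(n,m)$ and on the four quadrilaterals adjacent to it, and for which all four values of $R$ are taken in its domain. Let $u^0$ be a solution on $\mathbb Z^2$ that is regular on every quadrilateral, satisfies $u^0_{10}\neq u^0_{-10}$ and $u^0_{01}\neq u^0_{0\,-1}$ at every lattice point, and has its five-point values in $\Omega_{n,m}$ for every $(n,m)$. Then there are functions $a(n)$, $b(m)$, $\psi(n,m,u)$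 such that, for every $(n,m)$ and for all five-point values near those of $u^0$ at $(n,m)$, $$R=a(n)\Big(\frac{h_1(u_{00},u_{10})}{u_{10}-u_{-10}}-\tfrac12h_{1,u_{10}}(u_{00},u_{10})\Big)+b(m)\Big(\frac{h_2(u_{00},u_{01})}{u_{01}-u_{0\,-1}}-\tfrac12h_{2,u_{01}}(u_{00},u_{01})\Big)+\tfrac12\psi(n,m,u_{00}),$$ that is, $R\,\partial_{u_{00}}=a(n)\mathbf v_n+b(m)\mathbf v_m+\frac12\psi(n,m,u_{00})\partial_{u_{00}}$; and for all $(u_{00},u_{10},u_{01},u_{11})$ near the values of $u^0$ on the quadrilateral at $(n,m)$ with $Q=0$, $$\begin{aligned}&(a(n)-a(n+1))\,h_1(u_{00},u_{10})^2\,\partial_{u_{10}}\!\left(\frac{G(u_{10},u_{01})}{h_1(u_{00},u_{10})}\right)+(b(m)-b(m+1))\,h_2(u_{00},u_{01})^2\,\partial_{u_{01}}\!\left(\frac{G(u_{10},u_{01})}{h_2(u_{00},u_{01})}\right)\\&+G(u_{10},u_{01})\,\psi(n,m,u_{00})+h_2(u_{00},u_{01})\,\psi(n+1,m,u_{10})+h_1(u_{00},u_{10})\,\psi(n,m+1,u_{01})-Q_{,u_{11}}^2\,\psi(n+1,m+1,u_{11})=0.\end{aligned}$$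 Moreover, if for all $(n,m)$ the function $R(n,m,\cdot)$ is analytic, and $\Omega_{n,m}$ and its slices $\{u_{00}=\mathrm{const}\}$ are connected or empty (for instance, if $\mathbb K=\mathbb C$ and $\Omega_{n,m}$ is the complement of an algebraic hypersurface), then, with the same $a,b,\psi$, the formula for $R$ holds at all points of $\Omega_{n,m}$ with $u_{10}\ne u_{-10}$, $u_{01}\ne u_{0\,-1}$, and the determining equation holds at $(n,m)$ for all admissible values of $u$. -/

import Mathlib

open Filter Topology
open scoped ContDiff

noncomputable section

namespace QuadLattice

variable {𝕜 : Type*} [RCLike 𝕜]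

/-- Partial derivative of `F` with respect to its `i`-th argument. The arguments of `Q` are ordered
as `(u₀₀, u₁₀, u₀₁, u₁₁)`, so the indices `0, 1, 2, 3` stand for the usual `1, 2, 3, 4`. -/
def pd (F : (Fin 4 → 𝕜) → 𝕜) (i : Fin 4) (v : Fin 4 → 𝕜) : 𝕜 :=
  deriv (fun t => F (Function.update v i t)) (v i)

/-- The class `F'` of autonomous quadrilateral equations `Q(u₀₀, u₁₀, u₀₁, u₁₁) = 0`. -/
structure IsClassFPrime (Q : (Fin 4 → 𝕜) → 𝕜) : Prop where
  /-- `Q` is affine linear in each of its four arguments. -/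
  affine : ∀ (i : Fin 4) (v : Fin 4 → 𝕜), ∃ p q : 𝕜, ∀ t : 𝕜, Q (Function.update v i t) = p + q * t
  /-- `Q` depends explicitly on each of its four arguments. -/
  depends : ∀ i : Fin 4, ∃ v : Fin 4 → 𝕜, pd Q i v ≠ 0
  /-- Reflection in the `n` direction. -/
  symm_n : ∃ τ : 𝕜, (τ = 1 ∨ τ = -1) ∧ ∀ u x y z : 𝕜, Q ![u, x, y, z] = τ * Q ![x, u, z, y]
  /-- Reflection in the `m` direction. -/
  symm_m : ∃ τ' : 𝕜, (τ' = 1 ∨ τ' = -1) ∧ ∀ u x y z : 𝕜, Q ![u, x, y, z] = τ' * Q ![y, z, u, x]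

/-- `Q Q_{,ij} - Q_{,i} Q_{,j}`. For an affine linear `Q` it does not depend on the `i`-th and the
`j`-th argument. -/
def hPoly (Q : (Fin 4 → 𝕜) → 𝕜) (i j : Fin 4) (v : Fin 4 → 𝕜) : 𝕜 :=
  Q v * pd (pd Q i) j v - pd Q i v * pd Q j v

/-- The polynomial of the edges in the `n` direction. -/
def h₁ (Q : (Fin 4 → 𝕜) → 𝕜) (x y : 𝕜) : 𝕜 := hPoly Q 2 3 ![x, y, 0, 0]

/-- The polynomial of the edges in the `m` direction. -/
def h₂ (Q : (Fin 4 → 𝕜) → 𝕜) (x y : 𝕜) : 𝕜 := hPoly Q 1 3 ![x, 0, y, 0]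

/-- The polynomial of the diagonals. -/
def G (Q : (Fin 4 → 𝕜) → 𝕜) (x y : 𝕜) : 𝕜 := hPoly Q 0 3 ![0, x, y, 0]

/-- The matrix built from `h` (one of `h₁`, `h₂`), `G` and their `x`-derivatives at `x = 0`. -/
def gMatrix (Q : (Fin 4 → 𝕜) → 𝕜) (h : 𝕜 → 𝕜 → 𝕜) (y z w : 𝕜) : Matrix (Fin 3) (Fin 3) 𝕜 :=
  !![h 0 y, G Q 0 z, G Q 0 w;
     deriv (fun x => h x y) 0, deriv (fun x => G Q x z) 0, deriv (fun x => G Q x w) 0;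
     iteratedDeriv 2 (fun x => h x y) 0, iteratedDeriv 2 (fun x => G Q x z) 0,
       iteratedDeriv 2 (fun x => G Q x w) 0]

/-- Invertibility of the matrix of polynomials in the indeterminates `y, z, w` (over the field of
rational functions): its determinant is not the zero polynomial. As the field is infinite, this
means that it is invertible for some values of `y, z, w`. -/
def GInvertible (Q : (Fin 4 → 𝕜) → 𝕜) (h : 𝕜 → 𝕜 → 𝕜) : Prop :=
  ∃ y z w : 𝕜, IsUnit (gMatrix Q h y z w)

/-- The values `(u₀₀, u₁₀, u₀₁, u₁₁)` of `u` on the elementary quadrilateral at `(n, m)`. -/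
def quad (u : ℤ → ℤ → 𝕜) (n m : ℤ) : Fin 4 → 𝕜 :=
  ![u n m, u (n + 1) m, u n (m + 1), u (n + 1) (m + 1)]

/-- The five values `(u₀₀, u₁₀, u₀₁, u₋₁₀, u₀₋₁)` of `u` around `(n, m)`. -/
def cross (u : ℤ → ℤ → 𝕜) (n m : ℤ) : Fin 5 → 𝕜 :=
  ![u n m, u (n + 1) m, u n (m + 1), u (n - 1) m, u n (m - 1)]

/-- `u` satisfies the equation on the quadrilateral at `(n, m)`, at a regular point: the equation
can be solved there for the value at any one of the four vertices. -/
def SolvesAt (Q : (Fin 4 → 𝕜) → 𝕜) (u : ℤ → ℤ → 𝕜) (n m : ℤ) : Prop :=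
  Q (quad u n m) = 0 ∧ ∀ i, pd Q i (quad u n m) ≠ 0

/-- A solution on the patch of lattice points that enter the symmetry condition at `(n, m)`: the
equation holds on the quadrilateral at `(n, m)` and on the four adjacent ones, and the five values
around each vertex of the quadrilateral at `(n, m)` lie in the domain of the characteristic. -/
structure AdmissibleAt (Q : (Fin 4 → 𝕜) → 𝕜) (Ω : ℤ → ℤ → Set (Fin 5 → 𝕜)) (n m : ℤ)
    (u : ℤ → ℤ → 𝕜) : Prop where
  solves : SolvesAt Q u n m
  solves_right : SolvesAt Q u (n + 1) m
  solves_up : SolvesAt Q u n (m + 1)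
  solves_left : SolvesAt Q u (n - 1) m
  solves_down : SolvesAt Q u n (m - 1)
  mem₀₀ : cross u n m ∈ Ω n m
  mem₁₀ : cross u (n + 1) m ∈ Ω (n + 1) m
  mem₀₁ : cross u n (m + 1) ∈ Ω n (m + 1)
  mem₁₁ : cross u (n + 1) (m + 1) ∈ Ω (n + 1) (m + 1)

/-- `R(n, m, u₀₀, u₁₀, u₀₁, u₋₁₀, u₀₋₁) ∂_{u₀₀}`, with `R n m` defined on `Ω n m`, is a five point
generalized symmetry of `Q = 0`: the prolonged vector field annihilates `Q` on solutions. -/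
def IsFivePointSymmetry (Q : (Fin 4 → 𝕜) → 𝕜) (Ω : ℤ → ℤ → Set (Fin 5 → 𝕜))
    (R : ℤ → ℤ → (Fin 5 → 𝕜) → 𝕜) : Prop :=
  ∀ (n m : ℤ) (u : ℤ → ℤ → 𝕜), AdmissibleAt Q Ω n m u →
    pd Q 0 (quad u n m) * R n m (cross u n m)
      + pd Q 1 (quad u n m) * R (n + 1) m (cross u (n + 1) m)
      + pd Q 2 (quad u n m) * R n (m + 1) (cross u n (m + 1))
      + pd Q 3 (quad u n m) * R (n + 1) (m + 1) (cross u (n + 1) (m + 1)) = 0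

/-- The characteristic of `v_n`, at `p = (u₀₀, u₁₀, u₀₁, u₋₁₀, u₀₋₁)`. -/
def charN (Q : (Fin 4 → 𝕜) → 𝕜) (p : Fin 5 → 𝕜) : 𝕜 :=
  h₁ Q (p 0) (p 1) / (p 1 - p 3) - 1 / 2 * deriv (fun t => h₁ Q (p 0) t) (p 1)

/-- The characteristic of `v_m`, at `p = (u₀₀, u₁₀, u₀₁, u₋₁₀, u₀₋₁)`. -/
def charM (Q : (Fin 4 → 𝕜) → 𝕜) (p : Fin 5 → 𝕜) : 𝕜 :=
  h₂ Q (p 0) (p 2) / (p 2 - p 4) - 1 / 2 * deriv (fun t => h₂ Q (p 0) t) (p 2)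

/-- The characteristic of `a(n) v_n + b(m) v_m + ½ ψ(n, m, u₀₀) ∂_{u₀₀}`. -/
def combination (Q : (Fin 4 → 𝕜) → 𝕜) (a b : ℤ → 𝕜) (ψ : ℤ → ℤ → 𝕜 → 𝕜) (n m : ℤ)
    (p : Fin 5 → 𝕜) : 𝕜 :=
  a n * charN Q p + b m * charM Q p + 1 / 2 * ψ n m (p 0)

/-- The determining equation for `a`, `b`, `ψ` at `v = (u₀₀, u₁₀, u₀₁, u₁₁)`. -/
def DeterminingEq (Q : (Fin 4 → 𝕜) → 𝕜) (a b : ℤ → 𝕜) (ψ : ℤ → ℤ → 𝕜 → 𝕜) (n m : ℤ)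
    (v : Fin 4 → 𝕜) : Prop :=
  (a n - a (n + 1)) * h₁ Q (v 0) (v 1) ^ 2
        * deriv (fun t => G Q t (v 2) / h₁ Q (v 0) t) (v 1)
    + (b m - b (m + 1)) * h₂ Q (v 0) (v 2) ^ 2
        * deriv (fun t => G Q (v 1) t / h₂ Q (v 0) t) (v 2)
    + G Q (v 1) (v 2) * ψ n m (v 0)
    + h₂ Q (v 0) (v 2) * ψ (n + 1) m (v 1)
    + h₁ Q (v 0) (v 1) * ψ n (m + 1) (v 2)
    - pd Q 3 v ^ 2 * ψ (n + 1) (m + 1) (v 3) = 0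

end QuadLattice

end

/-! Write `χ` for the characteristic of `v_n` and `F` for `∂R/∂u₋₁₀` divided by `∂χ/∂u₋₁₀ = h₁(u₀₀,
u₁₀)/(u₁₀ - u₋₁₀)²` (`leftRatio`). Among the four values of `R` in the symmetry condition only those
at `(n, m)` and `(n, m+1)` involve `u₋₁₀`, the second through `u₋₁₁`. Differentiation with respect
to `u₋₁₀` gives an identity between two derivatives of `R`, which says that `F` takes the same value
at `(n, m)` and at `(n, m+1)` (`eventually_leftRatio_eq`).

The two sides of this identity have different arguments, so `F` can depend on `u₀₀, u₁₀, u₋₁₀` only.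
Differentiating it again, now along `u₀₁` with the lower row fixed, annihilates the upper side and
gives `h₂(x, ξ) F_ξ - G(x, η) F_η - G(x, ζ) F_ζ = 0`, where `(ξ, η, ζ)` are the arguments of `F` and
`x = u₀₀` is independent of them. The left side is quadratic in `x`, so its three Taylor
coefficients vanish: the matrix `𝒢₂` annihilates `(F_ξ, -F_η, -F_ζ)`. Its determinant is a nonzero
polynomial, hence nonzero on a dense set, so `F` is locally a constant, and this constant `a(n)`
does not depend on `m` (`eventually_fderiv_eq_zero`, `exists_leftRatio_eq`).

Reflection of the first lattice direction gives the analogous formula for `∂R/∂u₁₀`, and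
compatibility of the two derivatives fixes its coefficient as `-a(n)` (`coefficient_eq_neg`).
Interchange of the lattice directions gives `b(m)`, with `𝒢₁` in place of `𝒢₂`. Therefore `R - a v_n
- b v_m` depends on `u₀₀` only, and this remainder is `ψ/2` (`exists_combination`).

For the determining equation, a polarization identity shows that the contribution of `v_n` at two
vertically neighbouring vertices to the linearized equation does not depend on values outside the
quadrilateral (`polarN_add_polarN`). It is a multiple of `crossN`, and `Q_{,4}` times `crossN` is
the derivative of `G/h₁` in the determining equation (`crossN_eq_deriv`). For analytic `R` the
derivative formulas continue to all of `Ω` (`slotDeriv_eq_of_analyticOnNhd`), and connected slices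
make `ψ` a single function of `u₀₀`. -/

noncomputable section

namespace QuadLattice

variable {𝕜 : Type*} [RCLike 𝕜]

/-! ### Multi-affine functions in coordinates -/

/-- The general function of four arguments that is affine linear in each of them. The coefficient of
`∏ i ∈ S, v i` is `c b`, where `S` is the set of the binary digits of `b`. -/
def multiAffine (c : Fin 16 → 𝕜) (v : Fin 4 → 𝕜) : 𝕜 :=
  c 0 + c 1 * v 0 + c 2 * v 1 + c 3 * v 0 * v 1 + c 4 * v 2 + c 5 * v 0 * v 2 + c 6 * v 1 * v 2
  + c 7 * v 0 * v 1 * v 2 + c 8 * v 3 + c 9 * v 0 * v 3 + c 10 * v 1 * v 3 + c 11 * v 0 * v 1 *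
  v 3 + c 12 * v 2 * v 3 + c 13 * v 0 * v 2 * v 3 + c 14 * v 1 * v 2 * v 3 + c 15 * v 0 * v 1 *
  v 2 * v 3

/-- The first partial derivatives of `multiAffine c`. -/
def multiAffineD (c : Fin 16 → 𝕜) : Fin 4 → (Fin 4 → 𝕜) → 𝕜 :=
  ![fun v => c 1 + c 3 * v 1 + c 5 * v 2 + c 7 * v 1 * v 2 + c 9 * v 3 + c 11 * v 1 * v 3 + c 13 * v 2
      * v 3 + c 15 * v 1 * v 2 * v 3,
    fun v => c 2 + c 3 * v 0 + c 6 * v 2 + c 7 * v 0 * v 2 + c 10 * v 3 + c 11 * v 0 * v 3 + c 14 * v 2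
      * v 3 + c 15 * v 0 * v 2 * v 3,
    fun v => c 4 + c 5 * v 0 + c 6 * v 1 + c 7 * v 0 * v 1 + c 12 * v 3 + c 13 * v 0 * v 3 + c 14 * v 1
      * v 3 + c 15 * v 0 * v 1 * v 3,
    fun v => c 8 + c 9 * v 0 + c 10 * v 1 + c 11 * v 0 * v 1 + c 12 * v 2 + c 13 * v 0 * v 2 + c 14 * v
      1 * v 2 + c 15 * v 0 * v 1 * v 2]

/-- The second partial derivatives of `multiAffine c`. -/
def multiAffineDD (c : Fin 16 → 𝕜) : Fin 4 → Fin 4 → (Fin 4 → 𝕜) → 𝕜 :=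
  ![![fun v => 0 * v 0,
      fun v => c 3 + c 7 * v 2 + c 11 * v 3 + c 15 * v 2 * v 3,
      fun v => c 5 + c 7 * v 1 + c 13 * v 3 + c 15 * v 1 * v 3,
      fun v => c 9 + c 11 * v 1 + c 13 * v 2 + c 15 * v 1 * v 2],
    ![fun v => c 3 + c 7 * v 2 + c 11 * v 3 + c 15 * v 2 * v 3,
      fun v => 0 * v 0,
      fun v => c 6 + c 7 * v 0 + c 14 * v 3 + c 15 * v 0 * v 3,
      fun v => c 10 + c 11 * v 0 + c 14 * v 2 + c 15 * v 0 * v 2],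
    ![fun v => c 5 + c 7 * v 1 + c 13 * v 3 + c 15 * v 1 * v 3,
      fun v => c 6 + c 7 * v 0 + c 14 * v 3 + c 15 * v 0 * v 3,
      fun v => 0 * v 0,
      fun v => c 12 + c 13 * v 0 + c 14 * v 1 + c 15 * v 0 * v 1],
    ![fun v => c 9 + c 11 * v 1 + c 13 * v 2 + c 15 * v 1 * v 2,
      fun v => c 10 + c 11 * v 0 + c 14 * v 2 + c 15 * v 0 * v 2,
      fun v => c 12 + c 13 * v 0 + c 14 * v 1 + c 15 * v 0 * v 1,
      fun v => 0 * v 0]]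

theorem vec4_eta {α : Type*} (v : Fin 4 → α) : ![v 0, v 1, v 2, v 3] = v := by
  ext i; fin_cases i <;> rfl

theorem vec5_eta {α : Type*} (p : Fin 5 → α) : ![p 0, p 1, p 2, p 3, p 4] = p := by
  ext i; fin_cases i <;> rfl

theorem update_vec4_zero {α : Type*} (a b c d t : α) : Function.update ![a, b, c, d] 0 t = ![t, b, c, d] := by
  ext i; fin_cases i <;> simp

theorem update_vec4_one {α : Type*} (a b c d t : α) : Function.update ![a, b, c, d] 1 t = ![a, t, c, d] := by
  ext i; fin_cases i <;> simp

theorem update_vec4_two {α : Type*} (a b c d t : α) : Function.update ![a, b, c, d] 2 t = ![a, b, t, d] := by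
  ext i; fin_cases i <;> simp

theorem update_vec4_three {α : Type*} (a b c d t : α) :
    Function.update ![a, b, c, d] 3 t = ![a, b, c, t] := by
  ext i; fin_cases i <;> simp

theorem exists_multiAffine {Q : (Fin 4 → 𝕜) → 𝕜} (hQ : IsClassFPrime Q) :
    ∃ c, Q = multiAffine c := by
  have key : ∀ (i : Fin 4) (v : Fin 4 → 𝕜) (t : 𝕜), Q (Function.update v i t) =
      Q (Function.update v i 0) * (1 - t) + Q (Function.update v i 1) * t := by
    intro i v t
    obtain ⟨p, q, h⟩ := hQ.affine i v
    rw [h, h, h]; ring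
  have k0 : ∀ u x y z : 𝕜, Q ![u, x, y, z] = Q ![0, x, y, z] * (1 - u) + Q ![1, x, y, z] * u := by
    intro u x y z
    simpa only [update_vec4_zero] using key 0 ![0, x, y, z] u
  have k1 : ∀ u x y z : 𝕜, Q ![u, x, y, z] = Q ![u, 0, y, z] * (1 - x) + Q ![u, 1, y, z] * x := by
    intro u x y z
    simpa only [update_vec4_one] using key 1 ![u, 0, y, z] x
  have k2 : ∀ u x y z : 𝕜, Q ![u, x, y, z] = Q ![u, x, 0, z] * (1 - y) + Q ![u, x, 1, z] * y := by
    intro u x y z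
    simpa only [update_vec4_two] using key 2 ![u, x, 0, z] y
  have k3 : ∀ u x y z : 𝕜, Q ![u, x, y, z] = Q ![u, x, y, 0] * (1 - z) + Q ![u, x, y, 1] * z := by
    intro u x y z
    simpa only [update_vec4_three] using key 3 ![u, x, y, 0] z
  -- The coefficients come from inclusion–exclusion over the values of `Q` at the sixteen points of
  -- `{0, 1}⁴`.
  refine ⟨![Q ![0, 0, 0, 0],
    Q ![1, 0, 0, 0] - Q ![0, 0, 0, 0],
    Q ![0, 1, 0, 0] - Q ![0, 0, 0, 0],
    Q ![1, 1, 0, 0] - Q ![1, 0, 0, 0] - Q ![0, 1, 0, 0] + Q ![0, 0, 0, 0],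
    Q ![0, 0, 1, 0] - Q ![0, 0, 0, 0],
    Q ![1, 0, 1, 0] - Q ![1, 0, 0, 0] - Q ![0, 0, 1, 0] + Q ![0, 0, 0, 0],
    Q ![0, 1, 1, 0] - Q ![0, 1, 0, 0] - Q ![0, 0, 1, 0] + Q ![0, 0, 0, 0],
    Q ![1, 1, 1, 0] - Q ![1, 1, 0, 0] - Q ![1, 0, 1, 0] - Q ![0, 1, 1, 0] + Q ![1, 0, 0, 0] +
      Q ![0, 1, 0, 0] + Q ![0, 0, 1, 0] - Q ![0, 0, 0, 0],
    Q ![0, 0, 0, 1] - Q ![0, 0, 0, 0],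
    Q ![1, 0, 0, 1] - Q ![1, 0, 0, 0] - Q ![0, 0, 0, 1] + Q ![0, 0, 0, 0],
    Q ![0, 1, 0, 1] - Q ![0, 1, 0, 0] - Q ![0, 0, 0, 1] + Q ![0, 0, 0, 0],
    Q ![1, 1, 0, 1] - Q ![1, 1, 0, 0] - Q ![1, 0, 0, 1] - Q ![0, 1, 0, 1] + Q ![1, 0, 0, 0] +
      Q ![0, 1, 0, 0] + Q ![0, 0, 0, 1] - Q ![0, 0, 0, 0],
    Q ![0, 0, 1, 1] - Q ![0, 0, 1, 0] - Q ![0, 0, 0, 1] + Q ![0, 0, 0, 0],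
    Q ![1, 0, 1, 1] - Q ![1, 0, 1, 0] - Q ![1, 0, 0, 1] - Q ![0, 0, 1, 1] + Q ![1, 0, 0, 0] +
      Q ![0, 0, 1, 0] + Q ![0, 0, 0, 1] - Q ![0, 0, 0, 0],
    Q ![0, 1, 1, 1] - Q ![0, 1, 1, 0] - Q ![0, 1, 0, 1] - Q ![0, 0, 1, 1] + Q ![0, 1, 0, 0] +
      Q ![0, 0, 1, 0] + Q ![0, 0, 0, 1] - Q ![0, 0, 0, 0],
    Q ![1, 1, 1, 1] - Q ![1, 1, 1, 0] - Q ![1, 1, 0, 1] - Q ![1, 0, 1, 1] - Q ![0, 1, 1, 1] +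
      Q ![1, 1, 0, 0] + Q ![1, 0, 1, 0] + Q ![1, 0, 0, 1] + Q ![0, 1, 1, 0] + Q ![0, 1, 0, 1] +
      Q ![0, 0, 1, 1] - Q ![1, 0, 0, 0] - Q ![0, 1, 0, 0] - Q ![0, 0, 1, 0] - Q ![0, 0, 0, 1] +
      Q ![0, 0, 0, 0]], ?_⟩
  funext v
  obtain ⟨u, x, y, z, rfl⟩ : ∃ u x y z, v = ![u, x, y, z] :=
    ⟨v 0, v 1, v 2, v 3, by ext i; fin_cases i <;> rfl⟩
  rw [k0, k1, k1 1, k2, k2 0 1, k2 1 0, k2 1 1, k3, k3 0 0 1, k3 0 1 0, k3 0 1 1, k3 1 0 0, k3 1 0 1,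
    k3 1 1 0, k3 1 1 1]
  simp only [multiAffine, Matrix.cons_val]
  ring

theorem pd_multiAffine (c : Fin 16 → 𝕜) (i : Fin 4) :
    pd (multiAffine c) i = multiAffineD c i := by
  funext v
  obtain ⟨u, x, y, z, rfl⟩ : ∃ u x y z, v = ![u, x, y, z] := ⟨_, _, _, _, (vec4_eta v).symm⟩
  have key : ∀ t, multiAffine c (Function.update ![u, x, y, z] i t) =
      multiAffine c (Function.update ![u, x, y, z] i 0) + multiAffineD c i ![u, x, y, z] * t := by
    intro t
    fin_cases i <;> simp only [Fin.reduceFinMk, Fin.zero_eta, Fin.mk_one, update_vec4_zero,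
      update_vec4_one, update_vec4_two,
      update_vec4_three, multiAffine, multiAffineD, Matrix.cons_val] <;> ring
  rw [pd, funext key]
  simp

theorem pd_multiAffineD (c : Fin 16 → 𝕜) (i j : Fin 4) :
    pd (multiAffineD c i) j = multiAffineDD c i j := by
  funext v
  obtain ⟨u, x, y, z, rfl⟩ : ∃ u x y z, v = ![u, x, y, z] := ⟨_, _, _, _, (vec4_eta v).symm⟩
  have key : ∀ t, multiAffineD c i (Function.update ![u, x, y, z] j t) =
      multiAffineD c i (Function.update ![u, x, y, z] j 0)
        + multiAffineDD c i j ![u, x, y, z] * t := by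
    intro t
    fin_cases i <;> fin_cases j <;> simp only [Fin.reduceFinMk, Fin.zero_eta, Fin.mk_one,
      update_vec4_zero, update_vec4_one, update_vec4_two,
      update_vec4_three, multiAffineDD, multiAffineD, Matrix.cons_val] <;> ring
  rw [pd, funext key]
  simp

theorem hPoly_multiAffine (c : Fin 16 → 𝕜) (i j : Fin 4) (v : Fin 4 → 𝕜) :
    hPoly (multiAffine c) i j v =
      multiAffine c v * multiAffineDD c i j v - multiAffineD c i v * multiAffineD c j v := by
  rw [hPoly, pd_multiAffine, pd_multiAffineD, pd_multiAffine]

variable {Q : (Fin 4 → 𝕜) → 𝕜}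

/-! ### Edge and diagonal polynomials and their symmetries -/

namespace IsClassFPrime

theorem continuous (hQ : IsClassFPrime Q) : Continuous Q := by
  obtain ⟨c, rfl⟩ := exists_multiAffine hQ
  unfold multiAffine
  fun_prop

theorem continuous_pd (hQ : IsClassFPrime Q) (i : Fin 4) : Continuous (pd Q i) := by
  obtain ⟨c, rfl⟩ := exists_multiAffine hQ
  rw [pd_multiAffine]
  fin_cases i <;> simp only [Fin.reduceFinMk, Fin.zero_eta, Fin.mk_one, multiAffineD,
    Matrix.cons_val] <;> fun_prop

/-- Derivatives of an affine function are differences of its values. In this form the reflection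
symmetries of `Q` pass to its derivatives by rewriting. -/
theorem pd_zero_eq (hQ : IsClassFPrime Q) (u x y z : 𝕜) :
    pd Q 0 ![u, x, y, z] = Q ![1, x, y, z] - Q ![0, x, y, z] := by
  obtain ⟨c, rfl⟩ := exists_multiAffine hQ
  simp only [pd_multiAffine, multiAffine, multiAffineD, Matrix.cons_val]; ring

theorem pd_one_eq (hQ : IsClassFPrime Q) (u x y z : 𝕜) :
    pd Q 1 ![u, x, y, z] = Q ![u, 1, y, z] - Q ![u, 0, y, z] := by
  obtain ⟨c, rfl⟩ := exists_multiAffine hQ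
  simp only [pd_multiAffine, multiAffine, multiAffineD, Matrix.cons_val]; ring

theorem pd_two_eq (hQ : IsClassFPrime Q) (u x y z : 𝕜) :
    pd Q 2 ![u, x, y, z] = Q ![u, x, 1, z] - Q ![u, x, 0, z] := by
  obtain ⟨c, rfl⟩ := exists_multiAffine hQ
  simp only [pd_multiAffine, multiAffine, multiAffineD, Matrix.cons_val]; ring

theorem pd_three_eq (hQ : IsClassFPrime Q) (u x y z : 𝕜) :
    pd Q 3 ![u, x, y, z] = Q ![u, x, y, 1] - Q ![u, x, y, 0] := by
  obtain ⟨c, rfl⟩ := exists_multiAffine hQ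
  simp only [pd_multiAffine, multiAffine, multiAffineD, Matrix.cons_val]; ring

theorem eq_add_pd_three (hQ : IsClassFPrime Q) (u x y z : 𝕜) :
    Q ![u, x, y, z] = Q ![u, x, y, 0] + pd Q 3 ![u, x, y, 0] * z := by
  obtain ⟨c, rfl⟩ := exists_multiAffine hQ
  simp only [pd_multiAffine, multiAffine, multiAffineD, Matrix.cons_val]; ring

/-- For `f = α + βs + γt + δst` both `f f_{st} - f_s f_t` and `f(0,0) f(1,1) - f(1,0) f(0,1)` equal
`αδ - βγ`. The second expression exposes the symmetries. -/
theorem h₁_eq (hQ : IsClassFPrime Q) (x y : 𝕜) : h₁ Q x y =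
    Q ![x, y, 0, 0] * Q ![x, y, 1, 1] - Q ![x, y, 1, 0] * Q ![x, y, 0, 1] := by
  obtain ⟨c, rfl⟩ := exists_multiAffine hQ
  rw [h₁, hPoly_multiAffine]
  simp only [multiAffine, multiAffineD, multiAffineDD, Matrix.cons_val]; ring

theorem h₂_eq (hQ : IsClassFPrime Q) (x y : 𝕜) : h₂ Q x y =
    Q ![x, 0, y, 0] * Q ![x, 1, y, 1] - Q ![x, 1, y, 0] * Q ![x, 0, y, 1] := by
  obtain ⟨c, rfl⟩ := exists_multiAffine hQ
  rw [h₂, hPoly_multiAffine]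
  simp only [multiAffine, multiAffineD, multiAffineDD, Matrix.cons_val]; ring

theorem G_eq (hQ : IsClassFPrime Q) (x y : 𝕜) : G Q x y =
    Q ![0, x, y, 0] * Q ![1, x, y, 1] - Q ![1, x, y, 0] * Q ![0, x, y, 1] := by
  obtain ⟨c, rfl⟩ := exists_multiAffine hQ
  rw [G, hPoly_multiAffine]
  simp only [multiAffine, multiAffineD, multiAffineDD, Matrix.cons_val]; ring

theorem h₁_eq_hPoly (hQ : IsClassFPrime Q) (v : Fin 4 → 𝕜) :
    h₁ Q (v 0) (v 1) = hPoly Q 2 3 v := by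
  obtain ⟨c, rfl⟩ := exists_multiAffine hQ
  rw [h₁, hPoly_multiAffine, hPoly_multiAffine]
  simp only [multiAffine, multiAffineD, multiAffineDD, Matrix.cons_val]; ring

theorem h₂_eq_hPoly (hQ : IsClassFPrime Q) (v : Fin 4 → 𝕜) :
    h₂ Q (v 0) (v 2) = hPoly Q 1 3 v := by
  obtain ⟨c, rfl⟩ := exists_multiAffine hQ
  rw [h₂, hPoly_multiAffine, hPoly_multiAffine]
  simp only [multiAffine, multiAffineD, multiAffineDD, Matrix.cons_val]; ring

theorem G_eq_hPoly (hQ : IsClassFPrime Q) (v : Fin 4 → 𝕜) :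
    G Q (v 1) (v 2) = hPoly Q 0 3 v := by
  obtain ⟨c, rfl⟩ := exists_multiAffine hQ
  rw [G, hPoly_multiAffine, hPoly_multiAffine]
  simp only [multiAffine, multiAffineD, multiAffineDD, Matrix.cons_val]; ring

theorem h₁_symm (hQ : IsClassFPrime Q) (x y : 𝕜) : h₁ Q x y = h₁ Q y x := by
  obtain ⟨τ, hτ, h⟩ := hQ.symm_n
  rw [hQ.h₁_eq, hQ.h₁_eq, h x, h x, h x, h x]
  rcases hτ with rfl | rfl <;> ring

/-- The reflection in the `m` direction carries the lower edge to the upper one, and the sign `τ'`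
cancels because the polynomial is quadratic in `Q`. -/
theorem h₁_eq_hPoly_top (hQ : IsClassFPrime Q) (v : Fin 4 → 𝕜) :
    h₁ Q (v 2) (v 3) = hPoly Q 0 1 v := by
  have : hPoly Q 0 1 v = Q ![0, 0, v 2, v 3] * Q ![1, 1, v 2, v 3]
      - Q ![1, 0, v 2, v 3] * Q ![0, 1, v 2, v 3] := by
    obtain ⟨c, rfl⟩ := exists_multiAffine hQ
    rw [hPoly_multiAffine]
    simp only [multiAffine, multiAffineD, multiAffineDD, Matrix.cons_val]; ring
  obtain ⟨τ, hτ, h⟩ := hQ.symm_m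
  rw [hQ.h₁_eq, this, h (v 2), h (v 2), h (v 2), h (v 2)]
  rcases hτ with rfl | rfl <;> ring

theorem G_eq_hPoly_antidiagonal (hQ : IsClassFPrime Q) (v : Fin 4 → 𝕜) :
    G Q (v 0) (v 3) = hPoly Q 1 2 v := by
  have : hPoly Q 1 2 v = Q ![v 0, 0, 0, v 3] * Q ![v 0, 1, 1, v 3]
      - Q ![v 0, 1, 0, v 3] * Q ![v 0, 0, 1, v 3] := by
    obtain ⟨c, rfl⟩ := exists_multiAffine hQ
    rw [hPoly_multiAffine]
    simp only [multiAffine, multiAffineD, multiAffineDD, Matrix.cons_val]; ring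
  obtain ⟨τ, hτ, h⟩ := hQ.symm_n
  rw [hQ.G_eq, this, h 0, h 1, h 1, h 0]
  rcases hτ with rfl | rfl <;> ring

theorem G_symm (hQ : IsClassFPrime Q) (x y : 𝕜) : G Q x y = G Q y x := by
  obtain ⟨τ, hτ, h⟩ := hQ.symm_n
  obtain ⟨τ', hτ', h'⟩ := hQ.symm_m
  rw [hQ.G_eq, hQ.G_eq, h 0 x, h 1 x, h 0 x, h 1 x, h' x, h' x, h' x, h' x]
  rcases hτ with rfl | rfl <;> rcases hτ' with rfl | rfl <;> ring

theorem pd_symm_n (hQ : IsClassFPrime Q) : ∃ τ : 𝕜, (τ = 1 ∨ τ = -1) ∧ ∀ u x y z : 𝕜,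
    Q ![u, x, y, z] = τ * Q ![x, u, z, y] ∧
    pd Q 0 ![u, x, y, z] = τ * pd Q 1 ![x, u, z, y] ∧
    pd Q 1 ![u, x, y, z] = τ * pd Q 0 ![x, u, z, y] ∧
    pd Q 2 ![u, x, y, z] = τ * pd Q 3 ![x, u, z, y] ∧
    pd Q 3 ![u, x, y, z] = τ * pd Q 2 ![x, u, z, y] := by
  obtain ⟨τ, hτ, h⟩ := hQ.symm_n
  refine ⟨τ, hτ, fun u x y z => ⟨h _ _ _ _, ?_, ?_, ?_, ?_⟩⟩ <;>
  · simp only [hQ.pd_zero_eq, hQ.pd_one_eq, hQ.pd_two_eq, hQ.pd_three_eq, mul_sub, ← h]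

theorem pd_symm_m (hQ : IsClassFPrime Q) : ∃ τ : 𝕜, (τ = 1 ∨ τ = -1) ∧ ∀ u x y z : 𝕜,
    Q ![u, x, y, z] = τ * Q ![y, z, u, x] ∧
    pd Q 0 ![u, x, y, z] = τ * pd Q 2 ![y, z, u, x] ∧
    pd Q 1 ![u, x, y, z] = τ * pd Q 3 ![y, z, u, x] ∧
    pd Q 2 ![u, x, y, z] = τ * pd Q 0 ![y, z, u, x] ∧
    pd Q 3 ![u, x, y, z] = τ * pd Q 1 ![y, z, u, x] := by
  obtain ⟨τ, hτ, h⟩ := hQ.symm_m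
  refine ⟨τ, hτ, fun u x y z => ⟨h _ _ _ _, ?_, ?_, ?_, ?_⟩⟩ <;>
  · simp only [hQ.pd_zero_eq, hQ.pd_one_eq, hQ.pd_two_eq, hQ.pd_three_eq, mul_sub, ← h]

theorem h₁_quadratic (hQ : IsClassFPrime Q) (x : 𝕜) :
    ∃ k₀ k₁ k₂ : 𝕜, ∀ t, h₁ Q x t = k₀ + k₁ * t + k₂ * t ^ 2 := by
  obtain ⟨c, rfl⟩ := exists_multiAffine hQ
  refine ⟨(c 0 + c 1 * x) * (c 12 + c 13 * x) - (c 4 + c 5 * x) * (c 8 + c 9 * x),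
    (c 0 + c 1 * x) * (c 14 + c 15 * x) + (c 2 + c 3 * x) * (c 12 + c 13 * x)
      - (c 4 + c 5 * x) * (c 10 + c 11 * x) - (c 6 + c 7 * x) * (c 8 + c 9 * x),
    (c 2 + c 3 * x) * (c 14 + c 15 * x) - (c 6 + c 7 * x) * (c 10 + c 11 * x), fun t => ?_⟩
  rw [hQ.h₁_eq]
  simp only [multiAffine, Matrix.cons_val]; ring

theorem G_quadratic (hQ : IsClassFPrime Q) (x : 𝕜) :
    ∃ k₀ k₁ k₂ : 𝕜, ∀ t, G Q x t = k₀ + k₁ * t + k₂ * t ^ 2 := by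
  obtain ⟨c, rfl⟩ := exists_multiAffine hQ
  refine ⟨(c 0 + c 2 * x) * (c 9 + c 11 * x) - (c 1 + c 3 * x) * (c 8 + c 10 * x),
    (c 0 + c 2 * x) * (c 13 + c 15 * x) + (c 4 + c 6 * x) * (c 9 + c 11 * x)
      - (c 1 + c 3 * x) * (c 12 + c 14 * x) - (c 5 + c 7 * x) * (c 8 + c 10 * x),
    (c 4 + c 6 * x) * (c 13 + c 15 * x) - (c 5 + c 7 * x) * (c 12 + c 14 * x), fun t => ?_⟩
  rw [hQ.G_eq]
  simp only [multiAffine, Matrix.cons_val]; ring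

end IsClassFPrime

theorem deriv_quadratic (k₀ k₁ k₂ t : 𝕜) :
    deriv (fun t => k₀ + k₁ * t + k₂ * t ^ 2) t = k₁ + 2 * k₂ * t := by
  have : HasDerivAt (fun t => k₀ + k₁ * t + k₂ * t ^ 2) (k₁ * 1 + k₂ * ((2 : ℕ) * t ^ 1 * 1)) t :=
    (((hasDerivAt_id t).const_mul k₁).const_add k₀).add (((hasDerivAt_id t).pow 2).const_mul k₂)
  rw [this.deriv]
  push_cast; ring

/-! ### Contribution of `v_n` to the linearized equation -/

/-- The polarization of `h₁` divided by a difference: the characteristic of `v_n`. -/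
def polarN (Q : (Fin 4 → 𝕜) → 𝕜) (x y z : 𝕜) : 𝕜 :=
  h₁ Q x y / (y - z) - 1 / 2 * deriv (fun t => h₁ Q x t) y

/-- The expression `-2 Σ`, where `Σ` is the contribution of `v_n` at two neighbouring vertices to
the linearization of `Q = 0`. -/
def crossN (Q : (Fin 4 → 𝕜) → 𝕜) (v : Fin 4 → 𝕜) : 𝕜 :=
  pd Q 0 v * pd Q 1 v * pd (pd Q 2) 3 v + pd Q 2 v * pd Q 3 v * pd (pd Q 0) 1 v
    - pd Q 1 v * pd Q 2 v * pd (pd Q 0) 3 v - pd Q 0 v * pd Q 3 v * pd (pd Q 1) 2 v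

/-- For `h₁(x, t) = k₀ + k₁ t + k₂ t²` the characteristic is `(k₀ + k₁ (y + z)/2 + k₂ y z)/(y - z)`:
a symmetric numerator over an antisymmetric denominator. -/
theorem polarN_antisymm (hQ : IsClassFPrime Q) (x : 𝕜) {y z : 𝕜} (hyz : y ≠ z) :
    polarN Q x z y = -polarN Q x y z := by
  obtain ⟨k₀, k₁, k₂, h⟩ := hQ.h₁_quadratic x
  have h1 : y - z ≠ 0 := sub_ne_zero.2 hyz
  have h2 : z - y ≠ 0 := sub_ne_zero.2 hyz.symm
  simp only [polarN, h, deriv_quadratic]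
  rw [show z - y = -(y - z) by ring, div_neg]
  field_simp
  ring

/-- Here `a`, `b`, `d` are the coefficients in `y, y'` of `Q` and of its derivatives with respect to
`x` and `x'`. The fractions are the only terms with `s, s'`, and they combine to a constant because
`Q` vanishes at both `(y, y')` and `(s, s')`. -/
theorem bilinear_polar_identity {a₀ a₁ a₂ a₃ b₀ b₁ b₂ b₃ d₀ d₁ d₂ d₃ y s y' s' : 𝕜}
    (h : a₀ + a₁ * y + a₂ * y' + a₃ * y * y' = 0) (h' : a₀ + a₁ * s + a₂ * s' + a₃ * s * s' = 0)
    (hys : y ≠ s) (hys' : y' ≠ s') :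
    (b₀ + b₁ * y + b₂ * y' + b₃ * y * y') *
      (((a₀ + a₁ * y) * (d₂ + d₃ * y) - (d₀ + d₁ * y) * (a₂ + a₃ * y)) / (y - s)
        - 1 / 2 * ((a₀ * d₃ + a₁ * d₂ - d₀ * a₃ - d₁ * a₂) + 2 * (a₁ * d₃ - d₁ * a₃) * y))
    + (d₀ + d₁ * y + d₂ * y' + d₃ * y * y') *
      (((a₀ + a₂ * y') * (b₁ + b₃ * y') - (b₀ + b₂ * y') * (a₁ + a₃ * y')) / (y' - s')
        - 1 / 2 * ((a₀ * b₃ + a₂ * b₁ - b₀ * a₃ - b₂ * a₁) + 2 * (a₂ * b₃ - b₂ * a₃) * y'))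
    = -(1 / 2) * ((b₀ + b₁ * y + b₂ * y' + b₃ * y * y') * (a₁ + a₃ * y') * (d₂ + d₃ * y)
      + (d₀ + d₁ * y + d₂ * y' + d₃ * y * y') * (a₂ + a₃ * y) * (b₁ + b₃ * y')
      - (a₁ + a₃ * y') * (d₀ + d₁ * y + d₂ * y' + d₃ * y * y') * (b₂ + b₃ * y)
      - (b₀ + b₁ * y + b₂ * y' + b₃ * y * y') * (a₂ + a₃ * y) * (d₁ + d₃ * y')) := by
  have h1 : y - s ≠ 0 := sub_ne_zero.2 hys
  have h2 : y' - s' ≠ 0 := sub_ne_zero.2 hys'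
  have e1 : (a₀ + a₁ * y) * (d₂ + d₃ * y) - (d₀ + d₁ * y) * (a₂ + a₃ * y)
      = -((d₀ + d₁ * y + d₂ * y' + d₃ * y * y') * (a₂ + a₃ * y)) := by
    linear_combination (d₂ + d₃ * y) * h
  have e2 : (a₀ + a₂ * y') * (b₁ + b₃ * y') - (b₀ + b₂ * y') * (a₁ + a₃ * y')
      = -((b₀ + b₁ * y + b₂ * y' + b₃ * y * y') * (a₁ + a₃ * y')) := by
    linear_combination (b₁ + b₃ * y') * h
  -- After multiplication by the denominators this is the difference of the two equations `h` and
  -- `h'`.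
  have e3 : (a₂ + a₃ * y) / (y - s) + (a₁ + a₃ * y') / (y' - s') = a₃ := by
    rw [div_add_div _ _ h1 h2, div_eq_iff (mul_ne_zero h1 h2)]
    linear_combination h - h'
  rw [e1, e2]
  have e4 : a₀ * d₃ + a₁ * d₂ - d₀ * a₃ - d₁ * a₂ + 2 * (a₁ * d₃ - d₁ * a₃) * y
      = (a₁ + a₃ * y') * (d₂ + d₃ * y) - (d₁ + d₃ * y') * (a₂ + a₃ * y)
        - (d₀ + d₁ * y + d₂ * y' + d₃ * y * y') * a₃ := by
    linear_combination d₃ * h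
  have e5 : a₀ * b₃ + a₂ * b₁ - b₀ * a₃ - b₂ * a₁ + 2 * (a₂ * b₃ - b₂ * a₃) * y'
      = (a₂ + a₃ * y) * (b₁ + b₃ * y') - (b₂ + b₃ * y) * (a₁ + a₃ * y')
        - (b₀ + b₁ * y + b₂ * y' + b₃ * y * y') * a₃ := by
    linear_combination b₃ * h
  rw [e4, e5]
  simp only [neg_div, mul_div_assoc]
  linear_combination (-(b₀ + b₁ * y + b₂ * y' + b₃ * y * y') *
    (d₀ + d₁ * y + d₂ * y' + d₃ * y * y')) * e3

theorem h₁_eq_top (hQ : IsClassFPrime Q) (x y : 𝕜) : h₁ Q x y =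
    Q ![0, 0, x, y] * Q ![1, 1, x, y] - Q ![1, 0, x, y] * Q ![0, 1, x, y] := by
  obtain ⟨τ, hτ, h⟩ := hQ.symm_m
  rw [hQ.h₁_eq, h x, h x, h x, h x]
  rcases hτ with rfl | rfl <;> ring

theorem polarN_add_polarN (hQ : IsClassFPrime Q) {x y x' y' s s' : 𝕜}
    (h : Q ![x, y, x', y'] = 0) (h' : Q ![x, s, x', s'] = 0) (hys : y ≠ s) (hys' : y' ≠ s') :
    pd Q 0 ![x, y, x', y'] * polarN Q x y s + pd Q 2 ![x, y, x', y'] * polarN Q x' y' s'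
      = -(1 / 2) * crossN Q ![x, y, x', y'] := by
  obtain ⟨c, hc⟩ := exists_multiAffine hQ
  have key := bilinear_polar_identity (a₀ := c 0 + c 1 * x + c 4 * x' + c 5 * x * x')
    (a₁ := c 2 + c 3 * x + c 6 * x' + c 7 * x * x')
    (a₂ := c 8 + c 9 * x + c 12 * x' + c 13 * x * x')
    (a₃ := c 10 + c 11 * x + c 14 * x' + c 15 * x * x')
    (b₀ := c 1 + c 5 * x') (b₁ := c 3 + c 7 * x')
    (b₂ := c 9 + c 13 * x') (b₃ := c 11 + c 15 * x')
    (d₀ := c 4 + c 5 * x) (d₁ := c 6 + c 7 * x)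
    (d₂ := c 12 + c 13 * x) (d₃ := c 14 + c 15 * x) (y := y) (s := s) (y' := y') (s' := s')
    (by rw [← h, hc]; simp only [multiAffine, Matrix.cons_val]; ring)
    (by rw [← h', hc]; simp only [multiAffine, Matrix.cons_val]; ring) hys hys'
  have H1 : ∀ t, h₁ Q x t = ((c 0 + c 1 * x) * (c 12 + c 13 * x)
      - (c 4 + c 5 * x) * (c 8 + c 9 * x))
      + ((c 0 + c 1 * x) * (c 14 + c 15 * x) + (c 2 + c 3 * x) * (c 12 + c 13 * x)
      - (c 4 + c 5 * x) * (c 10 + c 11 * x) - (c 6 + c 7 * x) * (c 8 + c 9 * x)) * t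
      + ((c 2 + c 3 * x) * (c 14 + c 15 * x) - (c 6 + c 7 * x) * (c 10 + c 11 * x)) * t ^ 2 := by
    intro t
    rw [hQ.h₁_eq, hc]
    simp only [multiAffine, Matrix.cons_val]; ring
  have H2 : ∀ t, h₁ Q x' t = ((c 0 + c 4 * x') * (c 3 + c 7 * x')
      - (c 1 + c 5 * x') * (c 2 + c 6 * x'))
      + ((c 0 + c 4 * x') * (c 11 + c 15 * x') + (c 8 + c 12 * x') * (c 3 + c 7 * x')
      - (c 1 + c 5 * x') * (c 10 + c 14 * x') - (c 9 + c 13 * x') * (c 2 + c 6 * x')) * t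
      + ((c 8 + c 12 * x') * (c 11 + c 15 * x') - (c 9 + c 13 * x') * (c 10 + c 14 * x'))
        * t ^ 2 := by
    intro t
    rw [h₁_eq_top hQ, hc]
    simp only [multiAffine, Matrix.cons_val]; ring
  have P0 : pd Q 0 ![x, y, x', y'] = c 1 + c 5 * x' + (c 3 + c 7 * x') * y
      + (c 9 + c 13 * x') * y' + (c 11 + c 15 * x') * y * y' := by
    rw [hc, pd_multiAffine]; simp only [multiAffineD, Matrix.cons_val]; ring
  have P2 : pd Q 2 ![x, y, x', y'] = c 4 + c 5 * x + (c 6 + c 7 * x) * y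
      + (c 12 + c 13 * x) * y' + (c 14 + c 15 * x) * y * y' := by
    rw [hc, pd_multiAffine]; simp only [multiAffineD, Matrix.cons_val]; ring
  have T : crossN Q ![x, y, x', y'] = pd Q 0 ![x, y, x', y'] * (c 2 + c 3 * x + c 6 * x'
      + c 7 * x * x' + (c 10 + c 11 * x + c 14 * x' + c 15 * x * x') * y')
        * (c 12 + c 13 * x + (c 14 + c 15 * x) * y)
      + pd Q 2 ![x, y, x', y'] * (c 8 + c 9 * x + c 12 * x' + c 13 * x * x'
        + (c 10 + c 11 * x + c 14 * x' + c 15 * x * x') * y)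
        * (c 3 + c 7 * x' + (c 11 + c 15 * x') * y')
      - (c 2 + c 3 * x + c 6 * x' + c 7 * x * x'
        + (c 10 + c 11 * x + c 14 * x' + c 15 * x * x') * y') * pd Q 2 ![x, y, x', y']
        * (c 9 + c 13 * x' + (c 11 + c 15 * x') * y)
      - pd Q 0 ![x, y, x', y'] * (c 8 + c 9 * x + c 12 * x' + c 13 * x * x'
        + (c 10 + c 11 * x + c 14 * x' + c 15 * x * x') * y)
        * (c 6 + c 7 * x + (c 14 + c 15 * x) * y') := by
    rw [crossN, hc]
    simp only [pd_multiAffine, pd_multiAffineD]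
    simp only [multiAffineD, multiAffineDD, Matrix.cons_val]
    ring
  rw [T, polarN, polarN, funext H1, funext H2, deriv_quadratic, deriv_quadratic, P0, P2]
  linear_combination key

/-- Every term of `crossN` is cubic in `Q` and its derivatives, hence the factor `τ ^ 3`; the
reflection permutes the terms. -/
theorem crossN_mirror (hQ : IsClassFPrime Q) {τ : 𝕜}
    (h : ∀ u x y z : 𝕜, Q ![u, x, y, z] = τ * Q ![x, u, z, y]) (u x y z : 𝕜) :
    crossN Q ![u, x, y, z] = τ ^ 3 * crossN Q ![x, u, z, y] := by
  have e : ∀ v, crossN Q v = pd Q 0 v * pd Q 1 v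
        * (Q ![v 0, v 1, 1, 1] - Q ![v 0, v 1, 0, 1] - Q ![v 0, v 1, 1, 0] + Q ![v 0, v 1, 0, 0])
      + pd Q 2 v * pd Q 3 v
        * (Q ![1, 1, v 2, v 3] - Q ![1, 0, v 2, v 3] - Q ![0, 1, v 2, v 3] + Q ![0, 0, v 2, v 3])
      - pd Q 1 v * pd Q 2 v
        * (Q ![1, v 1, v 2, 1] - Q ![1, v 1, v 2, 0] - Q ![0, v 1, v 2, 1] + Q ![0, v 1, v 2, 0])
      - pd Q 0 v * pd Q 3 v
        * (Q ![v 0, 1, 1, v 3] - Q ![v 0, 1, 0, v 3] - Q ![v 0, 0, 1, v 3] + Q ![v 0, 0, 0, v 3])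
      := by
    intro v
    obtain ⟨c, rfl⟩ := exists_multiAffine hQ
    rw [crossN]
    simp only [pd_multiAffine, pd_multiAffineD]
    simp only [multiAffine, multiAffineD, multiAffineDD, Matrix.cons_val]
    ring
  rw [e, e]
  simp only [hQ.pd_zero_eq, hQ.pd_one_eq, hQ.pd_two_eq, hQ.pd_three_eq, Matrix.cons_val]
  rw [h 1 x, h 0 x, h u 1, h u 0, h u x 1, h u x 0, h u x y 1, h u x y 0, h u x 1, h u x 0, h u x 1,
    h u x 0, h 1 1, h 0 1, h 1 0, h 0 0, h 1 x, h 0 x, h 1 x, h 0 x, h u 1, h u 0, h u 1, h u 0]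
  ring

/-- This is `polarN_add_polarN` on the reflected quadrilateral; the sign changes because the
reflection exchanges the last two arguments of the antisymmetric `polarN`. -/
theorem polarN_add_polarN_mirror (hQ : IsClassFPrime Q) {x y x' y' s s' : 𝕜}
    (h : Q ![x, y, x', y'] = 0) (h' : Q ![y, s, y', s'] = 0) (hxs : x ≠ s) (hxs' : x' ≠ s') :
    pd Q 1 ![x, y, x', y'] * polarN Q y s x + pd Q 3 ![x, y, x', y'] * polarN Q y' s' x'
      = 1 / 2 * crossN Q ![x, y, x', y'] := by
  obtain ⟨τ, hτ, hs⟩ := hQ.pd_symm_n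
  have hm : Q ![y, x, y', x'] = 0 := by rw [(hs _ _ _ _).1, h, mul_zero]
  have key := polarN_add_polarN hQ hm h' hxs hxs'
  rw [crossN_mirror hQ (fun u x y z => (hs u x y z).1), (hs _ _ _ _).2.1, (hs _ _ _ _).2.2.2.1]
    at key
  rw [polarN_antisymm hQ y hxs, polarN_antisymm hQ y' hxs']
  rcases hτ with rfl | rfl
  · linear_combination -key
  · linear_combination key

/-- By the quotient rule the left side is `G' h₁ - G h₁'`. On `Q = 0` one has `h₁ = -Q_{,3} Q_{,4}`
and `G = -Q_{,1} Q_{,4}`; the terms with `Q_{,24}` cancel, and `Q_{,4}` factors out. -/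
theorem crossN_eq_deriv (hQ : IsClassFPrime Q) {v : Fin 4 → 𝕜} (h : Q v = 0)
    (h0 : h₁ Q (v 0) (v 1) ≠ 0) :
    h₁ Q (v 0) (v 1) ^ 2 * deriv (fun t => G Q t (v 2) / h₁ Q (v 0) t) (v 1)
      = pd Q 3 v * crossN Q v := by
  obtain ⟨c, hc⟩ := exists_multiAffine hQ
  have H1 : ∀ t, h₁ Q (v 0) t = ((c 0 + c 1 * v 0) * (c 12 + c 13 * v 0)
      - (c 4 + c 5 * v 0) * (c 8 + c 9 * v 0))
      + ((c 0 + c 1 * v 0) * (c 14 + c 15 * v 0) + (c 2 + c 3 * v 0) * (c 12 + c 13 * v 0)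
      - (c 4 + c 5 * v 0) * (c 10 + c 11 * v 0) - (c 6 + c 7 * v 0) * (c 8 + c 9 * v 0)) * t
      + ((c 2 + c 3 * v 0) * (c 14 + c 15 * v 0) - (c 6 + c 7 * v 0) * (c 10 + c 11 * v 0))
        * t ^ 2 := by
    intro t
    rw [hQ.h₁_eq, hc]
    simp only [multiAffine, Matrix.cons_val]; ring
  have H2 : ∀ t, G Q t (v 2) = ((c 0 + c 4 * v 2) * (c 9 + c 13 * v 2)
      - (c 1 + c 5 * v 2) * (c 8 + c 12 * v 2))
      + ((c 0 + c 4 * v 2) * (c 11 + c 15 * v 2) + (c 2 + c 6 * v 2) * (c 9 + c 13 * v 2)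
      - (c 1 + c 5 * v 2) * (c 10 + c 14 * v 2) - (c 3 + c 7 * v 2) * (c 8 + c 12 * v 2)) * t
      + ((c 2 + c 6 * v 2) * (c 11 + c 15 * v 2) - (c 3 + c 7 * v 2) * (c 10 + c 14 * v 2))
        * t ^ 2 := by
    intro t
    rw [hQ.G_eq, hc]
    simp only [multiAffine, Matrix.cons_val]; ring
  have d : ∀ k₀ k₁ k₂ : 𝕜, DifferentiableAt 𝕜 (fun t => k₀ + k₁ * t + k₂ * t ^ 2) (v 1) := by
    intro _ _ _; fun_prop
  have d1 : DifferentiableAt 𝕜 (fun t => h₁ Q (v 0) t) (v 1) := by rw [funext H1]; exact d _ _ _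
  have d2 : DifferentiableAt 𝕜 (fun t => G Q t (v 2)) (v 1) := by rw [funext H2]; exact d _ _ _
  have D1 := congrArg (fun f => deriv f (v 1)) (funext H1)
  have D2 := congrArg (fun f => deriv f (v 1)) (funext H2)
  simp only [deriv_quadratic] at D1 D2
  rw [deriv_fun_div d2 d1 h0, mul_div_cancel₀ _ (pow_ne_zero 2 h0), D1, D2]
  have e1 : h₁ Q (v 0) (v 1) = -(pd Q 2 v * pd Q 3 v) := by
    rw [hQ.h₁_eq_hPoly, hPoly, h]; ring
  have e2 : G Q (v 1) (v 2) = -(pd Q 0 v * pd Q 3 v) := by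
    rw [hQ.G_eq_hPoly, hPoly, h]; ring
  -- The factor of `Q v` in the last term is the third derivative `Q_{,234}` (and `Q_{,124}` in
  -- `e4`); both terms drop out on solutions.
  have e3 : (c 0 + c 1 * v 0) * (c 14 + c 15 * v 0) + (c 2 + c 3 * v 0) * (c 12 + c 13 * v 0)
      - (c 4 + c 5 * v 0) * (c 10 + c 11 * v 0) - (c 6 + c 7 * v 0) * (c 8 + c 9 * v 0)
      + 2 * ((c 2 + c 3 * v 0) * (c 14 + c 15 * v 0) - (c 6 + c 7 * v 0) * (c 10 + c 11 * v 0))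
        * v 1 = pd Q 1 v * pd (pd Q 2) 3 v - pd (pd Q 1) 2 v * pd Q 3 v
          - pd Q 2 v * pd (pd Q 1) 3 v + Q v * (c 14 + c 15 * v 0) := by
    rw [hc]
    simp only [pd_multiAffine, pd_multiAffineD]
    simp only [multiAffine, multiAffineD, multiAffineDD, Matrix.cons_val]
    ring
  have e4 : (c 0 + c 4 * v 2) * (c 11 + c 15 * v 2) + (c 2 + c 6 * v 2) * (c 9 + c 13 * v 2)
      - (c 1 + c 5 * v 2) * (c 10 + c 14 * v 2) - (c 3 + c 7 * v 2) * (c 8 + c 12 * v 2)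
      + 2 * ((c 2 + c 6 * v 2) * (c 11 + c 15 * v 2) - (c 3 + c 7 * v 2) * (c 10 + c 14 * v 2))
        * v 1 = pd Q 1 v * pd (pd Q 0) 3 v - pd (pd Q 0) 1 v * pd Q 3 v
          - pd Q 0 v * pd (pd Q 1) 3 v + Q v * (c 11 + c 15 * v 2) := by
    rw [hc]
    simp only [pd_multiAffine, pd_multiAffineD]
    simp only [multiAffine, multiAffineD, multiAffineDD, Matrix.cons_val]
    ring
  rw [e3, e4, h, e1, e2, crossN]
  ring

/-! ### Interchange of the lattice directions, and the determining equation -/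

/-- `Q` with the two lattice directions interchanged. -/
def transposeQ (Q : (Fin 4 → 𝕜) → 𝕜) (v : Fin 4 → 𝕜) : 𝕜 := Q ![v 0, v 2, v 1, v 3]

theorem transposeQ_apply (u x y z : 𝕜) : transposeQ Q ![u, x, y, z] = Q ![u, y, x, z] := rfl

theorem pd_transposeQ (u x y z : 𝕜) :
    pd (transposeQ Q) 0 ![u, x, y, z] = pd Q 0 ![u, y, x, z] ∧
    pd (transposeQ Q) 1 ![u, x, y, z] = pd Q 2 ![u, y, x, z] ∧
    pd (transposeQ Q) 2 ![u, x, y, z] = pd Q 1 ![u, y, x, z] ∧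
    pd (transposeQ Q) 3 ![u, x, y, z] = pd Q 3 ![u, y, x, z] := by
  refine ⟨?_, ?_, ?_, ?_⟩ <;>
  simp only [pd, update_vec4_zero, update_vec4_one, update_vec4_two, update_vec4_three,
    transposeQ_apply, Matrix.cons_val]

theorem IsClassFPrime.transpose (hQ : IsClassFPrime Q) : IsClassFPrime (transposeQ Q) where
  affine i v := by
    rw [← vec4_eta v]
    fin_cases i <;> simp only [Fin.reduceFinMk, Fin.zero_eta, Fin.mk_one, update_vec4_zero,
      update_vec4_one, update_vec4_two, update_vec4_three, transposeQ_apply]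
    · simpa only [update_vec4_zero] using hQ.affine 0 ![v 0, v 2, v 1, v 3]
    · simpa only [update_vec4_two] using hQ.affine 2 ![v 0, v 2, v 1, v 3]
    · simpa only [update_vec4_one] using hQ.affine 1 ![v 0, v 2, v 1, v 3]
    · simpa only [update_vec4_three] using hQ.affine 3 ![v 0, v 2, v 1, v 3]
  depends i := by
    have H := fun j => (hQ.depends j).imp fun v hv => (vec4_eta v).symm ▸ hv
    fin_cases i
    · obtain ⟨v, hv⟩ := H 0
      exact ⟨![v 0, v 2, v 1, v 3], by rwa [Fin.zero_eta, (pd_transposeQ _ _ _ _).1]⟩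
    · obtain ⟨v, hv⟩ := H 2
      exact ⟨![v 0, v 2, v 1, v 3], by rwa [Fin.mk_one, (pd_transposeQ _ _ _ _).2.1]⟩
    · obtain ⟨v, hv⟩ := H 1
      exact ⟨![v 0, v 2, v 1, v 3], by simpa only [Fin.reduceFinMk, (pd_transposeQ _ _ _ _).2.2.1] using hv⟩
    · obtain ⟨v, hv⟩ := H 3
      exact ⟨![v 0, v 2, v 1, v 3], by simpa only [Fin.reduceFinMk, (pd_transposeQ _ _ _ _).2.2.2] using hv⟩
  symm_n := by
    obtain ⟨τ, hτ, h⟩ := hQ.symm_m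
    exact ⟨τ, hτ, fun u x y z => h u y x z⟩
  symm_m := by
    obtain ⟨τ, hτ, h⟩ := hQ.symm_n
    exact ⟨τ, hτ, fun u x y z => h u y x z⟩

theorem h₁_transposeQ (hQ : IsClassFPrime Q) (x y : 𝕜) : h₁ (transposeQ Q) x y = h₂ Q x y := by
  rw [hQ.transpose.h₁_eq, hQ.h₂_eq]
  simp only [transposeQ_apply]

theorem h₂_transposeQ (hQ : IsClassFPrime Q) (x y : 𝕜) : h₂ (transposeQ Q) x y = h₁ Q x y := by
  rw [hQ.transpose.h₂_eq, hQ.h₁_eq]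
  simp only [transposeQ_apply]

theorem G_transposeQ (hQ : IsClassFPrime Q) (x y : 𝕜) : G (transposeQ Q) x y = G Q x y := by
  rw [hQ.transpose.G_eq, hQ.G_symm, hQ.G_eq]
  simp only [transposeQ_apply]

theorem charN_eq_polarN (p : Fin 5 → 𝕜) : charN Q p = polarN Q (p 0) (p 1) (p 3) := rfl

theorem charM_eq_polarN (hQ : IsClassFPrime Q) (p : Fin 5 → 𝕜) :
    charM Q p = polarN (transposeQ Q) (p 0) (p 2) (p 4) := by
  simp only [charM, polarN, h₁_transposeQ hQ]

/-- A combination of `v_n`, `v_m` and a point symmetry that satisfies the linearized equation at a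
solution also satisfies the determining equation there. -/
theorem determiningEq_of_admissibleAt (hQ : IsClassFPrime Q) {Ω : ℤ → ℤ → Set (Fin 5 → 𝕜)}
    {R : ℤ → ℤ → (Fin 5 → 𝕜) → 𝕜} (hR : IsFivePointSymmetry Q Ω R)
    {a b : ℤ → 𝕜} {ψ : ℤ → ℤ → 𝕜 → 𝕜}
    (hcomb : ∀ n m, ∀ p ∈ Ω n m, R n m p = combination Q a b ψ n m p)
    (ha : ∀ n m, ∀ p ∈ Ω n m, a n = 0 ∨ p 1 ≠ p 3)
    (hb : ∀ n m, ∀ p ∈ Ω n m, b m = 0 ∨ p 2 ≠ p 4) {n m : ℤ} {w : ℤ → ℤ → 𝕜}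
    (hw : AdmissibleAt Q Ω n m w) : DeterminingEq Q a b ψ n m (quad w n m) := by
  have key := hR n m w hw
  rw [hcomb _ _ _ hw.mem₀₀, hcomb _ _ _ hw.mem₁₀, hcomb _ _ _ hw.mem₀₁, hcomb _ _ _ hw.mem₁₁] at key
  have a00 := ha _ _ _ hw.mem₀₀
  have a10 := ha _ _ _ hw.mem₁₀
  have a01 := ha _ _ _ hw.mem₀₁
  have a11 := ha _ _ _ hw.mem₁₁
  have b00 := hb _ _ _ hw.mem₀₀
  have b10 := hb _ _ _ hw.mem₁₀
  have b01 := hb _ _ _ hw.mem₀₁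
  have b11 := hb _ _ _ hw.mem₁₁
  have q00 := hw.solves.1
  have qr := hw.solves_right.1
  have qu := hw.solves_up.1
  have ql := hw.solves_left.1
  have qd := hw.solves_down.1
  have reg := hw.solves.2
  have e1 : h₁ Q (quad w n m 0) (quad w n m 1) = -(pd Q 2 (quad w n m) * pd Q 3 (quad w n m)) := by
    rw [hQ.h₁_eq_hPoly, hPoly, q00]; ring
  have e2 : h₂ Q (quad w n m 0) (quad w n m 2) = -(pd Q 1 (quad w n m) * pd Q 3 (quad w n m)) := by
    rw [hQ.h₂_eq_hPoly, hPoly, q00]; ring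
  have e3 : G Q (quad w n m 1) (quad w n m 2) = -(pd Q 0 (quad w n m) * pd Q 3 (quad w n m)) := by
    rw [hQ.G_eq_hPoly, hPoly, q00]; ring
  have n1 : h₁ Q (quad w n m 0) (quad w n m 1) ≠ 0 := by
    rw [e1]; exact neg_ne_zero.2 (mul_ne_zero (reg 2) (reg 3))
  have n2 : h₂ Q (quad w n m 0) (quad w n m 2) ≠ 0 := by
    rw [e2]; exact neg_ne_zero.2 (mul_ne_zero (reg 1) (reg 3))
  have d1 := crossN_eq_deriv hQ q00 n1
  have d2 := crossN_eq_deriv hQ.transpose (v := ![quad w n m 0, quad w n m 2, quad w n m 1,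
    quad w n m 3]) (by rw [transposeQ_apply, vec4_eta]; exact q00)
    (by rw [h₁_transposeQ hQ]; exact n2)
  simp only [Matrix.cons_val, h₁_transposeQ hQ, G_transposeQ hQ, (pd_transposeQ _ _ _ _).2.2.2]
    at d2
  rw [vec4_eta, show (fun t => G Q t (quad w n m 1) / h₂ Q (quad w n m 0) t) =
    fun t => G Q (quad w n m 1) t / h₂ Q (quad w n m 0) t from
      funext fun t => by rw [hQ.G_symm]] at d2
  obtain ⟨τ, hτ, sn⟩ := hQ.symm_n
  obtain ⟨τ', hτ', sm⟩ := hQ.symm_m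
  have hτ0 : τ ≠ 0 := by rcases hτ with rfl | rfl <;> simp
  have hτ0' : τ' ≠ 0 := by rcases hτ' with rfl | rfl <;> simp
  simp only [quad, cross, add_sub_cancel_right, sub_add_cancel] at *
  generalize w n m = x at *
  generalize w (n + 1) m = y at *
  generalize w n (m + 1) = x' at *
  generalize w (n + 1) (m + 1) = y' at *
  simp only [combination, charN_eq_polarN, charM_eq_polarN hQ, Matrix.cons_val] at *
  -- The four contributions are grouped by pairs of vertices: left and right pairs for `v_n`, lower
  -- and upper pairs for `v_m`. The values outside the quadrilateral satisfy the equation on the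
  -- adjacent one, which is what the polarization identity requires.
  have A : a n * (pd Q 0 ![x, y, x', y'] * polarN Q x y (w (n - 1) m)
      + pd Q 2 ![x, y, x', y'] * polarN Q x' y' (w (n - 1) (m + 1)))
      = a n * (-(1 / 2) * crossN Q ![x, y, x', y']) := by
    by_cases h0 : a n = 0
    · rw [h0, zero_mul, zero_mul]
    rw [sn] at ql
    rw [polarN_add_polarN hQ q00 ((mul_eq_zero.1 ql).resolve_left hτ0) (a00.resolve_left h0)
      (a01.resolve_left h0)]
  have A' : a (n + 1) * (pd Q 1 ![x, y, x', y'] * polarN Q y (w (n + 1 + 1) m) x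
      + pd Q 3 ![x, y, x', y'] * polarN Q y' (w (n + 1 + 1) (m + 1)) x')
      = a (n + 1) * (1 / 2 * crossN Q ![x, y, x', y']) := by
    by_cases h0 : a (n + 1) = 0
    · rw [h0, zero_mul, zero_mul]
    rw [polarN_add_polarN_mirror hQ q00 qr (a10.resolve_left h0).symm
      (a11.resolve_left h0).symm]
  have B : b m * (pd Q 0 ![x, y, x', y'] * polarN (transposeQ Q) x x' (w n (m - 1))
      + pd Q 1 ![x, y, x', y'] * polarN (transposeQ Q) y y' (w (n + 1) (m - 1)))
      = b m * (-(1 / 2) * crossN (transposeQ Q) ![x, x', y, y']) := by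
    by_cases h0 : b m = 0
    · rw [h0, zero_mul, zero_mul]
    rw [sm] at qd
    have := polarN_add_polarN hQ.transpose (x := x) (y := x') (x' := y) (y' := y')
      (by exact q00) (by exact (mul_eq_zero.1 qd).resolve_left hτ0') (b00.resolve_left h0)
      (b10.resolve_left h0)
    rw [(pd_transposeQ _ _ _ _).1, (pd_transposeQ _ _ _ _).2.2.1] at this
    rw [this]
  have B' : b (m + 1) * (pd Q 2 ![x, y, x', y'] * polarN (transposeQ Q) x' (w n (m + 1 + 1)) x
      + pd Q 3 ![x, y, x', y'] * polarN (transposeQ Q) y' (w (n + 1) (m + 1 + 1)) y)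
      = b (m + 1) * (1 / 2 * crossN (transposeQ Q) ![x, x', y, y']) := by
    by_cases h0 : b (m + 1) = 0
    · rw [h0, zero_mul, zero_mul]
    have := polarN_add_polarN_mirror hQ.transpose (x := x) (y := x') (x' := y) (y' := y')
      (by exact q00) (by exact qu) (b01.resolve_left h0).symm
      (b11.resolve_left h0).symm
    rw [(pd_transposeQ _ _ _ _).2.1, (pd_transposeQ _ _ _ _).2.2.2] at this
    rw [this]
  simp only [DeterminingEq, Matrix.cons_val]
  rw [mul_assoc, d1, mul_assoc (b m - b (m + 1)), d2, e1, e2, e3]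
  -- Multiplication by `-2 Q_{,4}` turns `½ Q_{,i}` into `G`, `h₂`, `h₁` and `-Q_{,4}²` for `i = 1,
  -- 2, 3, 4`.
  linear_combination (-2 * pd Q 3 ![x, y, x', y']) * (key - A - A' - B - B')

/-! ### Local parametrization of solutions around a quadrilateral -/

/-- The solution `y'` of `Q(x, y, x', y') = 0`. -/
def cornerValue (Q : (Fin 4 → 𝕜) → 𝕜) (x x' y : 𝕜) : 𝕜 :=
  -Q ![x, y, x', 0] / pd Q 3 ![x, y, x', 0]

theorem pd_three_congr (hQ : IsClassFPrime Q) (x y x' z z' : 𝕜) :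
    pd Q 3 ![x, y, x', z] = pd Q 3 ![x, y, x', z'] := by
  rw [hQ.pd_three_eq, hQ.pd_three_eq]

theorem eq_cornerValue_iff (hQ : IsClassFPrime Q) {x y x' y' z : 𝕜}
    (h : pd Q 3 ![x, y, x', z] ≠ 0) : y' = cornerValue Q x x' y ↔ Q ![x, y, x', y'] = 0 := by
  rw [pd_three_congr hQ _ _ _ _ 0] at h
  rw [cornerValue, eq_div_iff h, hQ.eq_add_pd_three x y x' y']
  constructor <;> intro h <;> linear_combination h

theorem tendsto_vec4 {X : Type*} {l : Filter X} {f g h k : X → 𝕜} {a b c d : 𝕜}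
    (hf : Tendsto f l (𝓝 a)) (hg : Tendsto g l (𝓝 b)) (hh : Tendsto h l (𝓝 c))
    (hk : Tendsto k l (𝓝 d)) :
    Tendsto (fun t => (![f t, g t, h t, k t] : Fin 4 → 𝕜)) l (𝓝 ![a, b, c, d]) := by
  refine tendsto_pi_nhds.2 fun i => ?_
  fin_cases i <;> simpa

theorem tendsto_vec5 {X : Type*} {l : Filter X} {f g h k j : X → 𝕜} {a b c d e : 𝕜}
    (hf : Tendsto f l (𝓝 a)) (hg : Tendsto g l (𝓝 b)) (hh : Tendsto h l (𝓝 c))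
    (hk : Tendsto k l (𝓝 d)) (hj : Tendsto j l (𝓝 e)) :
    Tendsto (fun t => (![f t, g t, h t, k t, j t] : Fin 5 → 𝕜)) l (𝓝 ![a, b, c, d, e]) := by
  refine tendsto_pi_nhds.2 fun i => ?_
  fin_cases i <;> simpa

theorem tendsto_vec6 {X : Type*} {l : Filter X} {f g h k j i : X → 𝕜} {a b c d e e' : 𝕜}
    (hf : Tendsto f l (𝓝 a)) (hg : Tendsto g l (𝓝 b)) (hh : Tendsto h l (𝓝 c))
    (hk : Tendsto k l (𝓝 d)) (hj : Tendsto j l (𝓝 e)) (hi : Tendsto i l (𝓝 e')) :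
    Tendsto (fun t => (![f t, g t, h t, k t, j t, i t] : Fin 6 → 𝕜)) l
      (𝓝 ![a, b, c, d, e, e']) := by
  refine tendsto_pi_nhds.2 fun i => ?_
  fin_cases i <;> simpa

theorem tendsto_cornerValue (hQ : IsClassFPrime Q) {X : Type*} {l : Filter X} {f g h : X → 𝕜}
    {x x' y y' : 𝕜} (hf : Tendsto f l (𝓝 x)) (hg : Tendsto g l (𝓝 x')) (hh : Tendsto h l (𝓝 y))
    (hz : Q ![x, y, x', y'] = 0) (h3 : pd Q 3 ![x, y, x', y'] ≠ 0) :
    Tendsto (fun t => cornerValue Q (f t) (g t) (h t)) l (𝓝 y') := by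
  rw [(eq_cornerValue_iff hQ h3).2 hz]
  rw [pd_three_congr hQ _ _ _ _ 0] at h3
  have hv := tendsto_vec4 hf hh hg (tendsto_const_nhds (x := (0 : 𝕜)))
  exact (((hQ.continuous.tendsto _).comp hv).neg).div (((hQ.continuous_pd 3).tendsto _).comp hv) h3

/-- Values near a quadrilateral at `(0, 0)` that satisfy the equation there and on the four adjacent
quadrilaterals. The parameters are the values at `(0, 0)`, `(1, 0)`, `(0, 1)`, `(-1, 0)`, `(0, -1)`,
`(0, 2)`; the value at `(2, 0)` is `p`. -/
def patch (Q : (Fin 4 → 𝕜) → 𝕜) (p : 𝕜) (θ : Fin 6 → 𝕜) (i j : ℤ) : 𝕜 :=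
  if i = 0 ∧ j = 0 then θ 0
  else if i = 1 ∧ j = 0 then θ 1
  else if i = 0 ∧ j = 1 then θ 2
  else if i = -1 ∧ j = 0 then θ 3
  else if i = 0 ∧ j = -1 then θ 4
  else if i = 0 ∧ j = 2 then θ 5
  else if i = 2 ∧ j = 0 then p
  else if i = 1 ∧ j = 1 then cornerValue Q (θ 0) (θ 2) (θ 1)
  else if i = -1 ∧ j = 1 then cornerValue Q (θ 0) (θ 2) (θ 3)
  else if i = 1 ∧ j = -1 then cornerValue Q (θ 0) (θ 4) (θ 1)
  else if i = 1 ∧ j = 2 then cornerValue Q (θ 2) (θ 5) (cornerValue Q (θ 0) (θ 2) (θ 1))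
  else if i = 2 ∧ j = 1 then cornerValue Q (θ 1) (cornerValue Q (θ 0) (θ 2) (θ 1)) p
  else 0

/-- The parameters of `patch` for the solution `u` around `(n, m)`. -/
def patchParams (u : ℤ → ℤ → 𝕜) (n m : ℤ) : Fin 6 → 𝕜 :=
  ![u n m, u (n + 1) m, u n (m + 1), u (n - 1) m, u n (m - 1), u n (m + 1 + 1)]

/-- `f` translated by `(n, m)`. -/
def translate (f : ℤ → ℤ → 𝕜) (n m i j : ℤ) : 𝕜 := f (i - n) (j - m)

theorem quad_translate (f : ℤ → ℤ → 𝕜) (n m k l : ℤ) :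
    quad (translate f n m) k l = quad f (k - n) (l - m) := by
  simp only [quad, translate, sub_add_eq_add_sub]

theorem cross_translate (f : ℤ → ℤ → 𝕜) (n m k l : ℤ) :
    cross (translate f n m) k l = cross f (k - n) (l - m) := by
  simp only [cross, translate, sub_add_eq_add_sub, sub_right_comm]

section patchValues

variable (p : 𝕜) (θ : Fin 6 → 𝕜)

theorem quad_patch : quad (patch Q p θ) 0 0 =
    ![θ 0, θ 1, θ 2, cornerValue Q (θ 0) (θ 2) (θ 1)] := by
  simp [quad, patch]

theorem quad_patch_right : quad (patch Q p θ) 1 0 =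
    ![θ 1, p, cornerValue Q (θ 0) (θ 2) (θ 1),
      cornerValue Q (θ 1) (cornerValue Q (θ 0) (θ 2) (θ 1)) p] := by
  simp [quad, patch]

theorem quad_patch_up : quad (patch Q p θ) 0 1 =
    ![θ 2, cornerValue Q (θ 0) (θ 2) (θ 1), θ 5,
      cornerValue Q (θ 2) (θ 5) (cornerValue Q (θ 0) (θ 2) (θ 1))] := by
  simp [quad, patch]

theorem quad_patch_left : quad (patch Q p θ) (-1) 0 =
    ![θ 3, θ 0, cornerValue Q (θ 0) (θ 2) (θ 3), θ 2] := by
  simp [quad, patch]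

theorem quad_patch_down : quad (patch Q p θ) 0 (-1) =
    ![θ 4, cornerValue Q (θ 0) (θ 4) (θ 1), θ 0, θ 1] := by
  simp [quad, patch]

theorem cross_patch : cross (patch Q p θ) 0 0 = ![θ 0, θ 1, θ 2, θ 3, θ 4] := by
  simp [cross, patch]

theorem cross_patch_right : cross (patch Q p θ) 1 0 =
    ![θ 1, p, cornerValue Q (θ 0) (θ 2) (θ 1), θ 0, cornerValue Q (θ 0) (θ 4) (θ 1)] := by
  simp [cross, patch]

theorem cross_patch_up : cross (patch Q p θ) 0 1 =
    ![θ 2, cornerValue Q (θ 0) (θ 2) (θ 1), θ 5, cornerValue Q (θ 0) (θ 2) (θ 3), θ 0] := by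
  simp [cross, patch]

theorem cross_patch_diag : cross (patch Q p θ) 1 1 =
    ![cornerValue Q (θ 0) (θ 2) (θ 1), cornerValue Q (θ 1) (cornerValue Q (θ 0) (θ 2) (θ 1)) p,
      cornerValue Q (θ 2) (θ 5) (cornerValue Q (θ 0) (θ 2) (θ 1)), θ 2, θ 1] := by
  simp [cross, patch]

end patchValues

theorem solvesAt_vec (hQ : IsClassFPrime Q) {u : ℤ → ℤ → 𝕜} {n m : ℤ} (hu : SolvesAt Q u n m)
    {X : Type*} {l : Filter X} {f : X → Fin 4 → 𝕜} (hf : Tendsto f l (𝓝 (quad u n m))) :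
    ∀ᶠ t in l, ∀ i, pd Q i (f t) ≠ 0 :=
  eventually_all.2 fun i => (((hQ.continuous_pd i).tendsto _).comp hf).eventually_ne (hu.2 i)

/-- All the corner values depend continuously on the six parameters and take the values of `u` at
`patchParams u n m`. Regularity and membership in `Ω` are open conditions, so they persist nearby.
-/
theorem eventually_admissibleAt (hQ : IsClassFPrime Q) {Ω : ℤ → ℤ → Set (Fin 5 → 𝕜)}
    (hΩ : ∀ n m, IsOpen (Ω n m)) {u : ℤ → ℤ → 𝕜} (hu : ∀ n m, SolvesAt Q u n m)
    (huΩ : ∀ n m, cross u n m ∈ Ω n m) (n m : ℤ) :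
    ∀ᶠ θ in 𝓝 (patchParams u n m),
      AdmissibleAt Q Ω n m (translate (patch Q (u (n + 1 + 1) m) θ) n m) := by
  obtain ⟨τ, hτ, sn⟩ := hQ.pd_symm_n
  obtain ⟨τ', hτ', sm⟩ := hQ.pd_symm_m
  have hτ0 : τ ≠ 0 := by rcases hτ with rfl | rfl <;> simp
  have hτ0' : τ' ≠ 0 := by rcases hτ' with rfl | rfl <;> simp
  have q00 := hu n m
  have qr := hu (n + 1) m
  have qu := hu n (m + 1)
  have ql := hu (n - 1) m
  have qd := hu n (m - 1)
  have T : ∀ i, Tendsto (fun θ : Fin 6 → 𝕜 => θ i) (𝓝 (patchParams u n m))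
      (𝓝 (patchParams u n m i)) := fun i => (continuous_apply i).tendsto _
  have t0 := T 0
  have t1 := T 1
  have t2 := T 2
  have t3 := T 3
  have t4 := T 4
  have t5 := T 5
  simp only [patchParams, Matrix.cons_val] at t0 t1 t2 t3 t4 t5
  rw [← patchParams] at t0 t1 t2 t3 t4 t5
  have tp := tendsto_const_nhds (x := u (n + 1 + 1) m) (f := 𝓝 (patchParams u n m))
  have t11 := tendsto_cornerValue hQ t0 t2 t1 q00.1 (q00.2 3)
  have tl : Tendsto (fun θ => cornerValue Q (θ 0) (θ 2) (θ 3)) (𝓝 (patchParams u n m))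
      (𝓝 (u (n - 1) (m + 1))) := by
    have h1 := ql.1
    have h2 := ql.2 2
    simp only [quad, sub_add_cancel] at h1 h2
    rw [(sn _ _ _ _).1] at h1
    rw [(sn _ _ _ _).2.2.2.1] at h2
    exact tendsto_cornerValue hQ t0 t2 t3 ((mul_eq_zero.1 h1).resolve_left hτ0)
      (right_ne_zero_of_mul h2)
  have td : Tendsto (fun θ => cornerValue Q (θ 0) (θ 4) (θ 1)) (𝓝 (patchParams u n m))
      (𝓝 (u (n + 1) (m - 1))) := by
    have h1 := qd.1
    have h2 := qd.2 1
    simp only [quad, sub_add_cancel] at h1 h2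
    rw [(sm _ _ _ _).1] at h1
    rw [(sm _ _ _ _).2.2.1] at h2
    exact tendsto_cornerValue hQ t0 t4 t1 ((mul_eq_zero.1 h1).resolve_left hτ0')
      (right_ne_zero_of_mul h2)
  have t12 := tendsto_cornerValue hQ t2 t5 t11 qu.1 (qu.2 3)
  have t21 := tendsto_cornerValue hQ t1 t11 tp qr.1 (qr.2 3)
  have r00 := solvesAt_vec hQ q00 (tendsto_vec4 t0 t1 t2 t11)
  have rr := solvesAt_vec hQ qr (tendsto_vec4 t1 tp t11 t21)
  have ru := solvesAt_vec hQ qu (tendsto_vec4 t2 t11 t5 t12)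
  have rl := solvesAt_vec hQ ql (f := fun θ : Fin 6 → 𝕜 => ![θ 3, θ 0, cornerValue Q (θ 0) (θ 2) (θ 3), θ 2])
    (by simp only [quad, sub_add_cancel]; exact tendsto_vec4 t3 t0 tl t2)
  have rd := solvesAt_vec hQ qd (f := fun θ : Fin 6 → 𝕜 => ![θ 4, cornerValue Q (θ 0) (θ 4) (θ 1), θ 0, θ 1])
    (by simp only [quad, sub_add_cancel]; exact tendsto_vec4 t4 td t0 t1)
  have m00 := (tendsto_vec5 t0 t1 t2 t3 t4).eventually_mem ((hΩ n m).mem_nhds (huΩ n m))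
  have m10 := Tendsto.eventually_mem
    (f := fun θ : Fin 6 → 𝕜 => ![θ 1, u (n + 1 + 1) m, cornerValue Q (θ 0) (θ 2) (θ 1), θ 0,
      cornerValue Q (θ 0) (θ 4) (θ 1)])
    (by simpa only [cross, add_sub_cancel_right] using tendsto_vec5 t1 tp t11 t0 td)
    ((hΩ (n + 1) m).mem_nhds (huΩ (n + 1) m))
  have m01 := Tendsto.eventually_mem
    (f := fun θ : Fin 6 → 𝕜 => ![θ 2, cornerValue Q (θ 0) (θ 2) (θ 1), θ 5, cornerValue Q (θ 0) (θ 2) (θ 3),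
      θ 0])
    (by simpa only [cross, add_sub_cancel_right] using tendsto_vec5 t2 t11 t5 tl t0)
    ((hΩ n (m + 1)).mem_nhds (huΩ n (m + 1)))
  have m11 := Tendsto.eventually_mem
    (f := fun θ : Fin 6 → 𝕜 => ![cornerValue Q (θ 0) (θ 2) (θ 1),
      cornerValue Q (θ 1) (cornerValue Q (θ 0) (θ 2) (θ 1)) (u (n + 1 + 1) m),
      cornerValue Q (θ 2) (θ 5) (cornerValue Q (θ 0) (θ 2) (θ 1)), θ 2, θ 1])
    (by simpa only [cross, add_sub_cancel_right] using tendsto_vec5 t11 t21 t12 t2 t1)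
    ((hΩ (n + 1) (m + 1)).mem_nhds (huΩ (n + 1) (m + 1)))
  filter_upwards [r00, rr, ru, rl, rd, m00, m10, m01, m11] with θ r00 rr ru rl rd m00 m10 m01 m11
  refine ⟨?_, ?_, ?_, ?_, ?_, ?_, ?_, ?_, ?_⟩
  · rw [SolvesAt, quad_translate, sub_self, sub_self, quad_patch]
    exact ⟨(eq_cornerValue_iff hQ (r00 3)).1 rfl, r00⟩
  · rw [SolvesAt, quad_translate, add_sub_cancel_left, sub_self, quad_patch_right]
    exact ⟨(eq_cornerValue_iff hQ (rr 3)).1 rfl, rr⟩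
  · rw [SolvesAt, quad_translate, add_sub_cancel_left, sub_self, quad_patch_up]
    exact ⟨(eq_cornerValue_iff hQ (ru 3)).1 rfl, ru⟩
  · rw [SolvesAt, quad_translate, sub_sub_cancel_left, sub_self, quad_patch_left]
    refine ⟨?_, rl⟩
    have h2 := rl 2
    rw [(sn _ _ _ _).2.2.2.1] at h2
    rw [(sn _ _ _ _).1, (eq_cornerValue_iff hQ (right_ne_zero_of_mul h2)).1 rfl, mul_zero]
  · rw [SolvesAt, quad_translate, sub_sub_cancel_left, sub_self, quad_patch_down]
    refine ⟨?_, rd⟩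
    have h2 := rd 1
    rw [(sm _ _ _ _).2.2.1] at h2
    rw [(sm _ _ _ _).1, (eq_cornerValue_iff hQ (right_ne_zero_of_mul h2)).1 rfl, mul_zero]
  · rwa [cross_translate, sub_self, sub_self, cross_patch]
  · rwa [cross_translate, add_sub_cancel_left, sub_self, cross_patch_right]
  · rwa [cross_translate, add_sub_cancel_left, sub_self, cross_patch_up]
  · rwa [cross_translate, add_sub_cancel_left, add_sub_cancel_left, cross_patch_diag]

/-- Implicit differentiation of `Q = 0`. The fourth argument `z` in the hypothesis is arbitrary
since `Q_{,4}` does not depend on it. -/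
theorem hasDerivAt_cornerValue (hQ : IsClassFPrime Q) {x x' y : 𝕜} {z : 𝕜}
    (h : pd Q 3 ![x, y, x', z] ≠ 0) :
    HasDerivAt (fun t => cornerValue Q x x' t)
      (-pd Q 1 ![x, y, x', cornerValue Q x x' y] / pd Q 3 ![x, y, x', cornerValue Q x x' y]) y := by
  have e : ∀ t, pd Q 3 ![x, t, x', 0] =
      Q ![x, 0, x', 1] - Q ![x, 0, x', 0]
      + (Q ![x, 1, x', 1] - Q ![x, 1, x', 0] - (Q ![x, 0, x', 1] - Q ![x, 0, x', 0])) * t := by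
    obtain ⟨c, rfl⟩ := exists_multiAffine hQ
    intro t
    simp only [pd_multiAffine, multiAffine, multiAffineD, Matrix.cons_val]; ring
  have e' : ∀ t, Q ![x, t, x', 0] =
      Q ![x, 0, x', 0] + (Q ![x, 1, x', 0] - Q ![x, 0, x', 0]) * t := by
    obtain ⟨c, rfl⟩ := exists_multiAffine hQ
    intro t
    simp only [multiAffine, Matrix.cons_val]; ring
  have e1 : ∀ z, pd Q 1 ![x, y, x', z] = (Q ![x, 1, x', 0] - Q ![x, 0, x', 0])
      + (Q ![x, 1, x', 1] - Q ![x, 1, x', 0] - (Q ![x, 0, x', 1] - Q ![x, 0, x', 0])) * z := by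
    obtain ⟨c, rfl⟩ := exists_multiAffine hQ
    intro t
    simp only [pd_multiAffine, multiAffine, multiAffineD, Matrix.cons_val]; ring
  rw [pd_three_congr hQ _ _ _ _ 0] at h
  have d1 : HasDerivAt (fun t => Q ![x, t, x', 0]) (Q ![x, 1, x', 0] - Q ![x, 0, x', 0]) y := by
    rw [funext e']
    simpa using ((hasDerivAt_id y).const_mul (Q ![x, 1, x', 0] - Q ![x, 0, x', 0])).const_add
      (Q ![x, 0, x', 0])
  have d2 : HasDerivAt (fun t => pd Q 3 ![x, t, x', 0])
      (Q ![x, 1, x', 1] - Q ![x, 1, x', 0] - (Q ![x, 0, x', 1] - Q ![x, 0, x', 0])) y := by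
    rw [funext e]
    simpa using ((hasDerivAt_id y).const_mul (Q ![x, 1, x', 1] - Q ![x, 1, x', 0]
      - (Q ![x, 0, x', 1] - Q ![x, 0, x', 0]))).const_add (Q ![x, 0, x', 1] - Q ![x, 0, x', 0])
  refine (d1.fun_neg.fun_div d2 h).congr_deriv ?_
  rw [pd_three_congr hQ _ _ _ (cornerValue Q x x' y) 0, e1, cornerValue]
  field_simp
  ring

theorem hasDerivAt_cornerValue_top (hQ : IsClassFPrime Q) {x x' y : 𝕜} {z : 𝕜}
    (h : pd Q 3 ![x, y, x', z] ≠ 0) :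
    HasDerivAt (fun t => cornerValue Q x t y)
      (-pd Q 2 ![x, y, x', cornerValue Q x x' y] / pd Q 3 ![x, y, x', cornerValue Q x x' y])
      x' := by
  have e : ∀ t, cornerValue Q x t y = cornerValue (transposeQ Q) x y t := by
    intro t
    rw [cornerValue, cornerValue, transposeQ_apply, (pd_transposeQ _ _ _ _).2.2.2]
  have := hasDerivAt_cornerValue hQ.transpose (x := x) (x' := y) (y := x') (z := z)
    (by rwa [(pd_transposeQ _ _ _ _).2.2.2])
  rw [(pd_transposeQ _ _ _ _).2.2.2, (pd_transposeQ _ _ _ _).2.1, ← e] at this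
  exact this.congr_of_eventuallyEq (Eventually.of_forall e)

theorem contDiff_h₁ (hQ : IsClassFPrime Q) {N : WithTop ℕ∞} {E : Type*} [NormedAddCommGroup E]
    [NormedSpace 𝕜 E] {f g : E → 𝕜} (hf : ContDiff 𝕜 N f) (hg : ContDiff 𝕜 N g) :
    ContDiff 𝕜 N fun p => h₁ Q (f p) (g p) := by
  obtain ⟨c, hc⟩ := exists_multiAffine hQ
  simp only [hQ.h₁_eq]
  rw [hc]
  simp only [multiAffine, Matrix.cons_val]
  fun_prop

theorem contDiff_G (hQ : IsClassFPrime Q) {N : WithTop ℕ∞} {E : Type*} [NormedAddCommGroup E]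
    [NormedSpace 𝕜 E] {f g : E → 𝕜} (hf : ContDiff 𝕜 N f) (hg : ContDiff 𝕜 N g) :
    ContDiff 𝕜 N fun p => G Q (f p) (g p) := by
  obtain ⟨c, hc⟩ := exists_multiAffine hQ
  simp only [hQ.G_eq]
  rw [hc]
  simp only [multiAffine, Matrix.cons_val]
  fun_prop

/-! ### The first integral: invariance of the ratio under the shift in `m` -/

/-- A five point symmetry `R` of `Q = 0` together with a solution `u` on the lattice. -/
structure SymmetryAlong (Q : (Fin 4 → 𝕜) → 𝕜) (Ω : ℤ → ℤ → Set (Fin 5 → 𝕜))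
    (R : ℤ → ℤ → (Fin 5 → 𝕜) → 𝕜) (u : ℤ → ℤ → 𝕜) : Prop where
  isClass : IsClassFPrime Q
  gInvertible₁ : GInvertible Q (h₁ Q)
  gInvertible₂ : GInvertible Q (h₂ Q)
  isOpen : ∀ n m, IsOpen (Ω n m)
  contDiffOn : ∀ n m, ContDiffOn 𝕜 ∞ (R n m) (Ω n m)
  symmetry : IsFivePointSymmetry Q Ω R
  solves : ∀ n m, SolvesAt Q u n m
  mem : ∀ n m, cross u n m ∈ Ω n m
  ne_n : ∀ n m, u (n + 1) m ≠ u (n - 1) m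
  ne_m : ∀ n m, u n (m + 1) ≠ u n (m - 1)

/-- The partial derivative with respect to the `i`-th of the five arguments. -/
def slotDeriv (F : (Fin 5 → 𝕜) → 𝕜) (i : Fin 5) (p : Fin 5 → 𝕜) : 𝕜 :=
  fderiv 𝕜 F p (Pi.single i 1)

/-- The ratio of `∂F/∂u₋₁₀` to the same derivative of the characteristic of `v_n`. -/
def leftRatio (Q : (Fin 4 → 𝕜) → 𝕜) (F : (Fin 5 → 𝕜) → 𝕜) (p : Fin 5 → 𝕜) : 𝕜 :=
  slotDeriv F 3 p * (p 1 - p 3) ^ 2 / h₁ Q (p 0) (p 1)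

/-- The difference of the two values of `Q` is taken in two steps, first changing `y` to `s` and
then `y'` to `s'`. It tells how the factor `(u₁₀ - u₋₁₀)²` changes under the shift in `m`. -/
theorem sub_mul_pd_one (hQ : IsClassFPrime Q) {x y x' y' s s' : 𝕜}
    (h : Q ![x, y, x', y'] = 0) (h' : Q ![x, s, x', s'] = 0) :
    (y - s) * pd Q 1 ![x, y, x', y'] + (y' - s') * pd Q 3 ![x, s, x', s'] = 0 := by
  have : (y - s) * pd Q 1 ![x, y, x', y'] + (y' - s') * pd Q 3 ![x, s, x', s'] =
      Q ![x, y, x', y'] - Q ![x, s, x', s'] := by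
    obtain ⟨c, rfl⟩ := exists_multiAffine hQ
    simp only [pd_multiAffine, multiAffine, multiAffineD, Matrix.cons_val]; ring
  rw [this, h, h', sub_zero]

variable {Ω : ℤ → ℤ → Set (Fin 5 → 𝕜)} {R : ℤ → ℤ → (Fin 5 → 𝕜) → 𝕜} {u : ℤ → ℤ → 𝕜}

namespace SymmetryAlong

theorem contDiffAt (S : SymmetryAlong Q Ω R u) {n m : ℤ} {p : Fin 5 → 𝕜} (hp : p ∈ Ω n m) :
    ContDiffAt 𝕜 ∞ (R n m) p :=
  (S.contDiffOn n m).contDiffAt ((S.isOpen n m).mem_nhds hp)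

theorem differentiableAt (S : SymmetryAlong Q Ω R u) {n m : ℤ} {p : Fin 5 → 𝕜} (hp : p ∈ Ω n m) :
    DifferentiableAt 𝕜 (R n m) p :=
  (S.contDiffAt hp).differentiableAt (by simp)

/-- The symmetry condition is differentiated with respect to `θ 3 = u₋₁₀`, on which only `R` at `(n,
m)` and, through `u₋₁₁`, `R` at `(n, m+1)` depend. On `Q = 0` the two polynomials `h₁` are `-Q_{,3}
Q_{,4}` and `-Q_{,1} Q_{,2}`, and the squared differences are related by `sub_mul_pd_one`. -/
theorem eventually_leftRatio_eq (S : SymmetryAlong Q Ω R u) (n m : ℤ) :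
    ∀ᶠ θ in 𝓝 (patchParams u n m),
      leftRatio Q (R n m) ![θ 0, θ 1, θ 2, θ 3, θ 4] =
      leftRatio Q (R n (m + 1)) ![θ 2, cornerValue Q (θ 0) (θ 2) (θ 1), θ 5,
        cornerValue Q (θ 0) (θ 2) (θ 3), θ 0] := by
  have hQ := S.isClass
  obtain ⟨τ, hτ, sn⟩ := hQ.pd_symm_n
  have hτ0 : τ ≠ 0 := by rcases hτ with rfl | rfl <;> simp
  filter_upwards [(eventually_admissibleAt hQ S.isOpen S.solves S.mem n m).eventually_nhds]
    with θ hθ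
  have h0 := hθ.self_of_nhds
  have q00 := h0.solves
  have ql := h0.solves_left
  have m00 := h0.mem₀₀
  have m01 := h0.mem₀₁
  rw [SolvesAt, quad_translate, sub_self, sub_self, quad_patch] at q00
  rw [SolvesAt, quad_translate, sub_sub_cancel_left, sub_self, quad_patch_left, (sn _ _ _ _).1]
    at ql
  have q3 := ql.2 2
  rw [(sn _ _ _ _).2.2.2.1] at q3
  replace q3 := right_ne_zero_of_mul q3
  replace ql := (mul_eq_zero.1 ql.1).resolve_left hτ0
  rw [cross_translate, sub_self, sub_self, cross_patch] at m00
  rw [cross_translate, add_sub_cancel_left, sub_self, cross_patch_up] at m01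
  have cond : ∀ᶠ t in 𝓝 (θ 3),
      pd Q 0 ![θ 0, θ 1, θ 2, cornerValue Q (θ 0) (θ 2) (θ 1)]
          * R n m (Function.update ![θ 0, θ 1, θ 2, θ 3, θ 4] 3 t)
        + pd Q 1 ![θ 0, θ 1, θ 2, cornerValue Q (θ 0) (θ 2) (θ 1)]
          * R (n + 1) m (cross (patch Q (u (n + 1 + 1) m) θ) 1 0)
        + pd Q 2 ![θ 0, θ 1, θ 2, cornerValue Q (θ 0) (θ 2) (θ 1)]
          * R n (m + 1) (Function.update ![θ 2, cornerValue Q (θ 0) (θ 2) (θ 1), θ 5,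
              cornerValue Q (θ 0) (θ 2) (θ 3), θ 0] 3 (cornerValue Q (θ 0) (θ 2) t))
        + pd Q 3 ![θ 0, θ 1, θ 2, cornerValue Q (θ 0) (θ 2) (θ 1)]
          * R (n + 1) (m + 1) (cross (patch Q (u (n + 1 + 1) m) θ) 1 1) = 0 := by
    have ht : Tendsto (fun t => Function.update θ 3 t) (𝓝 (θ 3)) (𝓝 θ) := by
      have : Continuous (fun t => Function.update θ 3 t) := continuous_const.update 3 continuous_id
      simpa using this.tendsto (θ 3)
    filter_upwards [ht.eventually hθ] with t h
    have key := S.symmetry n m _ h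
    rw [quad_translate, cross_translate, cross_translate, cross_translate, cross_translate,
      sub_self, sub_self, add_sub_cancel_left, add_sub_cancel_left, quad_patch, cross_patch,
      cross_patch_right, cross_patch_up, cross_patch_diag] at key
    rw [cross_patch_right, cross_patch_diag]
    have u1 : ∀ a b c d e f : 𝕜, Function.update ![a, b, c, d, e] 3 f = ![a, b, c, f, e] := by
      intro a b c d e f
      ext i; fin_cases i <;> simp
    rw [u1, u1]
    simpa using key
  have d1 : HasDerivAt (fun t => R n m (Function.update ![θ 0, θ 1, θ 2, θ 3, θ 4] 3 t))
      (slotDeriv (R n m) 3 ![θ 0, θ 1, θ 2, θ 3, θ 4]) (θ 3) := by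
    refine HasFDerivAt.comp_hasDerivAt (θ 3) ?_ (hasDerivAt_update _ 3 (θ 3))
    have : Function.update ![θ 0, θ 1, θ 2, θ 3, θ 4] 3 (θ 3) = ![θ 0, θ 1, θ 2, θ 3, θ 4] :=
      Function.update_eq_self 3 ![θ 0, θ 1, θ 2, θ 3, θ 4]
    rw [this]
    exact (S.differentiableAt m00).hasFDerivAt
  have dM := hasDerivAt_cornerValue hQ q3
  have d2 : HasDerivAt (fun t => R n (m + 1) (Function.update ![θ 2, cornerValue Q (θ 0) (θ 2) (θ 1),
      θ 5, cornerValue Q (θ 0) (θ 2) (θ 3), θ 0] 3 t))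
      (slotDeriv (R n (m + 1)) 3 ![θ 2, cornerValue Q (θ 0) (θ 2) (θ 1),
      θ 5, cornerValue Q (θ 0) (θ 2) (θ 3), θ 0]) (cornerValue Q (θ 0) (θ 2) (θ 3)) := by
    refine HasFDerivAt.comp_hasDerivAt (cornerValue Q (θ 0) (θ 2) (θ 3)) ?_
      (hasDerivAt_update _ 3 (cornerValue Q (θ 0) (θ 2) (θ 3)))
    have : Function.update ![θ 2, cornerValue Q (θ 0) (θ 2) (θ 1),
      θ 5, cornerValue Q (θ 0) (θ 2) (θ 3), θ 0] 3 (cornerValue Q (θ 0) (θ 2) (θ 3)) =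
      ![θ 2, cornerValue Q (θ 0) (θ 2) (θ 1), θ 5, cornerValue Q (θ 0) (θ 2) (θ 3), θ 0] :=
      Function.update_eq_self 3 ![θ 2, cornerValue Q (θ 0) (θ 2) (θ 1),
      θ 5, cornerValue Q (θ 0) (θ 2) (θ 3), θ 0]
    rw [this]
    exact (S.differentiableAt m01).hasFDerivAt
  have d3 := ((((d1.const_mul (pd Q 0 ![θ 0, θ 1, θ 2, cornerValue Q (θ 0) (θ 2) (θ 1)])).add_const
    (pd Q 1 ![θ 0, θ 1, θ 2, cornerValue Q (θ 0) (θ 2) (θ 1)]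
          * R (n + 1) m (cross (patch Q (u (n + 1 + 1) m) θ) 1 0))).add
    ((d2.comp (θ 3) dM).const_mul (pd Q 2 ![θ 0, θ 1, θ 2, cornerValue Q (θ 0) (θ 2) (θ 1)]))).add_const
    (pd Q 3 ![θ 0, θ 1, θ 2, cornerValue Q (θ 0) (θ 2) (θ 1)]
          * R (n + 1) (m + 1) (cross (patch Q (u (n + 1 + 1) m) θ) 1 1)))
  have d4 := d3.unique ((hasDerivAt_const (θ 3) (0 : 𝕜)).congr_of_eventuallyEq cond)
  obtain ⟨qz, qne⟩ := q00
  have r1 := sub_mul_pd_one hQ qz ql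
  have r2 := sub_mul_pd_one hQ ql qz
  have e1 := hQ.h₁_eq_hPoly ![θ 0, θ 1, θ 2, cornerValue Q (θ 0) (θ 2) (θ 1)]
  have e2 := hQ.h₁_eq_hPoly_top ![θ 0, θ 1, θ 2, cornerValue Q (θ 0) (θ 2) (θ 1)]
  rw [hPoly, qz, zero_mul, zero_sub] at e1 e2
  simp only [Matrix.cons_val] at e1 e2
  simp only [leftRatio, Matrix.cons_val]
  rw [pd_three_congr hQ _ _ _ _ (cornerValue Q (θ 0) (θ 2) (θ 3))] at q3
  rw [e1, e2, div_eq_div_iff (neg_ne_zero.2 (mul_ne_zero (qne 2) (qne 3)))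
    (neg_ne_zero.2 (mul_ne_zero (qne 0) (qne 1)))]
  have d5 : pd Q 0 ![θ 0, θ 1, θ 2, cornerValue Q (θ 0) (θ 2) (θ 1)]
        * slotDeriv (R n m) 3 ![θ 0, θ 1, θ 2, θ 3, θ 4]
        * pd Q 3 ![θ 0, θ 3, θ 2, cornerValue Q (θ 0) (θ 2) (θ 3)]
      = pd Q 2 ![θ 0, θ 1, θ 2, cornerValue Q (θ 0) (θ 2) (θ 1)]
        * slotDeriv (R n (m + 1)) 3 ![θ 2, cornerValue Q (θ 0) (θ 2) (θ 1), θ 5,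
          cornerValue Q (θ 0) (θ 2) (θ 3), θ 0]
        * pd Q 1 ![θ 0, θ 3, θ 2, cornerValue Q (θ 0) (θ 2) (θ 3)] := by
    field_simp at d4
    linear_combination d4
  refine mul_right_cancel₀ q3 ?_
  -- `r1` and `r2` together say that `(u₁₀ - u₋₁₀)²` and `(u₁₁ - u₋₁₁)²` are inversely proportional
  -- to the products of the values of `Q_{,2}` and of `Q_{,4}` on the two columns; `d5` is the
  -- differentiated condition without denominators.
  linear_combination (-(θ 1 - θ 3) ^ 2
      * pd Q 1 ![θ 0, θ 1, θ 2, cornerValue Q (θ 0) (θ 2) (θ 1)]) * d5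
    - (pd Q 2 ![θ 0, θ 1, θ 2, cornerValue Q (θ 0) (θ 2) (θ 1)]
      * slotDeriv (R n (m + 1)) 3 ![θ 2, cornerValue Q (θ 0) (θ 2) (θ 1), θ 5,
          cornerValue Q (θ 0) (θ 2) (θ 3), θ 0])
      * ((θ 1 - θ 3) * pd Q 1 ![θ 0, θ 3, θ 2, cornerValue Q (θ 0) (θ 2) (θ 3)] * r1
        + (cornerValue Q (θ 0) (θ 2) (θ 1) - cornerValue Q (θ 0) (θ 2) (θ 3))
          * pd Q 3 ![θ 0, θ 3, θ 2, cornerValue Q (θ 0) (θ 2) (θ 3)] * r2)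

end SymmetryAlong

/-! ### Reduction of the arguments of the ratio -/

theorem tendsto_vec3 {X : Type*} {l : Filter X} {f g h : X → 𝕜} {a b c : 𝕜}
    (hf : Tendsto f l (𝓝 a)) (hg : Tendsto g l (𝓝 b)) (hh : Tendsto h l (𝓝 c)) :
    Tendsto (fun t => (![f t, g t, h t] : Fin 3 → 𝕜)) l (𝓝 ![a, b, c]) := by
  refine tendsto_pi_nhds.2 fun i => ?_
  fin_cases i <;> simpa

theorem tendsto_apply {k : ℕ} (b : Fin k → 𝕜) (i : Fin k) :
    Tendsto (fun p : Fin k → 𝕜 => p i) (𝓝 b) (𝓝 (b i)) := (continuous_apply i).tendsto b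

/-- `leftRatio` with the arguments it does not depend on fixed. -/
def leftRatioRed (Q : (Fin 4 → 𝕜) → 𝕜) (F : (Fin 5 → 𝕜) → 𝕜) (b c : 𝕜) (r : Fin 3 → 𝕜) : 𝕜 :=
  leftRatio Q F ![r 0, r 1, b, r 2, c]

theorem h₁_ne_zero (hQ : IsClassFPrime Q) {v : Fin 4 → 𝕜} (h : Q v = 0) (hv : ∀ i, pd Q i v ≠ 0) :
    h₁ Q (v 0) (v 1) ≠ 0 := by
  rw [hQ.h₁_eq_hPoly, hPoly, h, zero_mul, zero_sub]
  exact neg_ne_zero.2 (mul_ne_zero (hv 2) (hv 3))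

theorem cornerValue_inv (hQ : IsClassFPrime Q) {τ x x' y' z : 𝕜} (hτ : τ ≠ 0)
    (h : ∀ u x y z : 𝕜, Q ![u, x, y, z] = τ * Q ![y, z, u, x])
    (h1 : pd Q 3 ![x', y', x, z] ≠ 0) (h2 : pd Q 3 ![x, cornerValue Q x' x y', x', z] ≠ 0) :
    cornerValue Q x x' (cornerValue Q x' x y') = y' := by
  refine ((eq_cornerValue_iff hQ h2).2 ?_).symm
  have := (eq_cornerValue_iff hQ h1).1 rfl
  rw [h] at this
  exact (mul_eq_zero.1 this).resolve_left hτ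

theorem mirror_regular (hQ : IsClassFPrime Q) {x y x' y' : 𝕜}
    (h : Q ![x, y, x', y'] = 0 ∧ ∀ i, pd Q i ![x, y, x', y'] ≠ 0) :
    Q ![y, x, y', x'] = 0 ∧ ∀ i, pd Q i ![y, x, y', x'] ≠ 0 := by
  obtain ⟨τ, hτ, sn⟩ := hQ.pd_symm_n
  have hτ0 : τ ≠ 0 := by rcases hτ with rfl | rfl <;> simp
  obtain ⟨e, e0, e1, e2, e3⟩ := sn y x y' x'
  refine ⟨by rw [e, h.1, mul_zero], fun i => ?_⟩
  fin_cases i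
  · exact e0 ▸ mul_ne_zero hτ0 (h.2 1)
  · exact e1 ▸ mul_ne_zero hτ0 (h.2 0)
  · exact e2 ▸ mul_ne_zero hτ0 (h.2 3)
  · exact e3 ▸ mul_ne_zero hτ0 (h.2 2)

/-- Near a regular point, the equation can be solved for the second argument. -/
theorem tendsto_cornerValue_inv (hQ : IsClassFPrime Q) {x₀ y₀ ξ₀ η₀ : 𝕜}
    (h : Q ![x₀, y₀, ξ₀, η₀] = 0 ∧ ∀ i, pd Q i ![x₀, y₀, ξ₀, η₀] ≠ 0) {X : Type*} {l : Filter X}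
    {x ξ η : X → 𝕜} (hx : Tendsto x l (𝓝 x₀)) (hξ : Tendsto ξ l (𝓝 ξ₀))
    (hη : Tendsto η l (𝓝 η₀)) :
    Tendsto (fun t => cornerValue Q (ξ t) (x t) (η t)) l (𝓝 y₀) ∧
    ∀ᶠ t in l, Q ![x t, cornerValue Q (ξ t) (x t) (η t), ξ t, η t] = 0 ∧
      (∀ i, pd Q i ![x t, cornerValue Q (ξ t) (x t) (η t), ξ t, η t] ≠ 0) ∧
      cornerValue Q (x t) (ξ t) (cornerValue Q (ξ t) (x t) (η t)) = η t := by
  obtain ⟨τ, hτ, sm⟩ := hQ.pd_symm_m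
  have hτ0 : τ ≠ 0 := by rcases hτ with rfl | rfl <;> simp
  obtain ⟨h1, h2⟩ := h
  have h21 := h2 1
  rw [(sm _ _ _ _).1] at h1
  rw [(sm _ _ _ _).2.2.1] at h21
  have T := tendsto_cornerValue hQ hξ hx hη ((mul_eq_zero.1 h1).resolve_left hτ0)
    (right_ne_zero_of_mul h21)
  refine ⟨T, ?_⟩
  have hne : ∀ᶠ t in l, ∀ i, pd Q i ![x t, cornerValue Q (ξ t) (x t) (η t), ξ t, η t] ≠ 0 :=
    eventually_all.2 fun i => (((hQ.continuous_pd i).tendsto _).comp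
      (tendsto_vec4 hx T hξ hη)).eventually_ne (h2 i)
  filter_upwards [hne] with t ht
  have ht1 := ht 1
  have ht3 := ht 3
  rw [(sm _ _ _ _).2.2.1] at ht1
  replace ht1 := right_ne_zero_of_mul ht1
  refine ⟨?_, ht, ?_⟩
  · rw [(sm _ _ _ _).1, (eq_cornerValue_iff hQ ht1).1 rfl, mul_zero]
  · rw [pd_three_congr hQ _ _ _ _ 0] at ht1 ht3
    exact cornerValue_inv hQ hτ0 (fun u x y z => (sm u x y z).1) ht1 ht3

/-- The linear form in the gradient of `F` whose coefficients are those of the flow of the equation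
in the direction of its upper left vertex. -/
def gradientForm (Q : (Fin 4 → 𝕜) → 𝕜) (F : (Fin 3 → 𝕜) → 𝕜) (r : Fin 3 → 𝕜) (x : 𝕜) : 𝕜 :=
  h₂ Q x (r 0) * fderiv 𝕜 F r (Pi.single 0 1) + G Q x (r 1) * -fderiv 𝕜 F r (Pi.single 1 1)
    + G Q x (r 2) * -fderiv 𝕜 F r (Pi.single 2 1)

namespace SymmetryAlong

theorem regular_right (S : SymmetryAlong Q Ω R u) (n m : ℤ) :
    Q ![u n m, u (n + 1) m, u n (m + 1), u (n + 1) (m + 1)] = 0 ∧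
    ∀ i, pd Q i ![u n m, u (n + 1) m, u n (m + 1), u (n + 1) (m + 1)] ≠ 0 :=
  S.solves n m

theorem regular_left (S : SymmetryAlong Q Ω R u) (n m : ℤ) :
    Q ![u n m, u (n - 1) m, u n (m + 1), u (n - 1) (m + 1)] = 0 ∧
    ∀ i, pd Q i ![u n m, u (n - 1) m, u n (m + 1), u (n - 1) (m + 1)] ≠ 0 := by
  have := S.solves (n - 1) m
  simp only [SolvesAt, quad, sub_add_cancel] at this
  exact mirror_regular S.isClass this

/-- The value of the ratio at `(n, m+1)` does not involve `u₀₋₁`, so neither does the value at `(n,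
m)` that equals it. -/
theorem eventually_leftRatio_eq_update_four (S : SymmetryAlong Q Ω R u) (n m : ℤ) :
    ∀ᶠ p in 𝓝 (cross u n m), leftRatio Q (R n m) p =
      leftRatio Q (R n m) ![p 0, p 1, p 2, p 3, u n (m - 1)] := by
  have T := tendsto_apply (cross u n m)
  have t0 := T 0
  have t1 := T 1
  have t2 := T 2
  have t3 := T 3
  have t4 := T 4
  have c := fun a : 𝕜 => tendsto_const_nhds (x := a) (f := 𝓝 (cross u n m))
  have h := S.eventually_leftRatio_eq n m
  filter_upwards [(tendsto_vec6 t0 t1 t2 t3 t4 (c (u n (m + 1 + 1)))).eventually h,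
    (tendsto_vec6 t0 t1 t2 t3 (c (u n (m - 1))) (c (u n (m + 1 + 1)))).eventually h] with p h1 h2
  simp only [Matrix.cons_val] at h1 h2
  rw [h2, ← h1, vec5_eta]

/-- Conversely, the ratio at `(n, m)` does not involve `u₀₂`. To reach an arbitrary point near
`cross u n (m + 1)`, the equation is solved downwards for `u₁₀` and `u₋₁₀`. -/
theorem eventually_leftRatio_eq_update_two (S : SymmetryAlong Q Ω R u) (n m : ℤ) :
    ∀ᶠ p in 𝓝 (cross u n (m + 1)), leftRatio Q (R n (m + 1)) p =
      leftRatio Q (R n (m + 1)) ![p 0, p 1, u n (m + 1 + 1), p 3, p 4] := by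
  have hQ := S.isClass
  have T := tendsto_apply (cross u n (m + 1))
  have t0 := T 0
  have t1 := T 1
  have t2 := T 2
  have t3 := T 3
  have t4 : Tendsto (fun p : Fin 5 → 𝕜 => p 4) (𝓝 (cross u n (m + 1))) (𝓝 (u n m)) := by
    simpa [cross] using T 4
  have c := fun a : 𝕜 => tendsto_const_nhds (x := a) (f := 𝓝 (cross u n (m + 1)))
  have h := S.eventually_leftRatio_eq n m
  obtain ⟨ty, hy⟩ := tendsto_cornerValue_inv hQ (S.regular_right n m) t4 t0 t1
  obtain ⟨tz, hz⟩ := tendsto_cornerValue_inv hQ (S.regular_left n m) t4 t0 t3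
  filter_upwards [(tendsto_vec6 t4 ty t0 tz (c (u n (m - 1))) t2).eventually h,
    (tendsto_vec6 t4 ty t0 tz (c (u n (m - 1))) (c (u n (m + 1 + 1)))).eventually h, hy, hz]
    with p h1 h2 hy hz
  simp only [Matrix.cons_val, hy.2.2, hz.2.2] at h1 h2
  rw [← h2, h1, vec5_eta]

theorem eventually_leftRatio_eq_red (S : SymmetryAlong Q Ω R u) (n m : ℤ) :
    ∀ᶠ p in 𝓝 (cross u n m), leftRatio Q (R n m) p =
      leftRatioRed Q (R n m) (u n (m + 1)) (u n (m - 1)) ![p 0, p 1, p 3] := by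
  have T := tendsto_apply (cross u n m)
  have t0 := T 0
  have t1 := T 1
  have t2 := T 2
  have t3 := T 3
  have c := fun a : 𝕜 => tendsto_const_nhds (x := a) (f := 𝓝 (cross u n m))
  have h := S.eventually_leftRatio_eq_update_two n (m - 1)
  rw [sub_add_cancel] at h
  filter_upwards [(tendsto_vec5 t0 t1 t2 t3 (c (u n (m - 1)))).eventually h,
    S.eventually_leftRatio_eq_update_four n m] with p h1 h2
  rw [h2, h1]
  rfl

theorem eventually_leftRatioRed_eq (S : SymmetryAlong Q Ω R u) (n m : ℤ) :
    ∀ᶠ κ : Fin 4 → 𝕜 in 𝓝 ![u n m, u (n + 1) m, u n (m + 1), u (n - 1) m],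
      leftRatioRed Q (R n m) (u n (m + 1)) (u n (m - 1)) ![κ 0, κ 1, κ 3] =
      leftRatioRed Q (R n (m + 1)) (u n (m + 1 + 1)) (u n (m + 1 - 1))
        ![κ 2, cornerValue Q (κ 0) (κ 2) (κ 1), cornerValue Q (κ 0) (κ 2) (κ 3)] := by
  have hQ := S.isClass
  set b : Fin 4 → 𝕜 := ![u n m, u (n + 1) m, u n (m + 1), u (n - 1) m] with hb
  have T := tendsto_apply b
  have t0 : Tendsto (fun κ : Fin 4 → 𝕜 => κ 0) (𝓝 b) (𝓝 (u n m)) := T 0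
  have t1 : Tendsto (fun κ : Fin 4 → 𝕜 => κ 1) (𝓝 b) (𝓝 (u (n + 1) m)) := T 1
  have t2 : Tendsto (fun κ : Fin 4 → 𝕜 => κ 2) (𝓝 b) (𝓝 (u n (m + 1))) := T 2
  have t3 : Tendsto (fun κ : Fin 4 → 𝕜 => κ 3) (𝓝 b) (𝓝 (u (n - 1) m)) := T 3
  have c := fun a : 𝕜 => tendsto_const_nhds (x := a) (f := 𝓝 b)
  have ty := tendsto_cornerValue hQ t0 t2 t1 (S.regular_right n m).1 ((S.regular_right n m).2 3)
  have tz := tendsto_cornerValue hQ t0 t2 t3 (S.regular_left n m).1 ((S.regular_left n m).2 3)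
  have c1 := (tendsto_vec5 t0 t1 t2 t3 (c (u n (m - 1)))).eventually
    (S.eventually_leftRatio_eq_red n m)
  have c2 := Tendsto.eventually (f := fun κ : Fin 4 → 𝕜 => ![κ 2, cornerValue Q (κ 0) (κ 2) (κ 1),
      u n (m + 1 + 1), cornerValue Q (κ 0) (κ 2) (κ 3), κ 0])
    (by simpa only [cross, add_sub_cancel_right] using tendsto_vec5 t2 ty (c (u n (m + 1 + 1))) tz t0)
    (S.eventually_leftRatio_eq_red n (m + 1))
  filter_upwards [(tendsto_vec6 t0 t1 t2 t3 (c (u n (m - 1))) (c (u n (m + 1 + 1)))).eventually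
    (S.eventually_leftRatio_eq n m), c1, c2] with κ h1 h2 h3
  simp only [Matrix.cons_val] at h1 h2 h3
  rw [← h2, h1, h3]

theorem contDiffAt_leftRatio (S : SymmetryAlong Q Ω R u) {n m : ℤ} {p : Fin 5 → 𝕜}
    (hp : p ∈ Ω n m) (h : h₁ Q (p 0) (p 1) ≠ 0) : ContDiffAt 𝕜 ∞ (leftRatio Q (R n m)) p := by
  unfold leftRatio slotDeriv
  have h1 : ContDiffAt 𝕜 ∞ (fun p => fderiv 𝕜 (R n m) p (Pi.single 3 1)) p :=
    ((S.contDiffAt hp).fderiv_right (m := ∞) (by simp)).clm_apply contDiffAt_const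
  refine (h1.mul ?_).div (contDiff_h₁ S.isClass ?_ ?_).contDiffAt h <;> fun_prop

theorem contDiffAt_leftRatioRed (S : SymmetryAlong Q Ω R u) (n m : ℤ) :
    ∀ᶠ r in 𝓝 ![u n m, u (n + 1) m, u (n - 1) m],
      ContDiffAt 𝕜 ∞ (leftRatioRed Q (R n m) (u n (m + 1)) (u n (m - 1))) r := by
  have hL : ContDiff 𝕜 ∞ (fun r : Fin 3 → 𝕜 =>
      (![r 0, r 1, u n (m + 1), r 2, u n (m - 1)] : Fin 5 → 𝕜)) := by
    refine contDiff_pi.2 fun i => ?_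
    fin_cases i <;> simp only [Fin.reduceFinMk, Fin.zero_eta, Fin.mk_one, Matrix.cons_val] <;>
      fun_prop
  have hh : ContDiff 𝕜 ∞ (fun p : Fin 5 → 𝕜 => h₁ Q (p 0) (p 1)) :=
    contDiff_h₁ S.isClass (by fun_prop) (by fun_prop)
  have h1 := (hL.continuous.tendsto ![u n m, u (n + 1) m, u (n - 1) m]).eventually
    (((S.isOpen n m).mem_nhds (S.mem n m)))
  have h2 := (hL.continuous.tendsto ![u n m, u (n + 1) m, u (n - 1) m]).eventually
    ((hh.continuous.tendsto (cross u n m)).eventually_ne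
      (h₁_ne_zero S.isClass (S.solves n m).1 (S.solves n m).2))
  filter_upwards [h1, h2] with r h1 h2
  exact ContDiffAt.comp (g := leftRatio Q (R n m)) _ (S.contDiffAt_leftRatio h1 h2) hL.contDiffAt

/-- With the lower row `x, y, z` fixed, the ratio at `(n, m+1)` is constant along the curve in which
`u₀₁` varies and the upper corners follow. The chain rule, multiplied by `h₂`, is the claim, since
the corners have derivatives `-G/h₂`. The point `r` and the value `x` may be prescribed
independently, as `y` and `z` can be solved for. -/
theorem eventually_gradient (S : SymmetryAlong Q Ω R u) (n m : ℤ) :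
    ∀ᶠ r in 𝓝 ![u n (m + 1), u (n + 1) (m + 1), u (n - 1) (m + 1)], ∀ᶠ x in 𝓝 (u n m),
      gradientForm Q (leftRatioRed Q (R n (m + 1)) (u n (m + 1 + 1)) (u n (m + 1 - 1))) r x = 0 := by
  have hQ := S.isClass
  set b : Fin 3 → 𝕜 := ![u n (m + 1), u (n + 1) (m + 1), u (n - 1) (m + 1)] with hb
  refine Filter.Eventually.curry_nhds (p := fun q : (Fin 3 → 𝕜) × 𝕜 => gradientForm Q
    (leftRatioRed Q (R n (m + 1)) (u n (m + 1 + 1)) (u n (m + 1 - 1))) q.1 q.2 = 0) ?_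
  have T := fun i => (tendsto_apply b i).comp (continuous_fst.tendsto (b, u n m))
  have t0 : Tendsto (fun q : (Fin 3 → 𝕜) × 𝕜 => q.1 0) (𝓝 (b, u n m)) (𝓝 (u n (m + 1))) := T 0
  have t1 : Tendsto (fun q : (Fin 3 → 𝕜) × 𝕜 => q.1 1) (𝓝 (b, u n m))
    (𝓝 (u (n + 1) (m + 1))) := T 1
  have t2 : Tendsto (fun q : (Fin 3 → 𝕜) × 𝕜 => q.1 2) (𝓝 (b, u n m))
    (𝓝 (u (n - 1) (m + 1))) := T 2
  have tx : Tendsto (fun q : (Fin 3 → 𝕜) × 𝕜 => q.2) (𝓝 (b, u n m)) (𝓝 (u n m)) :=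
    continuous_snd.tendsto (b, u n m)
  obtain ⟨ty, hy⟩ := tendsto_cornerValue_inv hQ (S.regular_right n m) tx t0 t1
  obtain ⟨tz, hz⟩ := tendsto_cornerValue_inv hQ (S.regular_left n m) tx t0 t2
  have hrel := (tendsto_vec4 tx ty t0 tz).eventually
    (S.eventually_leftRatioRed_eq n m).eventually_nhds
  have hdiff := (continuous_fst.tendsto (b, u n m)).eventually (S.contDiffAt_leftRatioRed n (m + 1))
  filter_upwards [hrel, hdiff, hy, hz] with q hrel hdiff hy hz
  obtain ⟨r, x⟩ := q
  obtain ⟨ξ, η, ζ, rfl⟩ : ∃ ξ η ζ, r = ![ξ, η, ζ] :=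
    ⟨r 0, r 1, r 2, by ext i; fin_cases i <;> rfl⟩
  simp only [gradientForm, Matrix.cons_val] at hrel hy hz ⊢
  generalize leftRatioRed Q (R n (m + 1)) (u n (m + 1 + 1)) (u n (m + 1 - 1)) = F at hrel hdiff ⊢
  generalize cornerValue Q ξ x η = y at *
  generalize cornerValue Q ξ x ζ = z at *
  have hc : Tendsto (fun t => (![x, y, t, z] : Fin 4 → 𝕜)) (𝓝 ξ) (𝓝 ![x, y, ξ, z]) :=
    tendsto_vec4 tendsto_const_nhds tendsto_const_nhds tendsto_id tendsto_const_nhds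
  have hconst := hc.eventually hrel
  simp only [Matrix.cons_val] at hconst
  have dy := hasDerivAt_cornerValue_top hQ (hy.2.1 3)
  have dz := hasDerivAt_cornerValue_top hQ (hz.2.1 3)
  rw [hy.2.2] at dy
  rw [hz.2.2] at dz
  have dc : HasDerivAt (fun t => (![t, cornerValue Q x t y, cornerValue Q x t z] : Fin 3 → 𝕜))
      ![1, -pd Q 2 ![x, y, ξ, η] / pd Q 3 ![x, y, ξ, η],
        -pd Q 2 ![x, z, ξ, ζ] / pd Q 3 ![x, z, ξ, ζ]] ξ := by
    refine hasDerivAt_pi.2 fun i => ?_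
    fin_cases i
    · exact hasDerivAt_id ξ
    · exact dy
    · exact dz
  have dF : HasFDerivAt F (fderiv 𝕜 F ![ξ, η, ζ])
      ((fun t => (![t, cornerValue Q x t y, cornerValue Q x t z] : Fin 3 → 𝕜)) ξ) := by
    simp only [hy.2.2, hz.2.2]
    exact (hdiff.differentiableAt (by simp)).hasFDerivAt
  have d := (dF.comp_hasDerivAt ξ dc).unique
    ((hasDerivAt_const ξ _).congr_of_eventuallyEq (hconst.mono fun t ht => ht.symm))
  -- The velocity of the curve in the standard basis, so that the chain rule shows the three partial
  -- derivatives.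
  have split : ∀ a b : 𝕜, (![1, a, b] : Fin 3 → 𝕜) =
      Pi.single 0 1 + a • Pi.single 1 1 + b • Pi.single 2 1 := by
    intro a b
    ext i; fin_cases i <;> simp
  rw [split, map_add, map_add, map_smul, map_smul, smul_eq_mul, smul_eq_mul] at d
  have e1 := hQ.h₂_eq_hPoly ![x, y, ξ, η]
  have e2 := hQ.h₂_eq_hPoly ![x, z, ξ, ζ]
  have e3 := hQ.G_eq_hPoly_antidiagonal ![x, y, ξ, η]
  have e4 := hQ.G_eq_hPoly_antidiagonal ![x, z, ξ, ζ]
  rw [hPoly, hy.1, zero_mul, zero_sub] at e1 e3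
  rw [hPoly, hz.1, zero_mul, zero_sub] at e2 e4
  simp only [Matrix.cons_val] at e1 e2 e3 e4
  have f1 : h₂ Q x ξ * (-pd Q 2 ![x, y, ξ, η] / pd Q 3 ![x, y, ξ, η]) = -G Q x η := by
    have := hy.2.1 3
    rw [e1, e3]; field_simp
  have f2 : h₂ Q x ξ * (-pd Q 2 ![x, z, ξ, ζ] / pd Q 3 ![x, z, ξ, ζ]) = -G Q x ζ := by
    have := hz.2.1 3
    rw [e2, e4]; field_simp
  linear_combination h₂ Q x ξ * d - fderiv 𝕜 F ![ξ, η, ζ] (Pi.single 1 1) * f1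
    - fderiv 𝕜 F ![ξ, η, ζ] (Pi.single 2 1) * f2

end SymmetryAlong

/-! ### Quadratic polynomials and the matrix `𝒢` -/

/-- `f` is a quadratic polynomial. -/
def IsQuadratic (f : 𝕜 → 𝕜) : Prop :=
  ∃ k₀ k₁ k₂ : 𝕜, ∀ t, f t = k₀ + k₁ * t + k₂ * t ^ 2

namespace IsQuadratic

theorem deriv_zero {f : 𝕜 → 𝕜} (hf : IsQuadratic f) : deriv f 0 = (f 1 - f (-1)) / 2 := by
  obtain ⟨k₀, k₁, k₂, h⟩ := hf
  have := congrArg (fun f => deriv f 0) (funext h)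
  simp only [deriv_quadratic] at this
  rw [this, h, h]; ring

theorem iteratedDeriv_two_zero {f : 𝕜 → 𝕜} (hf : IsQuadratic f) :
    iteratedDeriv 2 f 0 = f 1 + f (-1) - 2 * f 0 := by
  obtain ⟨k₀, k₁, k₂, h⟩ := hf
  have e1 : deriv f = fun t => k₁ + 2 * k₂ * t + 0 * t ^ 2 := by
    funext t
    rw [funext h, deriv_quadratic]; ring
  rw [iteratedDeriv_succ, iteratedDeriv_one, e1, deriv_quadratic, h, h, h]; ring

theorem add {f g : 𝕜 → 𝕜} (hf : IsQuadratic f) (hg : IsQuadratic g) :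
    IsQuadratic fun t => f t + g t := by
  obtain ⟨k₀, k₁, k₂, h⟩ := hf
  obtain ⟨l₀, l₁, l₂, h'⟩ := hg
  exact ⟨k₀ + l₀, k₁ + l₁, k₂ + l₂, fun t => by simp only [h, h']; ring⟩

theorem mul_const {f : 𝕜 → 𝕜} (hf : IsQuadratic f) (c : 𝕜) : IsQuadratic fun t => f t * c := by
  obtain ⟨k₀, k₁, k₂, h⟩ := hf
  exact ⟨k₀ * c, k₁ * c, k₂ * c, fun t => by simp only [h]; ring⟩

/-- A quadratic polynomial that vanishes near a point vanishes everywhere. -/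
theorem eq_zero_of_eventually {f : 𝕜 → 𝕜} (hf : IsQuadratic f) {t₀ : 𝕜}
    (h0 : ∀ᶠ t in 𝓝 t₀, f t = 0) (t : 𝕜) : f t = 0 := by
  obtain ⟨k₀, k₁, k₂, h⟩ := hf
  have ha : AnalyticOnNhd 𝕜 f Set.univ := by
    rw [funext h]; intro x _; fun_prop
  exact congrFun (ha.eq_of_eventuallyEq (g := fun _ => 0) (fun _ _ => analyticAt_const) h0) t

end IsQuadratic

theorem isQuadratic_h₁ (hQ : IsClassFPrime Q) (y : 𝕜) : IsQuadratic fun x => h₁ Q x y := by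
  simp only [hQ.h₁_symm _ y]
  exact hQ.h₁_quadratic y

theorem isQuadratic_h₂ (hQ : IsClassFPrime Q) (y : 𝕜) : IsQuadratic fun x => h₂ Q x y := by
  simp only [← h₁_transposeQ hQ]
  exact isQuadratic_h₁ hQ.transpose y

theorem isQuadratic_G (hQ : IsClassFPrime Q) (y : 𝕜) : IsQuadratic fun x => G Q x y := by
  simp only [hQ.G_symm _ y]
  exact hQ.G_quadratic y

/-- Derivatives of quadratic polynomials at `0` are differences of the values at `0, 1, -1`; this
makes the dependence of the entries on `y, z, w` visibly polynomial. -/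
theorem gMatrix_eq (hQ : IsClassFPrime Q) (y z w : 𝕜) : gMatrix Q (h₂ Q) y z w =
    !![h₂ Q 0 y, G Q 0 z, G Q 0 w;
       (h₂ Q 1 y - h₂ Q (-1) y) / 2, (G Q 1 z - G Q (-1) z) / 2, (G Q 1 w - G Q (-1) w) / 2;
       h₂ Q 1 y + h₂ Q (-1) y - 2 * h₂ Q 0 y, G Q 1 z + G Q (-1) z - 2 * G Q 0 z,
         G Q 1 w + G Q (-1) w - 2 * G Q 0 w] := by
  simp only [gMatrix, (isQuadratic_h₂ hQ _).deriv_zero, (isQuadratic_G hQ _).deriv_zero,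
    (isQuadratic_h₂ hQ _).iteratedDeriv_two_zero, (isQuadratic_G hQ _).iteratedDeriv_two_zero]

theorem contDiff_det_gMatrix (hQ : IsClassFPrime Q) :
    ContDiff 𝕜 ω fun p : Fin 3 → 𝕜 => (gMatrix Q (h₂ Q) (p 0) (p 1) (p 2)).det := by
  have H : ∀ a : 𝕜, ContDiff 𝕜 ω fun p : Fin 3 → 𝕜 => h₂ Q a (p 0) := by
    intro a
    simp only [← h₁_transposeQ hQ]
    exact contDiff_h₁ hQ.transpose (by fun_prop) (by fun_prop)
  have K : ∀ (a : 𝕜) (i : Fin 3), ContDiff 𝕜 ω fun p : Fin 3 → 𝕜 => G Q a (p i) :=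
    fun a i => contDiff_G hQ (by fun_prop) (by fun_prop)
  have H0 := H 0
  have H1 := H 1
  have H2 := H (-1)
  have K0 := K 0
  have K1 := K 1
  have K2 := K (-1)
  simp only [gMatrix_eq hQ, Matrix.det_fin_three, Matrix.of_apply, Matrix.cons_val]
  fun_prop

/-- By the identity theorem, an analytic function that vanishes near one point vanishes everywhere,
contrary to invertibility at some `y, z, w`. -/
theorem gMatrix_det_ne_zero (hQ : IsClassFPrime Q) (hG : GInvertible Q (h₂ Q)) (p₀ : Fin 3 → 𝕜) :
    ¬ ∀ᶠ p : Fin 3 → 𝕜 in 𝓝 p₀, (gMatrix Q (h₂ Q) (p 0) (p 1) (p 2)).det = 0 := by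
  intro h
  obtain ⟨y, z, w, hu⟩ := hG
  have ha := contDiff_omega_iff_analyticOnNhd.1 (contDiff_det_gMatrix hQ)
  have := congrFun (AnalyticOnNhd.eq_of_eventuallyEq ha (g := fun _ => 0)
    (fun _ _ => analyticAt_const) h) ![y, z, w]
  exact ((Matrix.isUnit_iff_isUnit_det _).1 hu).ne_zero this

/-- The form is quadratic in `x`, so it vanishes identically; the rows of the matrix yield its value
and its first two derivatives at `0`. -/
theorem gMatrix_mulVec_eq_zero (hQ : IsClassFPrime Q) {y z w a b c x₀ : 𝕜}
    (h : ∀ᶠ x in 𝓝 x₀, h₂ Q x y * a + G Q x z * b + G Q x w * c = 0) :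
    (gMatrix Q (h₂ Q) y z w).mulVec ![a, b, c] = 0 := by
  have h0 := IsQuadratic.eq_zero_of_eventually ((((isQuadratic_h₂ hQ y).mul_const a).add
    ((isQuadratic_G hQ z).mul_const b)).add ((isQuadratic_G hQ w).mul_const c)) h
  have e0 := h0 0
  have e1 := h0 1
  have e2 := h0 (-1)
  rw [gMatrix_eq hQ]
  ext i
  fin_cases i
  · simp [Matrix.mulVec, dotProduct, Fin.sum_univ_three]; linear_combination e0
  · simp [Matrix.mulVec, dotProduct, Fin.sum_univ_three]; linear_combination (e1 - e2) / 2
  · simp [Matrix.mulVec, dotProduct, Fin.sum_univ_three]; linear_combination e1 + e2 - 2 * e0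

/-! ### Constancy of the ratio -/

namespace SymmetryAlong

theorem eventually_fderiv_eq_zero (S : SymmetryAlong Q Ω R u) (n m : ℤ) :
    ∀ᶠ r in 𝓝 ![u n (m + 1), u (n + 1) (m + 1), u (n - 1) (m + 1)],
      fderiv 𝕜 (leftRatioRed Q (R n (m + 1)) (u n (m + 1 + 1)) (u n (m + 1 - 1))) r = 0 := by
  have hQ := S.isClass
  have hd := S.contDiffAt_leftRatioRed n (m + 1)
  have hg := S.eventually_gradient n m
  generalize leftRatioRed Q (R n (m + 1)) (u n (m + 1 + 1)) (u n (m + 1 - 1)) = F at hd hg ⊢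
  have hk : ∀ᶠ r in 𝓝 ![u n (m + 1), u (n + 1) (m + 1), u (n - 1) (m + 1)],
      ∀ i, (gMatrix Q (h₂ Q) (r 0) (r 1) (r 2)).det * fderiv 𝕜 F r (Pi.single i 1) = 0 := by
    filter_upwards [hg] with r hr
    have h1 := gMatrix_mulVec_eq_zero hQ hr
    -- Multiplication by the adjugate: the determinant annihilates the vector even where it is not
    -- invertible.
    have h2 : (gMatrix Q (h₂ Q) (r 0) (r 1) (r 2)).det • ![fderiv 𝕜 F r (Pi.single 0 1),
        -fderiv 𝕜 F r (Pi.single 1 1), -fderiv 𝕜 F r (Pi.single 2 1)] = 0 := by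
      rw [← Matrix.one_mulVec ![_, _, _], ← Matrix.smul_mulVec, ← Matrix.adjugate_mul,
        ← Matrix.mulVec_mulVec, h1, Matrix.mulVec_zero]
    intro i
    have h3 := congrFun h2 i
    fin_cases i <;> simpa using h3
  filter_upwards [hk.eventually_nhds, hd] with r hr hd
  have hz : ∀ i, fderiv 𝕜 F r (Pi.single i 1) = 0 := by
    intro i
    by_contra hne
    -- A nonzero partial derivative stays nonzero near `r`, and would force the determinant to
    -- vanish near `r`.
    have hc : ContinuousAt (fun r => fderiv 𝕜 F r (Pi.single i 1)) r :=
      (((hd.fderiv_right (m := 0) (by simp)).clm_apply contDiffAt_const)).continuousAt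
    refine gMatrix_det_ne_zero hQ S.gInvertible₂ r ?_
    filter_upwards [hc.eventually_ne hne, hr] with r' h1 h2
    exact (mul_eq_zero.1 (h2 i)).resolve_right h1
  refine ContinuousLinearMap.coe_injective ?_
  refine LinearMap.pi_ext' fun i => ?_
  ext
  simpa using hz i

theorem exists_eventually_leftRatio_eq_const (S : SymmetryAlong Q Ω R u) (n m : ℤ) :
    ∃ a : 𝕜, ∀ᶠ r in 𝓝 ![u n m, u (n + 1) m, u (n - 1) m],
      leftRatioRed Q (R n m) (u n (m + 1)) (u n (m - 1)) r = a := by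
  have h1 := S.eventually_fderiv_eq_zero n (m - 1)
  rw [sub_add_cancel] at h1
  have h2 := S.contDiffAt_leftRatioRed n m
  obtain ⟨ε, hε, hb⟩ := Metric.eventually_nhds_iff_ball.1 (h1.and h2)
  refine ⟨leftRatioRed Q (R n m) (u n (m + 1)) (u n (m - 1)) ![u n m, u (n + 1) m, u (n - 1) m],
    Metric.eventually_nhds_iff_ball.2 ⟨ε, hε, fun r hr => ?_⟩⟩
  exact IsOpen.is_const_of_fderiv_eq_zero (𝕜 := 𝕜) Metric.isOpen_ball
    (convex_ball _ _).isPreconnected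
    (fun r hr => ((hb r hr).2.differentiableAt (by simp)).differentiableWithinAt)
    (fun r hr => (hb r hr).1) hr (Metric.mem_ball_self hε)

/-- The constants at `(n, m)` and `(n, m+1)` agree because the shift identity holds at `u` itself;
induction on `m` in both directions removes `m`. -/
theorem exists_leftRatio_eq (S : SymmetryAlong Q Ω R u) :
    ∃ a : ℤ → 𝕜, ∀ n m, ∀ᶠ p in 𝓝 (cross u n m), leftRatio Q (R n m) p = a n := by
  choose a ha using S.exists_eventually_leftRatio_eq_const
  have step : ∀ n m, a n (m + 1) = a n m := by
    intro n m
    have h := (S.eventually_leftRatioRed_eq n m).self_of_nhds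
    simp only [Matrix.cons_val] at h
    have hr := S.regular_right n m
    have hl := S.regular_left n m
    rw [← (eq_cornerValue_iff S.isClass (hr.2 3)).2 hr.1,
      ← (eq_cornerValue_iff S.isClass (hl.2 3)).2 hl.1] at h
    rw [← (ha n m).self_of_nhds, ← (ha n (m + 1)).self_of_nhds, h]
  have const : ∀ n m, a n m = a n 0 := by
    intro n m
    induction m using Int.induction_on with
    | zero => rfl
    | succ k ih => rw [step, ih]
    | pred k ih => rw [← ih, ← step, sub_add_cancel]
  refine ⟨fun n => a n 0, fun n m => ?_⟩
  have T := tendsto_apply (cross u n m)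
  filter_upwards [S.eventually_leftRatio_eq_red n m,
    (tendsto_vec3 (T 0) (T 1) (T 3)).eventually (ha n m)] with p h1 h2
  rw [h1, h2, const]

end SymmetryAlong

/-! ### Transport along the symmetries of the lattice -/

/-- Rearrangement of the five arguments. -/
def rearrange (e : Fin 5 → Fin 5) : (Fin 5 → 𝕜) →L[𝕜] (Fin 5 → 𝕜) :=
  ContinuousLinearMap.pi fun i => ContinuousLinearMap.proj (e i)

theorem rearrange_apply (e : Fin 5 → Fin 5) (p : Fin 5 → 𝕜) :
    rearrange e p = fun i => p (e i) := rfl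

theorem rearrange_rearrange {e : Fin 5 → Fin 5} (he : ∀ i, e (e i) = i) (p : Fin 5 → 𝕜) :
    rearrange e (rearrange e p) = p := by
  funext i; simp only [rearrange_apply, he]

theorem slotDeriv_comp_rearrange {e : Fin 5 → Fin 5} (he : ∀ i, e (e i) = i)
    {F : (Fin 5 → 𝕜) → 𝕜} {p : Fin 5 → 𝕜} (hF : DifferentiableAt 𝕜 F (rearrange e p)) (i : Fin 5) :
    slotDeriv (fun p => F (rearrange e p)) i p = slotDeriv F (e i) (rearrange e p) := by
  have h : HasFDerivAt (fun p => F (rearrange e p))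
      ((fderiv 𝕜 F (rearrange e p)).comp (rearrange e)) p :=
    
    HasFDerivAt.comp p hF.hasFDerivAt (rearrange e : (Fin 5 → 𝕜) →L[𝕜] _).hasFDerivAt
  rw [slotDeriv, h.fderiv, slotDeriv, ContinuousLinearMap.comp_apply]
  congr 1
  funext j
  simp only [rearrange_apply, Pi.single_apply]
  refine if_congr ⟨fun h => ?_, fun h => ?_⟩ rfl rfl
  · rw [← h, he]
  · rw [h, he]

/-- The action on the five arguments of the interchange of the lattice directions. -/
def transposeIndex : Fin 5 → Fin 5 := ![0, 2, 1, 4, 3]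

/-- The action on the five arguments of the reflection of the first lattice direction. -/
def reflectIndex : Fin 5 → Fin 5 := ![0, 3, 2, 1, 4]

theorem transposeIndex_invol (i : Fin 5) : transposeIndex (transposeIndex i) = i := by
  fin_cases i <;> rfl

theorem reflectIndex_invol (i : Fin 5) : reflectIndex (reflectIndex i) = i := by
  fin_cases i <;> rfl

theorem rearrange_transpose_cross (w : ℤ → ℤ → 𝕜) (n m : ℤ) :
    rearrange transposeIndex (cross (fun i j => w j i) n m) = cross w m n := by
  funext i; fin_cases i <;> rfl

theorem rearrange_reflect_cross (w : ℤ → ℤ → 𝕜) (n m : ℤ) :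
    rearrange reflectIndex (cross (fun i j => w (-i) j) n m) = cross w (-n) m := by
  funext i
  fin_cases i
  · rfl
  · exact congrArg (fun k => w k m) (by ring)
  · rfl
  · exact congrArg (fun k => w k m) (by ring)
  · rfl

theorem solvesAt_transpose {w : ℤ → ℤ → 𝕜} {n m : ℤ} (h : SolvesAt Q w m n) :
    SolvesAt (transposeQ Q) (fun i j => w j i) n m := by
  refine ⟨h.1, fun i => ?_⟩
  have e := pd_transposeQ (Q := Q) (w m n) (w m (n + 1)) (w (m + 1) n) (w (m + 1) (n + 1))
  rw [quad]
  fin_cases i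
  · exact e.1 ▸ h.2 0
  · exact e.2.1 ▸ h.2 2
  · exact e.2.2.1 ▸ h.2 1
  · exact e.2.2.2 ▸ h.2 3

/-- A quadrilateral is labelled by its lower left vertex, so reflection sends the label `n` to `-n -
1`. -/
theorem solvesAt_reflect (hQ : IsClassFPrime Q) {w : ℤ → ℤ → 𝕜} {n n' m : ℤ} (hn : n + n' = -1)
    (h : SolvesAt Q w n' m) : SolvesAt Q (fun i j => w (-i) j) n m := by
  obtain rfl : n' = -n - 1 := by linarith
  simp only [SolvesAt, quad, sub_add_cancel] at h ⊢
  rw [neg_add']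
  exact mirror_regular hQ h

theorem transposeQ_transposeQ : transposeQ (transposeQ Q) = Q := by
  funext v
  exact congrArg Q (vec4_eta v)

theorem gInvertible_transpose_iff (hQ : IsClassFPrime Q) {h h' : 𝕜 → 𝕜 → 𝕜}
    (hh : ∀ x y, h x y = h' x y) : GInvertible Q h → GInvertible (transposeQ Q) h' := by
  rintro ⟨y, z, w, H⟩
  refine ⟨y, z, w, ?_⟩
  simp only [gMatrix, hh, G_transposeQ hQ] at H ⊢
  exact H

namespace SymmetryAlong

/-- The interchange of directions exchanges `h₁` with `h₂`, hence the two invertibility hypotheses.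
-/
theorem transpose (S : SymmetryAlong Q Ω R u) :
    SymmetryAlong (transposeQ Q) (fun n m => rearrange transposeIndex ⁻¹' Ω m n)
      (fun n m p => R m n (rearrange transposeIndex p)) (fun n m => u m n) where
  isClass := S.isClass.transpose
  gInvertible₁ := gInvertible_transpose_iff S.isClass
    (fun x y => (h₁_transposeQ S.isClass x y).symm) S.gInvertible₂
  gInvertible₂ := gInvertible_transpose_iff S.isClass
    (fun x y => (h₂_transposeQ S.isClass x y).symm) S.gInvertible₁
  isOpen n m := (S.isOpen m n).preimage (rearrange transposeIndex).continuous
  contDiffOn n m := (S.contDiffOn m n).comp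
    (rearrange transposeIndex : (Fin 5 → 𝕜) →L[𝕜] _).contDiff.contDiffOn fun _ hp => hp
  symmetry n m w hw := by
    have tr : ∀ n m, SolvesAt (transposeQ Q) w n m → SolvesAt Q (fun i j => w j i) m n := by
      intro n m h
      have := solvesAt_transpose h
      rwa [transposeQ_transposeQ] at this
    have tc : ∀ n m, rearrange transposeIndex (cross w n m) = cross (fun i j => w j i) m n :=
      fun n m => rearrange_transpose_cross (fun i j => w j i) n m
    have H : AdmissibleAt Q Ω m n (fun i j => w j i) :=
      ⟨tr _ _ hw.solves, tr _ _ hw.solves_up, tr _ _ hw.solves_right, tr _ _ hw.solves_down,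
        tr _ _ hw.solves_left, tc _ _ ▸ hw.mem₀₀, tc _ _ ▸ hw.mem₀₁, tc _ _ ▸ hw.mem₁₀,
        tc _ _ ▸ hw.mem₁₁⟩
    have key := S.symmetry m n _ H
    have e := pd_transposeQ (Q := Q) (w n m) (w (n + 1) m) (w n (m + 1)) (w (n + 1) (m + 1))
    rw [quad] at key
    simp only [tc]
    rw [quad, e.1, e.2.1, e.2.2.1, e.2.2.2]
    linear_combination key
  solves n m := solvesAt_transpose (S.solves m n)
  mem n m := by
    rw [Set.mem_preimage, rearrange_transpose_cross]
    exact S.mem m n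
  ne_n n m := S.ne_m m n
  ne_m n m := S.ne_n m n

/-- Reflection exchanges `u₁₀` and `u₋₁₀`, so a result on `∂R/∂u₋₁₀` becomes one on `∂R/∂u₁₀`. -/
theorem reflect (S : SymmetryAlong Q Ω R u) :
    SymmetryAlong Q (fun n m => rearrange reflectIndex ⁻¹' Ω (-n) m)
      (fun n m p => R (-n) m (rearrange reflectIndex p)) (fun n m => u (-n) m) where
  isClass := S.isClass
  gInvertible₁ := S.gInvertible₁
  gInvertible₂ := S.gInvertible₂
  isOpen n m := (S.isOpen (-n) m).preimage (rearrange reflectIndex).continuous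
  contDiffOn n m := (S.contDiffOn (-n) m).comp
    (rearrange reflectIndex : (Fin 5 → 𝕜) →L[𝕜] _).contDiff.contDiffOn fun _ hp => hp
  symmetry n m w hw := by
    have hQ := S.isClass
    have tc : ∀ n m, rearrange reflectIndex (cross w n m) = cross (fun i j => w (-i) j) (-n) m := by
      intro n m
      have := rearrange_reflect_cross (fun i j => w (-i) j) n m
      simpa only [neg_neg] using this
    obtain ⟨h1, h2, h3, h4, h5, m1, m2, m3, m4⟩ := hw
    simp only [Set.mem_preimage, tc, neg_add'] at m1 m2 m3 m4
    have H : AdmissibleAt Q Ω (-n - 1) m (fun i j => w (-i) j) :=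
      ⟨solvesAt_reflect hQ (by ring) h1, solvesAt_reflect hQ (by ring) h4,
        solvesAt_reflect hQ (by ring) h3, solvesAt_reflect hQ (by ring) h2,
        solvesAt_reflect hQ (by ring) h5, m2, by rwa [sub_add_cancel], m4,
        by rwa [sub_add_cancel]⟩
    have key := S.symmetry _ m _ H
    obtain ⟨τ, hτ, sn⟩ := hQ.pd_symm_n
    have e := sn (w n m) (w (n + 1) m) (w n (m + 1)) (w (n + 1) (m + 1))
    have eq : quad (fun i j => w (-i) j) (-n - 1) m =
        ![w (n + 1) m, w n m, w (n + 1) (m + 1), w n (m + 1)] := by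
      simp [quad, add_comm]
    rw [eq, sub_add_cancel] at key
    simp only [tc, neg_add']
    rw [quad, e.2.1, e.2.2.1, e.2.2.2.1, e.2.2.2.2]
    linear_combination τ * key
  solves n m := solvesAt_reflect S.isClass (by ring) (S.solves (-n - 1) m)
  mem n m := by
    rw [Set.mem_preimage, rearrange_reflect_cross]
    exact S.mem (-n) m
  ne_n n m := by
    have := S.ne_n (-n) m
    rw [neg_add', neg_sub', sub_neg_eq_add]
    exact this.symm
  ne_m n m := S.ne_m (-n) m

theorem eventually_h₁_ne_zero (S : SymmetryAlong Q Ω R u) (n m : ℤ) :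
    ∀ᶠ p in 𝓝 (cross u n m), h₁ Q (p 0) (p 1) ≠ 0 := by
  have hh : ContDiff 𝕜 0 (fun p : Fin 5 → 𝕜 => h₁ Q (p 0) (p 1)) :=
    contDiff_h₁ S.isClass (by fun_prop) (by fun_prop)
  exact (hh.continuous.tendsto (cross u n m)).eventually_ne
      (h₁_ne_zero S.isClass (S.solves n m).1 (S.solves n m).2)

theorem eventually_mem (S : SymmetryAlong Q Ω R u) (n m : ℤ) :
    ∀ᶠ p in 𝓝 (cross u n m), p ∈ Ω n m :=
  (S.isOpen n m).mem_nhds (S.mem n m)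

theorem exists_slotDeriv_three_eq (S : SymmetryAlong Q Ω R u) :
    ∃ a : ℤ → 𝕜, ∀ n m, ∀ᶠ p in 𝓝 (cross u n m),
      slotDeriv (R n m) 3 p * (p 1 - p 3) ^ 2 = a n * h₁ Q (p 0) (p 1) := by
  obtain ⟨a, ha⟩ := S.exists_leftRatio_eq
  refine ⟨a, fun n m => ?_⟩
  filter_upwards [ha n m, S.eventually_h₁_ne_zero n m] with p h1 h2
  rwa [leftRatio, div_eq_iff h2] at h1

theorem exists_slotDeriv_one_eq (S : SymmetryAlong Q Ω R u) :
    ∃ a : ℤ → 𝕜, ∀ n m, ∀ᶠ p in 𝓝 (cross u n m),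
      slotDeriv (R n m) 1 p * (p 1 - p 3) ^ 2 = a n * h₁ Q (p 0) (p 3) := by
  obtain ⟨a, ha⟩ := S.reflect.exists_slotDeriv_three_eq
  refine ⟨fun n => a (-n), fun n m => ?_⟩
  have ht : Tendsto (rearrange reflectIndex) (𝓝 (cross u n m))
      (𝓝 (cross (fun n m => u (-n) m) (-n) m)) := by
    have := (rearrange reflectIndex : (Fin 5 → 𝕜) →L[𝕜] _).continuous.tendsto (cross u n m)
    have e := rearrange_reflect_cross (fun n m => u (-n) m) n m
    simp only [neg_neg] at e
    rwa [e] at this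
  filter_upwards [ht.eventually (ha (-n) m), S.eventually_mem n m] with p hp hm
  rw [slotDeriv_comp_rearrange reflectIndex_invol (by
      rw [rearrange_rearrange reflectIndex_invol, neg_neg]; exact S.differentiableAt hm),
    rearrange_rearrange reflectIndex_invol, neg_neg] at hp
  simp only [rearrange_apply, reflectIndex, Matrix.cons_val] at hp
  linear_combination hp

end SymmetryAlong

/-! ### Derivatives of the characteristics of `v_n` and `v_m` -/

theorem IsQuadratic.deriv_eq {f : 𝕜 → 𝕜} (hf : IsQuadratic f) (t : 𝕜) :
    deriv f t = (f (t + 1) - f (t - 1)) / 2 := by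
  obtain ⟨k₀, k₁, k₂, h⟩ := hf
  have := congrArg (fun f => deriv f t) (funext h)
  simp only [deriv_quadratic] at this
  rw [this, h, h]; ring

theorem contDiffAt_charN (hQ : IsClassFPrime Q) {N : WithTop ℕ∞} {p : Fin 5 → 𝕜} (hp : p 1 ≠ p 3) :
    ContDiffAt 𝕜 N (charN Q) p := by
  have e : charN Q = fun p => h₁ Q (p 0) (p 1) / (p 1 - p 3)
      - 1 / 2 * ((h₁ Q (p 0) (p 1 + 1) - h₁ Q (p 0) (p 1 - 1)) / 2) := by
    funext p
    rw [charN, IsQuadratic.deriv_eq (hQ.h₁_quadratic (p 0))]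
  have H := fun (f g : (Fin 5 → 𝕜) → 𝕜) (hf : ContDiff 𝕜 N f) (hg : ContDiff 𝕜 N g) =>
    (contDiff_h₁ hQ hf hg).contDiffAt (x := p)
  have h1 := H (fun p => p 0) (fun p => p 1) (by fun_prop) (by fun_prop)
  have h2 := H (fun p => p 0) (fun p => p 1 + 1) (by fun_prop) (by fun_prop)
  have h3 := H (fun p => p 0) (fun p => p 1 - 1) (by fun_prop) (by fun_prop)
  have h4 : ContDiffAt 𝕜 N (fun p : Fin 5 → 𝕜 => p 1 - p 3) p := by fun_prop
  rw [e]
  exact (h1.div h4 (sub_ne_zero.2 hp)).sub (contDiffAt_const.mul ((h2.sub h3).div_const 2))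

theorem slotDeriv_eq_deriv {F : (Fin 5 → 𝕜) → 𝕜} {p : Fin 5 → 𝕜} (hF : DifferentiableAt 𝕜 F p)
    (i : Fin 5) : HasDerivAt (fun t => F (Function.update p i t)) (slotDeriv F i p) (p i) := by
  refine HasFDerivAt.comp_hasDerivAt (p i) ?_ (hasDerivAt_update p i (p i))
  rw [Function.update_eq_self]
  exact hF.hasFDerivAt

theorem slotDeriv_charN (hQ : IsClassFPrime Q) {p : Fin 5 → 𝕜} (hp : p 1 ≠ p 3) :
    slotDeriv (charN Q) 1 p = -(h₁ Q (p 0) (p 3) / (p 1 - p 3) ^ 2) ∧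
    slotDeriv (charN Q) 2 p = 0 ∧
    slotDeriv (charN Q) 3 p = h₁ Q (p 0) (p 1) / (p 1 - p 3) ^ 2 ∧
    slotDeriv (charN Q) 4 p = 0 := by
  have H := slotDeriv_eq_deriv ((contDiffAt_charN hQ hp (N := 1)).differentiableAt (by simp))
  have h0 : p 1 - p 3 ≠ 0 := sub_ne_zero.2 hp
  obtain ⟨k₀, k₁, k₂, h⟩ := hQ.h₁_quadratic (p 0)
  have e : ∀ q : Fin 5 → 𝕜, q 0 = p 0 → charN Q q = (k₀ + k₁ * q 1 + k₂ * q 1 ^ 2) / (q 1 - q 3)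
      - 1 / 2 * (k₁ + 2 * k₂ * q 1) := by
    intro q hq
    rw [charN, hq, funext h, deriv_quadratic]
  have H1 := H 1
  have H2 := H 2
  have H3 := H 3
  have H4 := H 4
  rw [funext fun t => e (Function.update p 1 t) rfl] at H1
  rw [funext fun t => e (Function.update p 2 t) rfl] at H2
  rw [funext fun t => e (Function.update p 3 t) rfl] at H3
  rw [funext fun t => e (Function.update p 4 t) rfl] at H4
  refine ⟨?_, ?_, ?_, ?_⟩
  · refine H1.unique ?_
    have d1 : HasDerivAt (fun t => k₀ + k₁ * t + k₂ * t ^ 2) (k₁ + 2 * k₂ * p 1) (p 1) := by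
      rw [← deriv_quadratic k₀]
      exact DifferentiableAt.hasDerivAt (by fun_prop)
    have d2 : HasDerivAt (fun t => t - p 3) 1 (p 1) := (hasDerivAt_id _).sub_const _
    have d3 : HasDerivAt (fun t => k₁ + 2 * k₂ * t) (2 * k₂) (p 1) := by
      simpa using ((hasDerivAt_id (p 1)).const_mul (2 * k₂)).const_add k₁
    have := (d1.fun_div d2 h0).fun_sub (d3.const_mul (1 / 2))
    refine this.congr_deriv ?_
    rw [h]
    field_simp
    ring
  · exact H2.unique (hasDerivAt_const (p 2) ((k₀ + k₁ * p 1 + k₂ * p 1 ^ 2) / (p 1 - p 3)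
      - 1 / 2 * (k₁ + 2 * k₂ * p 1)))
  · refine H3.unique ?_
    have d2 : HasDerivAt (fun t => p 1 - t) (-1) (p 3) := (hasDerivAt_id _).const_sub _
    have := ((hasDerivAt_const (p 3) (k₀ + k₁ * p 1 + k₂ * p 1 ^ 2)).fun_div d2 h0).fun_sub
      (hasDerivAt_const (p 3) (1 / 2 * (k₁ + 2 * k₂ * p 1)))
    refine this.congr_deriv ?_
    rw [h]
    ring
  · exact H4.unique (hasDerivAt_const (p 4) ((k₀ + k₁ * p 1 + k₂ * p 1 ^ 2) / (p 1 - p 3)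
      - 1 / 2 * (k₁ + 2 * k₂ * p 1)))

theorem charM_eq_charN (hQ : IsClassFPrime Q) :
    charM Q = fun p => charN (transposeQ Q) (rearrange transposeIndex p) := by
  funext p
  rw [charM_eq_polarN hQ, charN_eq_polarN]
  rfl

theorem contDiffAt_charM (hQ : IsClassFPrime Q) {N : WithTop ℕ∞} {p : Fin 5 → 𝕜} (hp : p 2 ≠ p 4) :
    ContDiffAt 𝕜 N (charM Q) p := by
  rw [charM_eq_charN hQ]
  exact ContDiffAt.comp (g := charN (transposeQ Q)) p (contDiffAt_charN hQ.transpose hp)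
    (rearrange transposeIndex : (Fin 5 → 𝕜) →L[𝕜] _).contDiff.contDiffAt

theorem slotDeriv_charM (hQ : IsClassFPrime Q) {p : Fin 5 → 𝕜} (hp : p 2 ≠ p 4) :
    slotDeriv (charM Q) 1 p = 0 ∧
    slotDeriv (charM Q) 2 p = -(h₂ Q (p 0) (p 4) / (p 2 - p 4) ^ 2) ∧
    slotDeriv (charM Q) 3 p = 0 ∧
    slotDeriv (charM Q) 4 p = h₂ Q (p 0) (p 2) / (p 2 - p 4) ^ 2 := by
  have hp' : rearrange transposeIndex p 1 ≠ rearrange transposeIndex p 3 := hp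
  have hd : DifferentiableAt 𝕜 (charN (transposeQ Q)) (rearrange transposeIndex p) :=
    (contDiffAt_charN hQ.transpose hp' (N := 1)).differentiableAt (by simp)
  obtain ⟨e1, e2, e3, e4⟩ := slotDeriv_charN hQ.transpose hp'
  rw [charM_eq_charN hQ]
  simp only [slotDeriv_comp_rearrange transposeIndex_invol hd]
  simp only [h₁_transposeQ hQ] at e1 e3
  exact ⟨e2, e1, e4, e3⟩

/-! ### Functions with vanishing partial derivatives -/

/-- A function whose derivative along `q - p` vanishes on a convex open set takes the same value at
`p` and `q`. -/
theorem eq_of_fderiv_sub_eq_zero {B : Set (Fin 5 → 𝕜)} (hB : Convex ℝ B) (hBo : IsOpen B)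
    {F : (Fin 5 → 𝕜) → 𝕜} (hF : ∀ r ∈ B, DifferentiableAt 𝕜 F r) {p q : Fin 5 → 𝕜} (hp : p ∈ B)
    (hq : q ∈ B) (h : ∀ r ∈ B, fderiv 𝕜 F r (q - p) = 0) : F q = F p := by
  set γ : 𝕜 → (Fin 5 → 𝕜) := fun t => p + t • (q - p) with hγ
  have hγc : Continuous γ := by fun_prop
  have hγd : ∀ t, HasDerivAt γ (q - p) t := fun t =>
    (((hasDerivAt_id t).smul_const (q - p)).const_add p).congr_deriv (one_smul _ _)
  -- The parameter runs over `𝕜`, so that only `𝕜`-derivatives occur; for `𝕜 = ℂ` the preimage is a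
  -- convex region of the plane rather than an interval.
  have hS : Convex ℝ (γ ⁻¹' B) := by
    intro s hs t ht a b ha hb hab
    have := hB hs ht ha hb hab
    have e : γ (a • s + b • t) = a • γ s + b • γ t := by
      simp only [hγ, add_smul, smul_assoc, smul_add]
      rw [add_add_add_comm, ← add_smul, hab, one_smul]
    rwa [Set.mem_preimage, e]
  have hd : ∀ t ∈ γ ⁻¹' B, HasDerivAt (fun t => F (γ t)) 0 t := fun t ht => by
    have := (hF _ ht).hasFDerivAt.comp_hasDerivAt t (hγd t)
    rwa [h _ ht] at this
  have key := IsOpen.is_const_of_deriv_eq_zero (hBo.preimage hγc) hS.isPreconnected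
    (fun t ht => (hd t ht).differentiableAt.differentiableWithinAt) (fun t ht => (hd t ht).deriv)
    (x := 1) (y := 0) (by simpa [hγ] using hq) (by simpa [hγ] using hp)
  simpa [hγ] using key

theorem fderiv_eq_zero_of_slotDeriv {F : (Fin 5 → 𝕜) → 𝕜} {r v : Fin 5 → 𝕜}
    (h : ∀ i, v i = 0 ∨ slotDeriv F i r = 0) : fderiv 𝕜 F r v = 0 := by
  have : v = ∑ i, v i • Pi.single i (1 : 𝕜) := by
    funext j; simp [Finset.sum_apply, Pi.single_apply]
  rw [this, map_sum]
  refine Finset.sum_eq_zero fun i _ => ?_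
  rw [map_smul, smul_eq_mul, mul_eq_zero]
  exact h i

theorem slotDeriv_sub {F H : (Fin 5 → 𝕜) → 𝕜} {p : Fin 5 → 𝕜} (hF : DifferentiableAt 𝕜 F p)
    (hH : DifferentiableAt 𝕜 H p) (i : Fin 5) :
    slotDeriv (fun p => F p - H p) i p = slotDeriv F i p - slotDeriv H i p := by
  rw [slotDeriv, fderiv_fun_sub hF hH]; rfl

/-- The alternative `a = 0` is needed for analytic `R`: then `Ω` may contain points with `u₁₀ =
u₋₁₀`, where only the product with `a` is harmless. -/
theorem differentiableAt_const_mul_charN (hQ : IsClassFPrime Q) {a : 𝕜} {p : Fin 5 → 𝕜}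
    (h : a = 0 ∨ p 1 ≠ p 3) : DifferentiableAt 𝕜 (fun p => a * charN Q p) p := by
  rcases h with rfl | h
  · simp
  · exact ((contDiffAt_charN hQ h (N := 1)).differentiableAt (by simp)).const_mul a

theorem differentiableAt_const_mul_charM (hQ : IsClassFPrime Q) {a : 𝕜} {p : Fin 5 → 𝕜}
    (h : a = 0 ∨ p 2 ≠ p 4) : DifferentiableAt 𝕜 (fun p => a * charM Q p) p := by
  rcases h with rfl | h
  · simp
  · exact ((contDiffAt_charM hQ h (N := 1)).differentiableAt (by simp)).const_mul a

theorem slotDeriv_const_mul {F : (Fin 5 → 𝕜) → 𝕜} {p : Fin 5 → 𝕜} {a : 𝕜}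
    (h : a = 0 ∨ DifferentiableAt 𝕜 F p) (i : Fin 5) :
    slotDeriv (fun p => a * F p) i p = a * slotDeriv F i p := by
  rcases h with rfl | h
  · simp [slotDeriv]
  · rw [slotDeriv, fderiv_const_mul h]; rfl

theorem slotDeriv_const_mul_charN (hQ : IsClassFPrime Q) {a : 𝕜} {p : Fin 5 → 𝕜}
    (h : a = 0 ∨ p 1 ≠ p 3) :
    slotDeriv (fun p => a * charN Q p) 1 p = -(a * (h₁ Q (p 0) (p 3) / (p 1 - p 3) ^ 2)) ∧
    slotDeriv (fun p => a * charN Q p) 2 p = 0 ∧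
    slotDeriv (fun p => a * charN Q p) 3 p = a * (h₁ Q (p 0) (p 1) / (p 1 - p 3) ^ 2) ∧
    slotDeriv (fun p => a * charN Q p) 4 p = 0 := by
  simp only [slotDeriv_const_mul (F := charN Q) (p := p) (a := a)
    (h.imp_right fun h => (contDiffAt_charN hQ h (N := 1)).differentiableAt (by simp))]
  rcases h with rfl | h
  · simp
  · obtain ⟨e1, e2, e3, e4⟩ := slotDeriv_charN hQ h
    rw [e1, e2, e3, e4]
    simp

theorem slotDeriv_const_mul_charM (hQ : IsClassFPrime Q) {a : 𝕜} {p : Fin 5 → 𝕜}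
    (h : a = 0 ∨ p 2 ≠ p 4) :
    slotDeriv (fun p => a * charM Q p) 1 p = 0 ∧
    slotDeriv (fun p => a * charM Q p) 2 p = -(a * (h₂ Q (p 0) (p 4) / (p 2 - p 4) ^ 2)) ∧
    slotDeriv (fun p => a * charM Q p) 3 p = 0 ∧
    slotDeriv (fun p => a * charM Q p) 4 p = a * (h₂ Q (p 0) (p 2) / (p 2 - p 4) ^ 2) := by
  simp only [slotDeriv_const_mul (F := charM Q) (p := p) (a := a)
    (h.imp_right fun h => (contDiffAt_charM hQ h (N := 1)).differentiableAt (by simp))]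
  rcases h with rfl | h
  · simp
  · obtain ⟨e1, e2, e3, e4⟩ := slotDeriv_charM hQ h
    rw [e1, e2, e3, e4]
    simp

/-! ### Matching the coefficients of `∂R/∂u₁₀` and `∂R/∂u₋₁₀` -/

namespace SymmetryAlong

theorem eventually_ne_n (S : SymmetryAlong Q Ω R u) (n m : ℤ) :
    ∀ᶠ p in 𝓝 (cross u n m), p 1 ≠ p 3 :=
  (isOpen_ne_fun (continuous_apply 1) (continuous_apply 3)).mem_nhds (S.ne_n n m)

theorem eventually_ne_m (S : SymmetryAlong Q Ω R u) (n m : ℤ) :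
    ∀ᶠ p in 𝓝 (cross u n m), p 2 ≠ p 4 :=
  (isOpen_ne_fun (continuous_apply 2) (continuous_apply 4)).mem_nhds (S.ne_m n m)

/-- `R - a χ` does not depend on `u₋₁₀`, hence neither does its derivative `c` with respect to
`u₁₀`. The formulas for the derivatives of `R` and `χ` give `(a + a') h₁(u₀₀, z) = c (u₁₀ - z)²` for
`z = u₋₁₀` in an open set. Both sides are quadratic in `z`, so `z = u₁₀` is allowed, and there `h₁ ≠
0`. -/
theorem coefficient_eq_neg (S : SymmetryAlong Q Ω R u) {n m : ℤ} {a a' : 𝕜}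
    (h3 : ∀ᶠ p in 𝓝 (cross u n m),
      slotDeriv (R n m) 3 p * (p 1 - p 3) ^ 2 = a * h₁ Q (p 0) (p 1))
    (h1 : ∀ᶠ p in 𝓝 (cross u n m),
      slotDeriv (R n m) 1 p * (p 1 - p 3) ^ 2 = a' * h₁ Q (p 0) (p 3)) : a' = -a := by
  have hQ := S.isClass
  obtain ⟨ε, hε, hb⟩ := Metric.eventually_nhds_iff_ball.1
    (((h3.and h1).and (S.eventually_mem n m)).and (S.eventually_ne_n n m))
  have hbase := Metric.mem_ball_self (x := cross u n m) hε
  set B := Metric.ball (cross u n m) ε with hB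
  set F : (Fin 5 → 𝕜) → 𝕜 := fun p => R n m p - a * charN Q p with hF
  have hd : ∀ r ∈ B, DifferentiableAt 𝕜 F r := fun r hr =>
    (S.differentiableAt (hb r hr).1.2).sub (differentiableAt_const_mul_charN hQ (.inr (hb r hr).2))
  have s3 : ∀ r ∈ B, slotDeriv F 3 r = 0 := by
    intro r hr
    obtain ⟨⟨⟨e, -⟩, hm⟩, hne⟩ := hb r hr
    rw [slotDeriv_sub (S.differentiableAt hm) (differentiableAt_const_mul_charN hQ (.inr hne)),
      (slotDeriv_const_mul_charN hQ (.inr hne)).2.2.1, ← mul_div_assoc, ← e,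
      mul_div_cancel_right₀ _ (pow_ne_zero 2 (sub_ne_zero.2 hne)), sub_self]
  have hconst : ∀ r ∈ B, ∀ z, Function.update r 3 z ∈ B → F (Function.update r 3 z) = F r := by
    intro r hr z hz
    refine eq_of_fderiv_sub_eq_zero (convex_ball _ _) Metric.isOpen_ball hd hr hz fun q hq =>
      fderiv_eq_zero_of_slotDeriv fun i => ?_
    by_cases hi : i = 3
    · exact .inr (hi ▸ s3 q hq)
    · left; simp [Function.update_of_ne hi]
  have s1 : ∀ z, Function.update (cross u n m) 3 z ∈ B →
      slotDeriv F 1 (Function.update (cross u n m) 3 z) = slotDeriv F 1 (cross u n m) := by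
    intro z hz
    refine (slotDeriv_eq_deriv (hd _ hz) 1).unique ?_
    have H := slotDeriv_eq_deriv (hd _ hbase) 1
    have e : Function.update (cross u n m) 3 z 1 = cross u n m 1 := rfl
    rw [e]
    -- The derivatives with respect to `u₁₀` at the two values of `u₋₁₀` agree because the functions
    -- of `u₁₀` agree near the base value.
    refine H.congr_of_eventuallyEq ?_
    have c1 : Tendsto (fun t => Function.update (cross u n m) 1 t) (𝓝 (cross u n m 1))
        (𝓝 (cross u n m)) := by
      have : Continuous (fun t => Function.update (cross u n m) 1 t) :=
        continuous_const.update 1 continuous_id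
      simpa using this.tendsto (cross u n m 1)
    have c2 : Tendsto (fun t => Function.update (Function.update (cross u n m) 3 z) 1 t)
        (𝓝 (cross u n m 1)) (𝓝 (Function.update (cross u n m) 3 z)) := by
      have : Continuous (fun t => Function.update (Function.update (cross u n m) 3 z) 1 t) :=
        continuous_const.update 1 continuous_id
      have h := this.tendsto (Function.update (cross u n m) 3 z 1)
      rwa [Function.update_eq_self] at h
    filter_upwards [c1.eventually_mem (Metric.isOpen_ball.mem_nhds hbase),
      c2.eventually_mem (Metric.isOpen_ball.mem_nhds hz)] with t ht1 ht2
    rw [Function.update_comm (by decide)] at ht2 ⊢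
    exact hconst _ ht1 z ht2
  have hz : ∀ᶠ z in 𝓝 (cross u n m 3), h₁ Q (cross u n m 0) z * (a + a')
      + (cross u n m 1 - z) ^ 2 * -slotDeriv F 1 (cross u n m) = 0 := by
    have c1 : Tendsto (fun t => Function.update (cross u n m) 3 t) (𝓝 (cross u n m 3))
        (𝓝 (cross u n m)) := by
      have : Continuous (fun t => Function.update (cross u n m) 3 t) :=
        continuous_const.update 3 continuous_id
      simpa using this.tendsto (cross u n m 3)
    filter_upwards [c1.eventually_mem (Metric.isOpen_ball.mem_nhds hbase)] with z hz
    obtain ⟨⟨⟨-, e⟩, hm⟩, hne⟩ := hb _ hz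
    have k1 := s1 z hz
    rw [slotDeriv_sub (S.differentiableAt hm) (differentiableAt_const_mul_charN hQ (.inr hne)),
      (slotDeriv_const_mul_charN hQ (.inr hne)).1, sub_neg_eq_add] at k1
    rw [← k1]
    have hne' := sub_ne_zero.2 hne
    have u3 : Function.update (cross u n m) 3 z 3 = z := by simp
    have u1 : Function.update (cross u n m) 3 z 1 = cross u n m 1 := rfl
    have u0 : Function.update (cross u n m) 3 z 0 = cross u n m 0 := rfl
    rw [u3, u1] at hne'
    rw [u3, u1, u0] at e
    rw [u3, u1, u0]
    field_simp
    linear_combination -e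
  have hq : IsQuadratic fun z => (cross u n m 1 - z) ^ 2 :=
    ⟨cross u n m 1 ^ 2, -2 * cross u n m 1, 1, fun t => by ring⟩
  have key := (((show IsQuadratic (fun z => h₁ Q (cross u n m 0) z) from
    hQ.h₁_quadratic (cross u n m 0)).mul_const (a + a')).add
    (hq.mul_const (-slotDeriv F 1 (cross u n m)))).eq_zero_of_eventually hz (cross u n m 1)
  have hne := (S.eventually_h₁_ne_zero n m).self_of_nhds
  have : h₁ Q (cross u n m 0) (cross u n m 1) * (a + a') = 0 := by linear_combination key
  linear_combination (mul_eq_zero.1 this).resolve_left hne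

theorem exists_slotDeriv_horizontal (S : SymmetryAlong Q Ω R u) :
    ∃ a : ℤ → 𝕜, ∀ n m, ∀ᶠ p in 𝓝 (cross u n m),
      slotDeriv (R n m) 3 p * (p 1 - p 3) ^ 2 = a n * h₁ Q (p 0) (p 1) ∧
      slotDeriv (R n m) 1 p * (p 1 - p 3) ^ 2 = -(a n * h₁ Q (p 0) (p 3)) := by
  obtain ⟨a, ha⟩ := S.exists_slotDeriv_three_eq
  obtain ⟨a', ha'⟩ := S.exists_slotDeriv_one_eq
  refine ⟨a, fun n m => (ha n m).and ((ha' n m).mono fun p hp => ?_)⟩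
  rw [hp, S.coefficient_eq_neg (ha n m) (ha' n m), neg_mul]

theorem exists_slotDeriv_vertical (S : SymmetryAlong Q Ω R u) :
    ∃ b : ℤ → 𝕜, ∀ n m, ∀ᶠ p in 𝓝 (cross u n m),
      slotDeriv (R n m) 4 p * (p 2 - p 4) ^ 2 = b m * h₂ Q (p 0) (p 2) ∧
      slotDeriv (R n m) 2 p * (p 2 - p 4) ^ 2 = -(b m * h₂ Q (p 0) (p 4)) := by
  obtain ⟨b, hb⟩ := S.transpose.exists_slotDeriv_horizontal
  refine ⟨b, fun n m => ?_⟩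
  have ht : Tendsto (rearrange transposeIndex) (𝓝 (cross u n m))
      (𝓝 (cross (fun n m => u m n) m n)) := by
    have := (rearrange transposeIndex : (Fin 5 → 𝕜) →L[𝕜] _).continuous.tendsto (cross u n m)
    rwa [show rearrange transposeIndex (cross u n m) = cross (fun n m => u m n) m n from
      rearrange_transpose_cross (fun n m => u m n) n m] at this
  filter_upwards [ht.eventually (hb m n), S.eventually_mem n m] with p hp hm
  have hd : DifferentiableAt 𝕜 (R n m) (rearrange transposeIndex (rearrange transposeIndex p)) := by
    rw [rearrange_rearrange transposeIndex_invol]; exact S.differentiableAt hm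
  rw [slotDeriv_comp_rearrange transposeIndex_invol hd,
    slotDeriv_comp_rearrange transposeIndex_invol hd,
    rearrange_rearrange transposeIndex_invol, h₁_transposeQ S.isClass,
    h₁_transposeQ S.isClass] at hp
  exact hp

end SymmetryAlong

/-! ### The remainder `ψ` and its determining equation -/

/-- The derivatives of `F` at `p` with respect to its last four arguments are those of
`a v_n + b v_m`, which is regular at `p`. -/
structure HasCombinationDeriv (Q : (Fin 4 → 𝕜) → 𝕜) (F : (Fin 5 → 𝕜) → 𝕜) (a b : 𝕜)
    (p : Fin 5 → 𝕜) : Prop where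
  regular_n : a = 0 ∨ p 1 ≠ p 3
  regular_m : b = 0 ∨ p 2 ≠ p 4
  one : slotDeriv F 1 p = -(a * (h₁ Q (p 0) (p 3) / (p 1 - p 3) ^ 2))
  two : slotDeriv F 2 p = -(b * (h₂ Q (p 0) (p 4) / (p 2 - p 4) ^ 2))
  three : slotDeriv F 3 p = a * (h₁ Q (p 0) (p 1) / (p 1 - p 3) ^ 2)
  four : slotDeriv F 4 p = b * (h₂ Q (p 0) (p 2) / (p 2 - p 4) ^ 2)

/-- What is left of `F` after the subtraction of `a v_n + b v_m`. -/
def residual (Q : (Fin 4 → 𝕜) → 𝕜) (F : (Fin 5 → 𝕜) → 𝕜) (a b : 𝕜) (p : Fin 5 → 𝕜) : 𝕜 :=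
  F p - a * charN Q p - b * charM Q p

theorem HasCombinationDeriv.slotDeriv_residual (hQ : IsClassFPrime Q) {F : (Fin 5 → 𝕜) → 𝕜}
    {a b : 𝕜} {p : Fin 5 → 𝕜} (hF : DifferentiableAt 𝕜 F p) (h : HasCombinationDeriv Q F a b p) :
    DifferentiableAt 𝕜 (residual Q F a b) p ∧
      ∀ i, i ≠ 0 → slotDeriv (residual Q F a b) i p = 0 := by
  have hN := differentiableAt_const_mul_charN hQ h.regular_n
  have hM := differentiableAt_const_mul_charM hQ h.regular_m
  obtain ⟨n1, n2, n3, n4⟩ := slotDeriv_const_mul_charN hQ h.regular_n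
  obtain ⟨m1, m2, m3, m4⟩ := slotDeriv_const_mul_charM hQ h.regular_m
  refine ⟨(hF.sub hN).sub hM, fun i hi => ?_⟩
  have e : slotDeriv (residual Q F a b) i p = slotDeriv F i p
      - slotDeriv (fun p => a * charN Q p) i p - slotDeriv (fun p => b * charM Q p) i p := by
    rw [← slotDeriv_sub hF hN, ← slotDeriv_sub (F := fun p => F p - a * charN Q p) (hF.sub hN) hM]
    rfl
  rw [e]
  fin_cases i
  · exact absurd rfl hi
  · exact (by rw [h.one, n1, m1]; ring :
      slotDeriv F 1 p - slotDeriv (fun p => a * charN Q p) 1 p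
        - slotDeriv (fun p => b * charM Q p) 1 p = 0)
  · exact (by rw [h.two, n2, m2]; ring :
      slotDeriv F 2 p - slotDeriv (fun p => a * charN Q p) 2 p
        - slotDeriv (fun p => b * charM Q p) 2 p = 0)
  · exact (by rw [h.three, n3, m3]; ring :
      slotDeriv F 3 p - slotDeriv (fun p => a * charN Q p) 3 p
        - slotDeriv (fun p => b * charM Q p) 3 p = 0)
  · exact (by rw [h.four, n4, m4]; ring :
      slotDeriv F 4 p - slotDeriv (fun p => a * charN Q p) 4 p
        - slotDeriv (fun p => b * charM Q p) 4 p = 0)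

/-- A function that depends locally on the first argument only does so on every set with connected
slices. -/
theorem exists_eq_comp_apply_zero {U : Set (Fin 5 → 𝕜)} (hU : IsOpen U)
    (hs : ∀ s, IsPreconnected {p | p ∈ U ∧ p 0 = s}) {C : (Fin 5 → 𝕜) → 𝕜}
    (hC : ∀ p ∈ U, DifferentiableAt 𝕜 C p ∧ ∀ i, i ≠ 0 → slotDeriv C i p = 0) :
    ∃ φ : 𝕜 → 𝕜, ∀ p ∈ U, C p = φ (p 0) := by
  have key : ∀ p ∈ U, ∀ q ∈ U, q 0 = p 0 → C q = C p := by
    intro p hp q hq h0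
    have : PreconnectedSpace {r | r ∈ U ∧ r 0 = p 0} :=
      isPreconnected_iff_preconnectedSpace.1 (hs (p 0))
    -- Two points of one slice have equal first coordinates, so only the vanishing derivatives enter
    -- along the segment in a small ball.
    have hloc : IsLocallyConstant fun r : {r | r ∈ U ∧ r 0 = p 0} => C r := by
      rw [IsLocallyConstant.iff_eventually_eq]
      rintro ⟨r, hr, hr0⟩
      obtain ⟨ε, hε, hb⟩ := Metric.isOpen_iff.1 hU r hr
      have hmem : ∀ᶠ q : {r | r ∈ U ∧ r 0 = p 0} in 𝓝 ⟨r, hr, hr0⟩, (q : Fin 5 → 𝕜) ∈ Metric.ball r ε :=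
        (continuous_subtype_val.tendsto _).eventually_mem (Metric.ball_mem_nhds r hε)
      filter_upwards [hmem] with q hq
      refine eq_of_fderiv_sub_eq_zero (convex_ball r ε) Metric.isOpen_ball
        (fun s hs => (hC s (hb hs)).1) (Metric.mem_ball_self hε) hq fun s hs =>
        fderiv_eq_zero_of_slotDeriv fun i => ?_
      by_cases hi : i = 0
      · left
        rw [hi, Pi.sub_apply, q.2.2, hr0, sub_self]
      · exact .inr ((hC s (hb hs)).2 i hi)
    exact hloc.apply_eq_of_preconnectedSpace ⟨q, hq, h0⟩ ⟨p, hp, rfl⟩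
  classical
  -- The value `0` is taken at those `s` whose slice is empty.
  refine ⟨fun s => if h : ∃ p ∈ U, p 0 = s then C h.choose else 0, fun p hp => ?_⟩
  have h : ∃ q ∈ U, q 0 = p 0 := ⟨p, hp, rfl⟩
  simp only [dif_pos h]
  exact (key p hp _ h.choose_spec.1 h.choose_spec.2).symm

namespace SymmetryAlong

/-- The set `U` is either all of `Ω` or a small ball at each lattice point; its connected slices
make the remainder a function of `u₀₀` alone. The determining equation near `u` follows from that at
admissible values, by extending a given quadrilateral to a patch. -/
theorem exists_combination (S : SymmetryAlong Q Ω R u) {a b : ℤ → 𝕜}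
    {U : ℤ → ℤ → Set (Fin 5 → 𝕜)} (hU : ∀ n m, IsOpen (U n m)) (hUΩ : ∀ n m, U n m ⊆ Ω n m)
    (huU : ∀ n m, cross u n m ∈ U n m)
    (hs : ∀ n m s, IsPreconnected {p | p ∈ U n m ∧ p 0 = s})
    (hd : ∀ n m, ∀ p ∈ U n m, HasCombinationDeriv Q (R n m) (a n) (b m) p) :
    ∃ ψ : ℤ → ℤ → 𝕜 → 𝕜, (∀ n m, ∀ p ∈ U n m, R n m p = combination Q a b ψ n m p) ∧
      (∀ n m w, AdmissibleAt Q U n m w → DeterminingEq Q a b ψ n m (quad w n m)) ∧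
      ∀ n m, ∀ᶠ v in 𝓝 (quad u n m), Q v = 0 → DeterminingEq Q a b ψ n m v := by
  have hQ := S.isClass
  have hex := fun n m => exists_eq_comp_apply_zero (hU n m) (hs n m)
    (C := residual Q (R n m) (a n) (b m)) fun p hp =>
      (hd n m p hp).slotDeriv_residual hQ (S.differentiableAt (hUΩ n m hp))
  choose φ hφ using hex
  have hcomb : ∀ n m, ∀ p ∈ U n m,
      R n m p = combination Q a b (fun n m s => 2 * φ n m s) n m p := by
    intro n m p hp
    have := hφ n m p hp
    rw [residual] at this
    rw [combination]
    linear_combination this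
  have hsymm : IsFivePointSymmetry Q U R := fun n m w hw => S.symmetry n m w
    ⟨hw.solves, hw.solves_right, hw.solves_up, hw.solves_left, hw.solves_down, hUΩ _ _ hw.mem₀₀,
      hUΩ _ _ hw.mem₁₀, hUΩ _ _ hw.mem₀₁, hUΩ _ _ hw.mem₁₁⟩
  have hdet : ∀ n m w, AdmissibleAt Q U n m w →
      DeterminingEq Q a b (fun n m s => 2 * φ n m s) n m (quad w n m) := fun n m w hw =>
    determiningEq_of_admissibleAt hQ hsymm hcomb (fun n m p hp => (hd n m p hp).regular_n)
      (fun n m p hp => (hd n m p hp).regular_m) hw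
  refine ⟨_, hcomb, hdet, fun n m => ?_⟩
  have T := tendsto_apply (quad u n m)
  have c := fun a : 𝕜 => tendsto_const_nhds (x := a) (f := 𝓝 (quad u n m))
  have h3 : ∀ᶠ v in 𝓝 (quad u n m), pd Q 3 v ≠ 0 :=
    ((hQ.continuous_pd 3).tendsto _).eventually_ne ((S.solves n m).2 3)
  -- The values outside the quadrilateral are frozen at those of `u`; the fourth corner of the patch
  -- is then `v 3` because `Q v = 0`.
  filter_upwards [h3, (tendsto_vec6 (T 0) (T 1) (T 2) (c (u (n - 1) m)) (c (u n (m - 1)))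
    (c (u n (m + 1 + 1)))).eventually (eventually_admissibleAt hQ hU S.solves huU n m)]
    with v h3 hadm hv
  have key := hdet n m _ hadm
  rw [quad_translate, sub_self, sub_self, quad_patch] at key
  simp only [Matrix.cons_val] at key
  have e := vec4_eta v
  rw [← e] at h3 hv
  rwa [← (eq_cornerValue_iff hQ h3).2 hv, e] at key

end SymmetryAlong

/-! ### Analytic continuation -/

theorem eq_mul_div_sq {d k a h : 𝕜} (hk : k ≠ 0) (e : d * k ^ 2 = a * h) : d = a * (h / k ^ 2) := by
  rw [← mul_div_assoc, ← e, mul_div_cancel_right₀ _ (pow_ne_zero 2 hk)]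

theorem eq_neg_mul_div_sq {d k a h : 𝕜} (hk : k ≠ 0) (e : d * k ^ 2 = -(a * h)) :
    d = -(a * (h / k ^ 2)) := by
  rw [← neg_mul] at e ⊢
  exact eq_mul_div_sq hk e

theorem analyticOnNhd_slotDeriv {U : Set (Fin 5 → 𝕜)} {F : (Fin 5 → 𝕜) → 𝕜}
    (hF : AnalyticOnNhd 𝕜 F U) (i : Fin 5) : AnalyticOnNhd 𝕜 (slotDeriv F i) U :=
  (ContinuousLinearMap.apply 𝕜 𝕜 (Pi.single i 1 : Fin 5 → 𝕜)).comp_analyticOnNhd hF.fderiv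

/-- Analytic continuation of the formulas for two partial derivatives. -/
theorem slotDeriv_eq_of_analyticOnNhd {U : Set (Fin 5 → 𝕜)} (hU : IsOpen U)
    (hUc : IsPreconnected U) {F : (Fin 5 → 𝕜) → 𝕜} (hF : AnalyticOnNhd 𝕜 F U) {h : 𝕜 → 𝕜 → 𝕜}
    (hh : ContDiff 𝕜 ω fun q : 𝕜 × 𝕜 => h q.1 q.2) {i j : Fin 5} (hi : i ≠ 0) (hj : j ≠ 0)
    (hij : i ≠ j) {a : 𝕜} {p₀ : Fin 5 → 𝕜} (hp₀ : p₀ ∈ U) (hne : p₀ i ≠ p₀ j)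
    (h0 : h (p₀ 0) (p₀ i) ≠ 0)
    (he : ∀ᶠ p in 𝓝 p₀, slotDeriv F j p * (p i - p j) ^ 2 = a * h (p 0) (p i) ∧
      slotDeriv F i p * (p i - p j) ^ 2 = -(a * h (p 0) (p j))) {p : Fin 5 → 𝕜} (hp : p ∈ U) :
    (a = 0 ∨ p i ≠ p j) ∧ slotDeriv F i p = -(a * (h (p 0) (p j) / (p i - p j) ^ 2)) ∧
      slotDeriv F j p = a * (h (p 0) (p i) / (p i - p j) ^ 2) := by
  have hFi := analyticOnNhd_slotDeriv hF i
  have hFj := analyticOnNhd_slotDeriv hF j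
  have hev : ∀ᶠ p in 𝓝 p₀, p i ≠ p j :=
    (isOpen_ne_fun (continuous_apply i) (continuous_apply j)).mem_nhds hne
  -- If `a = 0`, `U` may meet the hyperplane `p i = p j`, where one cannot divide; the derivatives
  -- themselves are continued from the zero function instead.
  by_cases ha : a = 0
  · subst ha
    have z : ∀ k, (AnalyticOnNhd 𝕜 (slotDeriv F k) U) →
        (∀ᶠ p in 𝓝 p₀, slotDeriv F k p * (p i - p j) ^ 2 = 0) → slotDeriv F k p = 0 := by
      intro k hk hz
      refine hk.eqOn_of_preconnected_of_eventuallyEq (g := fun _ => 0)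
        (fun _ _ => analyticAt_const) hUc hp₀ ?_ hp
      filter_upwards [hz, hev] with q h1 h2
      exact (mul_eq_zero.1 h1).resolve_right (pow_ne_zero 2 (sub_ne_zero.2 h2))
    refine ⟨.inl rfl, ?_, ?_⟩
    · rw [z i hFi (he.mono fun q hq => by simpa using hq.2)]; simp
    · rw [z j hFj (he.mono fun q hq => by simpa using hq.1)]; simp
  have hsub : AnalyticOnNhd 𝕜 (fun p : Fin 5 → 𝕜 => (p i - p j) ^ 2) U := by
    have : ContDiff 𝕜 ω (fun p : Fin 5 → 𝕜 => (p i - p j) ^ 2) := by fun_prop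
    exact fun p _ => contDiff_omega_iff_analyticOnNhd.1 this p trivial
  have hhk : ∀ k, AnalyticOnNhd 𝕜 (fun p : Fin 5 → 𝕜 => h (p 0) (p k)) U := by
    intro k p _
    have : ContDiff 𝕜 ω (fun p : Fin 5 → 𝕜 => h (p 0) (p k)) :=
      hh.comp (f := fun p : Fin 5 → 𝕜 => (p 0, p k)) (by fun_prop)
    exact contDiff_omega_iff_analyticOnNhd.1 this p trivial
  have ej : ∀ q ∈ U, slotDeriv F j q * (q i - q j) ^ 2 = a * h (q 0) (q i) := fun q hq =>
    (hFj.mul hsub).eqOn_of_preconnected_of_eventuallyEq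
      (g := fun q => a * h (q 0) (q i)) (analyticOnNhd_const.mul (hhk i)) hUc hp₀
      (he.mono fun q hq => hq.1) hq
  have ei : ∀ q ∈ U, slotDeriv F i q * (q i - q j) ^ 2 = -(a * h (q 0) (q j)) := fun q hq =>
    (hFi.mul hsub).eqOn_of_preconnected_of_eventuallyEq
      (g := fun q => -(a * h (q 0) (q j))) (analyticOnNhd_const.mul (hhk j)).neg hUc hp₀
      (he.mono fun q hq => hq.2) hq
  -- If `U` met the hyperplane with `a ≠ 0`, then `a * h = 0` on a relatively open part of it. There
  -- `p 0` and `p i` vary freely, so `h` would vanish near a point, hence identically, contrary to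
  -- `h0`.
  have hpne : p i ≠ p j := by
    intro hpij
    have hc : Continuous fun q : 𝕜 × 𝕜 =>
        Function.update (Function.update (Function.update p 0 q.1) i q.2) j q.2 := by
      have c1 : Continuous fun q : 𝕜 × 𝕜 => Function.update p 0 q.1 :=
        continuous_const.update 0 continuous_fst
      have c2 : Continuous fun q : 𝕜 × 𝕜 => Function.update (Function.update p 0 q.1) i q.2 :=
        c1.update i continuous_snd
      exact c2.update j continuous_snd
    have hbase : Function.update (Function.update (Function.update p 0 (p 0)) i (p i)) j (p i)
        = p := by
      rw [Function.update_eq_self, Function.update_eq_self, hpij, Function.update_eq_self]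
    have hmem := (hc.tendsto (p 0, p i)).eventually_mem (s := U) (by
      simp only [hbase]; exact hU.mem_nhds hp)
    have hzero : ∀ᶠ q : 𝕜 × 𝕜 in 𝓝 (p 0, p i), h q.1 q.2 = 0 := by
      filter_upwards [hmem] with q hq
      have := ej _ hq
      rw [Function.update_self, Function.update_of_ne hij, Function.update_self, sub_self,
        Function.update_of_ne hj.symm, Function.update_of_ne hi.symm, Function.update_self] at this
      simp only [ne_eq, OfNat.ofNat_ne_zero, not_false_eq_true, zero_pow, mul_zero] at this
      exact (mul_eq_zero.1 this.symm).resolve_left ha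
    have := congrFun ((contDiff_omega_iff_analyticOnNhd.1 hh).eq_of_eventuallyEq
      (g := fun _ => 0) (fun _ _ => analyticAt_const) hzero) (p₀ 0, p₀ i)
    exact h0 this
  exact ⟨.inr hpne, eq_neg_mul_div_sq (sub_ne_zero.2 hpne) (ei p hp),
    eq_mul_div_sq (sub_ne_zero.2 hpne) (ej p hp)⟩

end QuadLattice

end

/-! ### The theorem -/

theorem proposition5 {𝕜 : Type*} [RCLike 𝕜] (Q : (Fin 4 → 𝕜) → 𝕜)
    (hQ : QuadLattice.IsClassFPrime Q)
    (hG₁ : QuadLattice.GInvertible Q (QuadLattice.h₁ Q))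
    (hG₂ : QuadLattice.GInvertible Q (QuadLattice.h₂ Q))
    (Ω : ℤ → ℤ → Set (Fin 5 → 𝕜)) (hΩ : ∀ n m, IsOpen (Ω n m))
    (R : ℤ → ℤ → (Fin 5 → 𝕜) → 𝕜) (hR : ∀ n m, ContDiffOn 𝕜 ∞ (R n m) (Ω n m))
    (hsymm : QuadLattice.IsFivePointSymmetry Q Ω R)
    (u : ℤ → ℤ → 𝕜) (hu : ∀ n m, QuadLattice.SolvesAt Q u n m)
    (huΩ : ∀ n m, QuadLattice.cross u n m ∈ Ω n m)
    (hun : ∀ n m, u (n + 1) m ≠ u (n - 1) m) (hum : ∀ n m, u n (m + 1) ≠ u n (m - 1)) :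
    ∃ (a b : ℤ → 𝕜) (ψ : ℤ → ℤ → 𝕜 → 𝕜),
      (∀ n m, ∀ᶠ p in 𝓝 (QuadLattice.cross u n m),
        R n m p = QuadLattice.combination Q a b ψ n m p) ∧
      (∀ n m, ∀ᶠ v in 𝓝 (QuadLattice.quad u n m),
        Q v = 0 → QuadLattice.DeterminingEq Q a b ψ n m v) ∧
      ((∀ n m, AnalyticOnNhd 𝕜 (R n m) (Ω n m)) →
        (∀ n m, IsPreconnected (Ω n m)) →
        (∀ n m s, IsPreconnected {p | p ∈ Ω n m ∧ p 0 = s}) →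
        (∀ n m, ∀ p ∈ Ω n m, p 1 ≠ p 3 → p 2 ≠ p 4 →
          R n m p = QuadLattice.combination Q a b ψ n m p) ∧
        (∀ n m w, QuadLattice.AdmissibleAt Q Ω n m w →
          QuadLattice.DeterminingEq Q a b ψ n m (QuadLattice.quad w n m))) := by
  have S : QuadLattice.SymmetryAlong Q Ω R u := ⟨hQ, hG₁, hG₂, hΩ, hR, hsymm, hu, huΩ, hun, hum⟩
  obtain ⟨a, ha⟩ := S.exists_slotDeriv_horizontal
  obtain ⟨b, hb⟩ := S.exists_slotDeriv_vertical
  -- The same `ψ` has to serve the local and the global claims. Under the analytic hypotheses it is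
  -- built on all of `Ω`; otherwise it is built on balls, and the global claim is vacuous.
  by_cases H : (∀ n m, AnalyticOnNhd 𝕜 (R n m) (Ω n m)) ∧ (∀ n m, IsPreconnected (Ω n m)) ∧
      ∀ n m s, IsPreconnected {p | p ∈ Ω n m ∧ p 0 = s}
  · obtain ⟨hA, hc, hs⟩ := H
    have hd : ∀ n m, ∀ p ∈ Ω n m, QuadLattice.HasCombinationDeriv Q (R n m) (a n) (b m) p := by
      intro n m p hp
      obtain ⟨r1, e1, e3⟩ := QuadLattice.slotDeriv_eq_of_analyticOnNhd (hΩ n m) (hc n m) (hA n m)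
        (QuadLattice.contDiff_h₁ hQ contDiff_fst contDiff_snd) (i := 1) (j := 3) (by decide)
        (by decide) (by decide) (huΩ n m) (hun n m) (S.eventually_h₁_ne_zero n m).self_of_nhds
        (ha n m) hp
      have h2 := QuadLattice.contDiff_h₁ hQ.transpose (N := ω) (𝕜 := 𝕜)
        (contDiff_fst (E := 𝕜) (F := 𝕜)) contDiff_snd
      simp only [QuadLattice.h₁_transposeQ hQ] at h2
      have h20 := S.transpose.eventually_h₁_ne_zero m n |>.self_of_nhds
      rw [QuadLattice.h₁_transposeQ hQ] at h20
      obtain ⟨r2, e2, e4⟩ := QuadLattice.slotDeriv_eq_of_analyticOnNhd (hΩ n m) (hc n m) (hA n m)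
        h2 (i := 2) (j := 4) (by decide) (by decide) (by decide) (huΩ n m) (hum n m) h20
        (hb n m) hp
      exact ⟨r1, r2, e1, e2, e3, e4⟩
    obtain ⟨ψ, h1, h2, h3⟩ := S.exists_combination hΩ (fun n m => subset_rfl) huΩ hs hd
    exact ⟨a, b, ψ, fun n m => (S.eventually_mem n m).mono fun p hp => h1 n m p hp, h3,
      fun _ _ _ => ⟨fun n m p hp _ _ => h1 n m p hp, h2⟩⟩
  · have hball : ∀ n m, ∃ ε > 0, ∀ p ∈ Metric.ball (QuadLattice.cross u n m) ε,
        p ∈ Ω n m ∧ QuadLattice.HasCombinationDeriv Q (R n m) (a n) (b m) p := by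
      intro n m
      refine Metric.eventually_nhds_iff_ball.1 ?_
      filter_upwards [S.eventually_mem n m, ha n m, hb n m, S.eventually_ne_n n m,
        S.eventually_ne_m n m] with p hp h1 h2 h3 h4
      exact ⟨hp, .inr h3, .inr h4, QuadLattice.eq_neg_mul_div_sq (sub_ne_zero.2 h3) h1.2,
        QuadLattice.eq_neg_mul_div_sq (sub_ne_zero.2 h4) h2.2,
        QuadLattice.eq_mul_div_sq (sub_ne_zero.2 h3) h1.1,
        QuadLattice.eq_mul_div_sq (sub_ne_zero.2 h4) h2.1⟩
    choose ε hε hball using hball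
    have hs : ∀ n m s, IsPreconnected
        {p | p ∈ Metric.ball (QuadLattice.cross u n m) (ε n m) ∧ p 0 = s} := by
      intro n m s
      have hconv : Convex ℝ {p : Fin 5 → 𝕜 | p 0 = s} := by
        intro p (hp : p 0 = s) q (hq : q 0 = s) c d _ _ hcd
        change (c • p + d • q) 0 = s
        rw [Pi.add_apply, Pi.smul_apply, Pi.smul_apply, hp, hq, ← add_smul, hcd, one_smul]
      exact ((convex_ball _ _).inter hconv).isPreconnected
    obtain ⟨ψ, h1, -, h3⟩ := S.exists_combination (fun n m => Metric.isOpen_ball)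
      (fun n m p hp => (hball n m p hp).1) (fun n m => Metric.mem_ball_self (hε n m)) hs
      fun n m p hp => (hball n m p hp).2
    exact ⟨a, b, ψ, fun n m => (Metric.ball_mem_nhds _ (hε n m) : _ ∈ _) |> fun h =>
      Filter.mem_of_superset h fun p hp => h1 n m p hp, h3,
      fun hA hc hs => absurd ⟨hA, hc, hs⟩ H⟩
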